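/- Write $\langle x\rangle=(1+|x|^2)^{1/2}$. Let $V:\mathbb R^3\to\mathbb R$ be bounded with $V(x)\to0$ as $|x|\to\infty$, and let $A:\mathbb R^3\to\mathbb R^3$ be a vector field with $\operatorname{div}A=0$. Assume that there are constants $C$ and $\varepsilon>0$ such that $$|\nabla V(x)|,\ |A(x)|,\ |DA(x)|\ \le\ C\langle x\rangle^{-1-\varepsilon}\qquad\text{for almost every }x\in\mathbb R^3,$$ where $\nabla V$, $DA$ and $\operatorname{div}A$ may be understood in the weak (distributional) sense. Consider on $L^2(\mathbb R^3;\mathbb C)$ the operator $$H=-\Delta+\tfrac i2(A\cdot\nabla+\nabla\cdot A)+V$$ with domain the Sobolev space $H^2(\mathbb R^3)$, where $(\nabla\cdot A)\psi=\nabla\cdot(A\psi)$. Then $H$ has no positive eigenvalues: if $E>0$, $\psi\in H^2(\mathbb R^3)$ and $H\psi=E\psi$, then $\psi=0$. -/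

import Mathlib

open MeasureTheory Filter Topology
open scoped ContDiff

/-- Three-dimensional Euclidean space `ℝ³`. -/
abbrev R3 : Type := EuclideanSpace ℝ (Fin 3)

/-- The `j`-th standard basis vector of `ℝ³`. -/
noncomputable abbrev stdVec (j : Fin 3) : R3 := EuclideanSpace.single j (1 : ℝ)

/-- The Japanese bracket `⟨x⟩ = (1 + |x|²)^{1/2}`. -/
noncomputable def japaneseBracket (x : R3) : ℝ := Real.sqrt (1 + ‖x‖ ^ 2)

/-- Real-valued test functions `φ ∈ C_c^∞(ℝ³)`. -/
def IsTestFun (φ : R3 → ℝ) : Prop := ContDiff ℝ ∞ φ ∧ HasCompactSupport φ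

/-- `f' : ℝ³ → L(ℝ³, F)` is the weak (distributional) total derivative of `f : ℝ³ → F`:
both are locally integrable and, for all test functions `φ` and all directions `v`,
`∫ (∂_v φ) f = - ∫ φ f'(·) v`. -/
def HasWeakFDeriv {F : Type*} [NormedAddCommGroup F] [NormedSpace ℝ F]
    (f : R3 → F) (f' : R3 → R3 →L[ℝ] F) : Prop :=
  LocallyIntegrable f volume ∧ LocallyIntegrable f' volume ∧
    ∀ φ : R3 → ℝ, IsTestFun φ → ∀ v : R3,
      ∫ x, (fderiv ℝ φ x v) • f x = - ∫ x, φ x • f' x v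

/-- `d` is the weak (distributional) divergence of the vector field `X = (X₁, X₂, X₃)`, whose
components take values in a real normed space `F` (here `F = ℝ` or `F = ℂ`): everything is locally
integrable and `∫ ∑ⱼ (∂ⱼ φ) Xⱼ = - ∫ φ d` for all test functions `φ`. -/
def HasWeakDivergence {F : Type*} [NormedAddCommGroup F] [NormedSpace ℝ F]
    (X : R3 → Fin 3 → F) (d : R3 → F) : Prop :=
  (∀ j, LocallyIntegrable (fun x => X x j) volume) ∧ LocallyIntegrable d volume ∧
    ∀ φ : R3 → ℝ, IsTestFun φ →
      ∫ x, ∑ j : Fin 3, (fderiv ℝ φ x (stdVec j)) • X x j = - ∫ x, φ x • d x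

/-- The graph of the magnetic Schrödinger operator
`H = -Δ + (i/2)(A·∇ + ∇·A) + V` on `L²(ℝ³; ℂ)` with domain the Sobolev space `H²(ℝ³)`:
`IsMagneticSchrodinger A V ψ η` says that `ψ ∈ H²` (with weak gradient `Dψ` and weak Hessian
`D2ψ`), that `η ∈ L²`, and that `η = Hψ`.  Here `Δψ = ∑ⱼ D2ψ(eⱼ, eⱼ)`, `A·∇ψ = ∑ⱼ Aⱼ ∂ⱼψ`, and
`d` is the weak divergence `∇·(Aψ)`. -/
def IsMagneticSchrodinger (A : R3 → R3) (V : R3 → ℝ) (ψ η : R3 → ℂ) : Prop :=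
  MemLp ψ 2 volume ∧ MemLp η 2 volume ∧
    ∃ (Dψ : R3 → R3 →L[ℝ] ℂ) (D2ψ : R3 → R3 →L[ℝ] R3 →L[ℝ] ℂ) (d : R3 → ℂ),
      HasWeakFDeriv ψ Dψ ∧ MemLp Dψ 2 volume ∧
      HasWeakFDeriv Dψ D2ψ ∧ MemLp D2ψ 2 volume ∧
      HasWeakDivergence (fun x j => A x j • ψ x) d ∧
      ∀ᵐ x ∂(volume : Measure R3),
        η x = -(∑ j : Fin 3, D2ψ x (stdVec j) (stdVec j))
          + (Complex.I / 2) * ((∑ j : Fin 3, (A x j : ℂ) * Dψ x (stdVec j)) + d x)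
          + (V x : ℂ) * ψ x

/-- The real number `E` is an eigenvalue of `H = -Δ + (i/2)(A·∇ + ∇·A) + V`: there is `ψ` in the
domain of `H`, not zero in `L²`, with `Hψ = Eψ`. -/
def IsMagneticEigenvalue (A : R3 → R3) (V : R3 → ℝ) (E : ℝ) : Prop :=
  ∃ ψ : R3 → ℂ, ¬ (ψ =ᵐ[volume] 0) ∧
    IsMagneticSchrodinger A V ψ (fun x => (E : ℂ) * ψ x)

/-!
Write `q = E - V`. Since `div A = 0`, the weak divergence of `Aψ` is `A · ∇ψ`
(`weakDivergence_eq`), so an eigenfunction satisfies `Δψ + qψ = i A · ∇ψ`, and its real and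
imaginary parts form a real system with `|Δψ + qψ| ≤ |A| |∇ψ|`. Such a system has no nonzero
solution in `H²` (`ae_eq_zero_of_virial`). The idea, due to Froese and Herbst, is to combine the
virial theorem with exponential weights.

Conjugate by a radial weight: if `u = e^F w` with `∇F = g · x`, then `e^F (Δw + qw)` is `Δu` plus
terms in which `g` multiplies the Euler field `x · ∇u` and a potential `q + |x|² g²`. Pairing with
`2 x · ∇u + 2u`, that is, commuting with the generator of dilations, gives an exact identity
(`integral_virialDensity`, `conjugation`) whose quadratic form contains `|∇u|²`, `4g (x · ∇u)²`
and `(q + x · ∇q + 3|x|² g² + …) u²`. The decay of `∇V` makes `q + x · ∇q` close to `E > 0` far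
out, so the form is positive for every weight with slowly varying slope (`weight_coercive`), and
one obtains the Carleman inequality `∫ e^{2F} (w² + |∇w|²) ≤ C ∫ |x|² e^{2F} (Δw + qw)²`, with `C`
independent of the weight (`carleman_of_coercive`). Mollification carries it over to truncations
of `H²` functions (`IsSobolevH2.carleman`). Because `|x| |A| → 0`, the first-order term
`i A · ∇ψ` is absorbed on the left, and only the mass in a fixed ball remains on the right
(`weighted_mass_le`).

Taking `F = α⟨x⟩ + γ⟨x⟩ / (1 + δ⟨x⟩)` and letting `δ → 0` raises the known rate of exponential
decay from `α` to `α + γ`. The admissible step `γ` is of size `E / α` for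
large `α`, so it is bounded below while `α` stays bounded, every rate is reached, and `ψ` decays
faster than any exponential (`MassControlled.exp_decay`). With `F = α⟨x⟩` and `α → ∞`, the mass
in the fixed ball cannot balance the mass further out, and `ψ` vanishes outside a ball
(`MassControlled.eq_zero_outside`).
Finally a compactly supported solution is zero: the Gaussian weight `τ |x - a|² / 2`, centred at a
point `a` away from the support, gives a Carleman inequality for `Δ` alone with constant `4 / τ`
(`carleman_gaussian`), and `τ → ∞` beats the bounded coefficients
(`ae_eq_zero_of_compact_support`).
-/

/-! ### Partial derivatives of smooth functions -/

/-- The partial derivative `∂ⱼu` of a real function on `ℝ³`. -/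
noncomputable def pd (j : Fin 3) (u : R3 → ℝ) : R3 → ℝ := fun x => fderiv ℝ u x (stdVec j)

/-- The Laplacian, as the sum of the pure second partial derivatives. -/
noncomputable def lap (u : R3 → ℝ) : R3 → ℝ := fun x => ∑ j, pd j (pd j u) x

theorem contDiff_pd {u : R3 → ℝ} (hu : ContDiff ℝ ∞ u) (j : Fin 3) : ContDiff ℝ ∞ (pd j u) :=
  (hu.fderiv_right (m := ∞) le_rfl).clm_apply contDiff_const

theorem contDiff_lap {u : R3 → ℝ} (hu : ContDiff ℝ ∞ u) : ContDiff ℝ ∞ (lap u) :=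
  ContDiff.sum fun j _ => contDiff_pd (contDiff_pd hu j) j

theorem ContDiff.differentiableAt_infty {u : R3 → ℝ} (hu : ContDiff ℝ ∞ u) (x : R3) :
    DifferentiableAt ℝ u x := hu.contDiffAt.differentiableAt (by simp)

theorem tsupport_pd_subset (j : Fin 3) (u : R3 → ℝ) : tsupport (pd j u) ⊆ tsupport u := by
  refine closure_minimal (fun x hx => ?_) (isClosed_tsupport u)
  by_contra h
  apply hx
  have : fderiv ℝ u x = 0 := by
    have := (notMem_tsupport_iff_eventuallyEq.1 h).fderiv_eq (𝕜 := ℝ)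
    rw [this]; simp
  simp [pd, this]

theorem pd_eq_zero_of_notMem {j : Fin 3} {u : R3 → ℝ} {x : R3} (hx : x ∉ tsupport u) :
    pd j u x = 0 :=
  image_eq_zero_of_notMem_tsupport fun h => hx (tsupport_pd_subset j u h)

theorem lap_eq_zero_of_notMem {u : R3 → ℝ} {x : R3} (hx : x ∉ tsupport u) : lap u x = 0 :=
  Finset.sum_eq_zero fun _ _ =>
    pd_eq_zero_of_notMem fun h => hx (tsupport_pd_subset _ u h)

theorem isTestFun_pd {u : R3 → ℝ} (hu : IsTestFun u) (j : Fin 3) : IsTestFun (pd j u) :=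
  ⟨contDiff_pd hu.1 j, hu.2.mono' (subset_tsupport _ |>.trans (tsupport_pd_subset j u))⟩

theorem IsTestFun.mul_left {u h : R3 → ℝ} (hu : IsTestFun u) (hh : ContDiff ℝ ∞ h) :
    IsTestFun (fun x => h x * u x) := ⟨hh.mul hu.1, hu.2.mul_left⟩

theorem IsTestFun.mul_right {u h : R3 → ℝ} (hu : IsTestFun u) (hh : ContDiff ℝ ∞ h) :
    IsTestFun (fun x => u x * h x) := ⟨hu.1.mul hh, hu.2.mul_right⟩

theorem IsTestFun.add {u h : R3 → ℝ} (hu : IsTestFun u) (hh : IsTestFun h) :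
    IsTestFun (fun x => u x + h x) := ⟨hu.1.add hh.1, hu.2.add hh.2⟩

theorem IsTestFun.integrable {u : R3 → ℝ} (hu : IsTestFun u) : Integrable u volume :=
  hu.1.continuous.integrable_of_hasCompactSupport hu.2

theorem pd_mul {u v : R3 → ℝ} (hu : ContDiff ℝ ∞ u) (hv : ContDiff ℝ ∞ v) (j : Fin 3) (x : R3) :
    pd j (fun y => u y * v y) x = pd j u x * v x + u x * pd j v x := by
  simp only [pd, fderiv_fun_mul (hu.differentiableAt_infty x) (hv.differentiableAt_infty x)]
  simp only [add_apply, smul_apply, smul_eq_mul]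
  ring

theorem pd_add {u v : R3 → ℝ} (hu : ContDiff ℝ ∞ u) (hv : ContDiff ℝ ∞ v) (j : Fin 3) (x : R3) :
    pd j (fun y => u y + v y) x = pd j u x + pd j v x := by
  simp only [pd, fderiv_fun_add (hu.differentiableAt_infty x) (hv.differentiableAt_infty x)]
  rfl

theorem pd_sub {u v : R3 → ℝ} (hu : ContDiff ℝ ∞ u) (hv : ContDiff ℝ ∞ v) (j : Fin 3) (x : R3) :
    pd j (fun y => u y - v y) x = pd j u x - pd j v x := by
  simp only [pd, fderiv_fun_sub (hu.differentiableAt_infty x) (hv.differentiableAt_infty x)]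
  rfl

theorem pd_const (j : Fin 3) (c : ℝ) (x : R3) : pd j (fun _ => c) x = 0 := by
  simp [pd]

theorem pd_sum {ι : Type*} {s : Finset ι} {u : ι → R3 → ℝ} (hu : ∀ i, ContDiff ℝ ∞ (u i))
    (j : Fin 3) (x : R3) : pd j (fun y => ∑ i ∈ s, u i y) x = ∑ i ∈ s, pd j (u i) x := by
  simp only [pd]
  rw [fderiv_fun_sum fun i _ => (hu i).differentiableAt_infty x]
  simp

theorem pd_exp {u : R3 → ℝ} (hu : ContDiff ℝ ∞ u) (j : Fin 3) (x : R3) :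
    pd j (fun y => Real.exp (u y)) x = Real.exp (u x) * pd j u x := by
  simp only [pd, fderiv_exp (hu.differentiableAt_infty x)]
  simp

theorem contDiff_coord (i : Fin 3) (c : ℝ) : ContDiff ℝ ∞ (fun x : R3 => x i - c) := by
  fun_prop

theorem pd_coord (i j : Fin 3) (c : ℝ) (x : R3) :
    pd j (fun y : R3 => y i - c) x = if i = j then 1 else 0 := by
  have h : HasFDerivAt (fun y : R3 => y i - c) (EuclideanSpace.proj i : R3 →L[ℝ] ℝ) x :=
    ((EuclideanSpace.proj i : R3 →L[ℝ] ℝ).hasFDerivAt).sub_const c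
  simp only [pd, h.fderiv]
  simp

theorem pd_comm {u : R3 → ℝ} (hu : ContDiff ℝ ∞ u) (i j : Fin 3) (x : R3) :
    pd i (pd j u) x = pd j (pd i u) x := by
  have hd : DifferentiableAt ℝ (fderiv ℝ u) x :=
    (hu.fderiv_right (m := ∞) le_rfl).contDiffAt.differentiableAt (by simp)
  have key : ∀ i j : Fin 3, pd i (pd j u) x = fderiv ℝ (fderiv ℝ u) x (stdVec i) (stdVec j) := by
    intro i j
    change fderiv ℝ (fun y => fderiv ℝ u y (stdVec j)) x (stdVec i) = _
    rw [fderiv_clm_apply hd (differentiableAt_const _)]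
    simp
  rw [key, key]
  exact ((contDiff_infty.1 hu 2).contDiffAt.isSymmSndFDerivAt (by simp)).eq _ _

theorem integral_pd_eq_zero {u : R3 → ℝ} (hu : IsTestFun u) (j : Fin 3) : ∫ x, pd j u x = 0 := by
  have h := integral_mul_fderiv_eq_neg_fderiv_mul_of_integrable (μ := (volume : Measure R3))
    (f := fun _ => (1 : ℝ)) (g := u) (v := stdVec j) (by simp)
    (by simp only [one_mul]; exact (isTestFun_pd hu j).integrable) (by simpa using hu.integrable)
    (fun x _ => differentiableAt_const _) (fun x _ => hu.1.differentiableAt_infty x)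
  simpa [pd] using h

theorem norm_sq_eq_sum (x : R3) : ‖x‖ ^ 2 = ∑ j, x j ^ 2 := by
  rw [EuclideanSpace.norm_sq_eq]; simp

/-! ### The virial identity -/

/-- `q'` is the weak gradient of the real function `q`, given by its components. -/
def HasWeakGrad (q : R3 → ℝ) (q' : Fin 3 → R3 → ℝ) : Prop :=
  LocallyIntegrable q volume ∧ (∀ j, LocallyIntegrable (q' j) volume) ∧
    ∀ φ, IsTestFun φ → ∀ j, ∫ x, pd j φ x * q x = - ∫ x, φ x * q' j x

/-- The Euler vector field `(x - a) · ∇` centred at `a`, applied to `u`. -/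
noncomputable def euler (a : R3) (u : R3 → ℝ) : R3 → ℝ := fun x => ∑ j, (x j - a j) * pd j u x

theorem contDiff_euler {u : R3 → ℝ} (a : R3) (hu : ContDiff ℝ ∞ u) : ContDiff ℝ ∞ (euler a u) :=
  ContDiff.sum fun j _ => (contDiff_coord j _).mul (contDiff_pd hu j)

theorem IsTestFun.integrable_mul {φ f : R3 → ℝ} (hφ : IsTestFun φ)
    (hf : LocallyIntegrable f volume) : Integrable (fun x => φ x * f x) volume :=
  hf.integrable_smul_left_of_hasCompactSupport hφ.1.continuous hφ.2

/-- Testing the weak gradient of `q` with the functions `(xⱼ - aⱼ) u²`. -/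
theorem HasWeakGrad.integral_euler {q : R3 → ℝ} {q' : Fin 3 → R3 → ℝ} (hq : HasWeakGrad q q')
    (a : R3) {u : R3 → ℝ} (hu : IsTestFun u) :
    Integrable (fun x => (3 * u x ^ 2 + 2 * u x * euler a u x) * q x +
      u x ^ 2 * ∑ j, (x j - a j) * q' j x) volume ∧
    ∫ x, ((3 * u x ^ 2 + 2 * u x * euler a u x) * q x +
      u x ^ 2 * ∑ j, (x j - a j) * q' j x) = 0 := by
  have ht : ∀ j : Fin 3, IsTestFun (fun x : R3 => (x j - a j) * (u x * u x)) := fun j =>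
    (hu.mul_left hu.1).mul_left (contDiff_coord j _)
  have hpd : ∀ (j : Fin 3) x, pd j (fun x : R3 => (x j - a j) * (u x * u x)) x =
      u x * u x + 2 * ((x j - a j) * u x * pd j u x) := by
    intro j x
    rw [pd_mul (contDiff_coord j _) (hu.1.mul hu.1), pd_mul hu.1 hu.1, pd_coord]
    simp; ring
  have h1 : ∀ j : Fin 3, Integrable
      (fun x => pd j (fun x : R3 => (x j - a j) * (u x * u x)) x * q x +
        (x j - a j) * (u x * u x) * q' j x) volume := fun j =>
    ((isTestFun_pd (ht j) j).integrable_mul hq.1).add ((ht j).integrable_mul (hq.2.1 j))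
  have h2 : ∀ j : Fin 3, ∫ x, (pd j (fun x : R3 => (x j - a j) * (u x * u x)) x * q x +
        (x j - a j) * (u x * u x) * q' j x) = 0 := by
    intro j
    rw [integral_add ((isTestFun_pd (ht j) j).integrable_mul hq.1) ((ht j).integrable_mul (hq.2.1 j)),
      hq.2.2 _ (ht j) j]
    ring
  have h3 : (fun x => (3 * u x ^ 2 + 2 * u x * euler a u x) * q x +
      u x ^ 2 * ∑ j, (x j - a j) * q' j x) = fun x => ∑ j : Fin 3,
      (pd j (fun x : R3 => (x j - a j) * (u x * u x)) x * q x +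
        (x j - a j) * (u x * u x) * q' j x) := by
    funext x
    simp only [hpd, euler, Fin.sum_univ_three]
    ring
  rw [h3]
  refine ⟨integrable_finsetSum _ fun j _ => h1 j, ?_⟩
  rw [integral_finsetSum _ fun j _ => h1 j]
  simp [h2]

/-- The integrand of the virial identity for `-Δ - q`, conjugated with a weight `e^F` whose gradient
is `g · (x - a)`: `G` stands for `Δu - 2 g (x-a)·∇u + (|∇F|² - ΔF + q) u`. -/
noncomputable def virialDensity (a : R3) (g q : R3 → ℝ) (q' : Fin 3 → R3 → ℝ) (u G : R3 → ℝ)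
    (x : R3) : ℝ :=
  ∑ j, pd j u x ^ 2 + 4 * g x * euler a u x ^ 2 +
    (‖x - a‖ ^ 2 * (3 * g x ^ 2 + 2 * g x * euler a g x) + q x +
      ∑ j, (x j - a j) * q' j x) * u x ^ 2 +
    (4 * g x + 2 * (3 * g x + euler a g x)) * (u x * euler a u x) +
    2 * (3 * g x + euler a g x) * u x ^ 2 + 2 * G x * (euler a u x + u x)

/-- The virial identity: the commutator of the conjugated operator with the dilations about `a`
is a sum of divergences. -/
theorem integral_virialDensity {a : R3} {g q : R3 → ℝ} {q' : Fin 3 → R3 → ℝ} {u G : R3 → ℝ}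
    (hg : ContDiff ℝ ∞ g) (hq : HasWeakGrad q q') (hu : IsTestFun u)
    (hG : ∀ x, G x = lap u x - 2 * g x * euler a u x +
      (‖x - a‖ ^ 2 * g x ^ 2 - (3 * g x + euler a g x) + q x) * u x) :
    Integrable (virialDensity a g q q' u G) volume ∧ ∫ x, virialDensity a g q q' u G x = 0 := by
  set S : R3 → ℝ := fun x => ∑ i, pd i u x * pd i u x with hS
  set P : R3 → ℝ := fun x => (∑ i : Fin 3, (x i - a i) * (x i - a i)) * (g x * g x) with hP
  have cS : ContDiff ℝ ∞ S := ContDiff.sum fun i _ => (contDiff_pd hu.1 i).mul (contDiff_pd hu.1 i)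
  have cP : ContDiff ℝ ∞ P := (ContDiff.sum fun i _ =>
    (contDiff_coord i _).mul (contDiff_coord i _)).mul (hg.mul hg)
  have cE := contDiff_euler a hu.1
  have hS' : ∀ j x, pd j S x = ∑ i, 2 * (pd i u x * pd i (pd j u) x) := by
    intro j x
    rw [hS, pd_sum fun i => (contDiff_pd hu.1 i).mul (contDiff_pd hu.1 i)]
    refine Finset.sum_congr rfl fun i _ => ?_
    rw [pd_mul (contDiff_pd hu.1 i) (contDiff_pd hu.1 i), pd_comm hu.1 i j]
    ring
  have hP' : ∀ j x, pd j P x = 2 * (x j - a j) * (g x * g x) +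
      (∑ i : Fin 3, (x i - a i) * (x i - a i)) * (2 * g x * pd j g x) := by
    intro j x
    rw [hP, pd_mul (ContDiff.sum fun i _ =>
      (contDiff_coord i _).mul (contDiff_coord i _)) (hg.mul hg), pd_mul hg hg,
      pd_sum fun i => (contDiff_coord i _).mul (contDiff_coord i _)]
    have : ∀ i : Fin 3, pd j (fun y : R3 => (y i - a i) * (y i - a i)) x =
        if i = j then 2 * (x i - a i) else 0 := by
      intro i
      rw [pd_mul (contDiff_coord i _) (contDiff_coord i _), pd_coord]
      split_ifs <;> ring
    simp only [this, Finset.sum_ite_eq', Finset.mem_univ, if_true]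
    ring
  have hE' : ∀ j x, pd j (euler a u) x = pd j u x + ∑ i, (x i - a i) * pd i (pd j u) x := by
    intro j x
    have : euler a u = fun x => ∑ i, (x i - a i) * pd i u x := rfl
    rw [this, pd_sum fun i => (contDiff_coord i _).mul (contDiff_pd hu.1 i)]
    have : ∀ i : Fin 3, pd j (fun y : R3 => (y i - a i) * pd i u y) x =
        (if i = j then pd i u x else 0) + (x i - a i) * pd i (pd j u) x := by
      intro i
      rw [pd_mul (contDiff_coord i _) (contDiff_pd hu.1 i), pd_coord, pd_comm hu.1 i j]
      split_ifs <;> ring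
    simp only [this, Finset.sum_add_distrib, Finset.sum_ite_eq', Finset.mem_univ, if_true]
  -- the vector field whose divergence is the smooth part of the density
  set X : Fin 3 → R3 → ℝ := fun j x =>
    pd j u x * (2 * euler a u x + 2 * u x) + (x j - a j) * (P x * (u x * u x) - S x) with hX
  have c1 : ContDiff ℝ ∞ (fun x => 2 * euler a u x + 2 * u x) :=
    (contDiff_const.mul cE).add (contDiff_const.mul hu.1)
  have c2 : ContDiff ℝ ∞ (fun x => P x * (u x * u x) - S x) := (cP.mul (hu.1.mul hu.1)).sub cS
  have tS : IsTestFun (fun x => P x * (u x * u x) - S x) := by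
    refine ⟨c2, hu.2.mono' fun x hx => ?_⟩
    by_contra h
    apply hx
    simp [hS, image_eq_zero_of_notMem_tsupport h, pd_eq_zero_of_notMem h]
  have tX : ∀ j, IsTestFun (X j) := fun j =>
    ((isTestFun_pd hu j).mul_right c1).add (tS.mul_left (contDiff_coord j _))
  have hX' : ∀ j x, pd j (X j) x = pd j (pd j u) x * (2 * euler a u x + 2 * u x) +
      pd j u x * (2 * (pd j u x + ∑ i, (x i - a i) * pd i (pd j u) x) + 2 * pd j u x) +
      ((P x * (u x * u x) - S x) + (x j - a j) *
        ((2 * (x j - a j) * (g x * g x) +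
          (∑ i : Fin 3, (x i - a i) * (x i - a i)) * (2 * g x * pd j g x)) * (u x * u x) +
          P x * (2 * (u x * pd j u x)) - ∑ i, 2 * (pd i u x * pd i (pd j u) x))) := by
    intro j x
    rw [hX, pd_add ((contDiff_pd hu.1 j).mul c1) ((contDiff_coord j _).mul c2),
      pd_mul (contDiff_pd hu.1 j) c1, pd_mul (contDiff_coord j _) c2, pd_coord,
      pd_sub (cP.mul (hu.1.mul hu.1)) cS, pd_mul cP (hu.1.mul hu.1), pd_mul hu.1 hu.1, hS', hP',
      pd_add (contDiff_const.mul cE) (contDiff_const.mul hu.1), pd_mul contDiff_const cE,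
      pd_mul contDiff_const hu.1, pd_const, hE', if_pos rfl]
    ring
  obtain ⟨i1, i2⟩ := hq.integral_euler a hu
  have key : virialDensity a g q q' u G = fun x => (∑ j, pd j (X j) x) +
      ((3 * u x ^ 2 + 2 * u x * euler a u x) * q x + u x ^ 2 * ∑ j, (x j - a j) * q' j x) := by
    funext x
    simp only [virialDensity, hX', hG, lap, norm_sq_eq_sum, hS, hP, euler, Fin.sum_univ_three,
      PiLp.sub_apply, pd_comm hu.1 1 0, pd_comm hu.1 2 0, pd_comm hu.1 2 1]
    ring
  have i3 : Integrable (fun x => ∑ j, pd j (X j) x) volume :=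
    integrable_finsetSum _ fun j _ => (isTestFun_pd (tX j) j).integrable
  rw [key]
  refine ⟨i3.add i1, ?_⟩
  rw [integral_add i3 i1, i2, integral_finsetSum _ fun j _ => (isTestFun_pd (tX j) j).integrable]
  simp [integral_pd_eq_zero (tX _)]

/-- Conjugation with `e^F`: if `u = e^F w` and `∇F = g · (x - a)`, then `e^F (Δw + q w)` is the
conjugated operator applied to `u`, and `e^F ∇w = ∇u - u ∇F`. -/
theorem conjugation {a : R3} {F g w : R3 → ℝ} (q : R3 → ℝ)
    (hF : ContDiff ℝ ∞ F) (hg : ContDiff ℝ ∞ g)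
    (hFg : ∀ j x, pd j F x = (x j - a j) * g x) (hw : ContDiff ℝ ∞ w) (x : R3) :
    (∀ j, pd j (fun y => Real.exp (F y) * w y) x =
      Real.exp (F x) * (pd j w x + (x j - a j) * g x * w x)) ∧
    Real.exp (F x) * (lap w x + q x * w x) =
      lap (fun y => Real.exp (F y) * w y) x -
        2 * g x * euler a (fun y => Real.exp (F y) * w y) x +
      (‖x - a‖ ^ 2 * g x ^ 2 - (3 * g x + euler a g x) + q x) * (Real.exp (F x) * w x) := by
  have hE : ContDiff ℝ ∞ (fun y => Real.exp (F y)) := hF.exp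
  have h1 : ∀ j x, pd j (fun y => Real.exp (F y) * w y) x =
      Real.exp (F x) * (pd j w x + (x j - a j) * g x * w x) := by
    intro j x
    rw [pd_mul hE hw, pd_exp hF, hFg]; ring
  have h2 : ∀ j, pd j (pd j (fun y => Real.exp (F y) * w y)) x =
      Real.exp (F x) * (pd j (pd j w) x + 2 * ((x j - a j) * g x * pd j w x) +
        (x j - a j) ^ 2 * g x ^ 2 * w x + g x * w x + (x j - a j) * pd j g x * w x) := by
    intro j
    have c := contDiff_coord j (a j)
    have : pd j (fun y => Real.exp (F y) * w y) = fun x =>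
      Real.exp (F x) * (pd j w x + (x j - a j) * g x * w x) := funext (h1 j)
    rw [this, pd_mul hE ((contDiff_pd hw j).add ((c.mul hg).mul hw)), pd_exp hF, hFg,
      pd_add (contDiff_pd hw j) ((c.mul hg).mul hw), pd_mul (c.mul hg) hw, pd_mul c hg, pd_coord]
    simp; ring
  refine ⟨fun j => h1 j x, ?_⟩
  simp only [lap, h2, euler, h1, norm_sq_eq_sum, Fin.sum_univ_three, PiLp.sub_apply]
  ring

/-! ### Carleman inequalities for test functions -/

theorem euler_sq_le (a : R3) (u : R3 → ℝ) (x : R3) :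
    euler a u x ^ 2 ≤ ‖x - a‖ ^ 2 * ∑ j, pd j u x ^ 2 := by
  rw [norm_sq_eq_sum]
  exact Finset.sum_mul_sq_le_sq_mul_sq _ _ _

/-- The pointwise lower bound for the virial density that yields coercivity at infinity. -/
theorem virial_lower_bound {S d u g g1 r K G η : ℝ} (hS : 0 ≤ S) (hd : d ^ 2 ≤ r ^ 2 * S)
    (hr : 1 ≤ r) (hg : 0 ≤ g) (h1 : -3 * g ≤ g1) (h2 : g1 ≤ 0) (hη : 0 < η)
    (hK : 2 * η + r ^ 2 * g ^ 2 / 8 ≤ K - 7 * g) :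
    S / 2 + (η + r ^ 2 * g ^ 2 / 8) * u ^ 2 ≤
      S + 4 * g * d ^ 2 + K * u ^ 2 + (4 * g + 2 * (3 * g + g1)) * (u * d) +
        2 * (3 * g + g1) * u ^ 2 + 2 * G * (d + u) + (2 + 1 / η) * (r ^ 2 * G ^ 2) := by
  have e1 : 0 ≤ 4 * g * d ^ 2 + (4 * g + 2 * (3 * g + g1)) * (u * d) + 7 * g * u ^ 2 := by
    have a1 : -(10 * g * |u * d|) ≤ (4 * g + 2 * (3 * g + g1)) * (u * d) := by
      have b1 : |(4 * g + 2 * (3 * g + g1)) * (u * d)| ≤ 10 * g * |u * d| := by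
        rw [abs_mul]
        gcongr
        rw [abs_of_nonneg (by linarith)]
        linarith
      exact (neg_le_neg b1).trans (neg_abs_le _)
    have a2 : 10 * |u * d| ≤ 4 * d ^ 2 + 7 * u ^ 2 := by
      rw [abs_mul]
      nlinarith [sq_nonneg (2 * |d| - 5 / 2 * |u|), sq_abs u, sq_abs d, sq_nonneg u]
    nlinarith [mul_le_mul_of_nonneg_left a2 hg]
  have e2 : 0 ≤ S / 2 + 2 * G * d + 2 * (r ^ 2 * G ^ 2) := by
    have hσ := Real.sq_sqrt hS
    have a1 : |d| ≤ r * √S := abs_le_of_sq_le_sq (by nlinarith) (by positivity)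
    have a2 : -(|G| * (r * √S)) ≤ G * d := by
      have : |G * d| ≤ |G| * (r * √S) := by rw [abs_mul]; gcongr
      exact (neg_le_neg this).trans (neg_abs_le _)
    nlinarith [sq_nonneg (√S - 2 * r * |G|), sq_abs G]
  have e3 : 0 ≤ η * u ^ 2 + 2 * G * u + 1 / η * (r ^ 2 * G ^ 2) := by
    have a1 : G ^ 2 ≤ r ^ 2 * G ^ 2 :=
      le_mul_of_one_le_left (sq_nonneg G) (one_le_pow₀ hr)
    have a2 : 1 / η * G ^ 2 ≤ 1 / η * (r ^ 2 * G ^ 2) := by gcongr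
    have a3 : η * u ^ 2 + 2 * G * u + 1 / η * G ^ 2 = 1 / η * (η * u + G) ^ 2 := by
      field_simp
      ring
    nlinarith [show 0 ≤ 1 / η * (η * u + G) ^ 2 by positivity]
  have e4 : 0 ≤ (3 * g + g1) * u ^ 2 := mul_nonneg (by linarith) (sq_nonneg u)
  nlinarith [mul_le_mul_of_nonneg_right hK (sq_nonneg u)]

theorem sum_sub_sq_le (p y : Fin 3 → ℝ) (c : ℝ) :
    ∑ j, (p j - y j * c) ^ 2 ≤ 2 * ∑ j, p j ^ 2 + 2 * (∑ j, y j ^ 2) * c ^ 2 := by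
  rw [Finset.mul_sum, Finset.mul_sum, Finset.sum_mul, ← Finset.sum_add_distrib]
  refine Finset.sum_le_sum fun j _ => ?_
  nlinarith [sq_nonneg (p j + y j * c)]

theorem tsupport_exp_mul_subset (F w : R3 → ℝ) :
    tsupport (fun x => Real.exp (F x) * w x) ⊆ tsupport w :=
  closure_mono fun x hx => by
    simp only [Function.mem_support, ne_eq, mul_eq_zero, not_or] at hx ⊢
    exact hx.2

/-- The gradient of `w` in terms of that of `u = e^F w`. -/
theorem exp_mul_sum_sq_le {a : R3} {F g w : R3 → ℝ} (hF : ContDiff ℝ ∞ F) (hg : ContDiff ℝ ∞ g)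
    (hFg : ∀ j x, pd j F x = (x j - a j) * g x) (hw : ContDiff ℝ ∞ w) (x : R3) :
    Real.exp (2 * F x) * (w x ^ 2 + ∑ j, pd j w x ^ 2) ≤
      (Real.exp (F x) * w x) ^ 2 + (2 * ∑ j, pd j (fun y => Real.exp (F y) * w y) x ^ 2 +
        2 * ‖x - a‖ ^ 2 * g x ^ 2 * (Real.exp (F x) * w x) ^ 2) := by
  obtain ⟨h1, -⟩ := conjugation 0 hF hg hFg hw x
  have h2 := sum_sub_sq_le (fun j => pd j (fun y => Real.exp (F y) * w y) x)
    (fun j => (x - a) j) (g x * (Real.exp (F x) * w x))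
  rw [← norm_sq_eq_sum] at h2
  have h3 : ∀ j, pd j (fun y => Real.exp (F y) * w y) x -
      (x - a) j * (g x * (Real.exp (F x) * w x)) = Real.exp (F x) * pd j w x := by
    intro j
    rw [h1, PiLp.sub_apply]; ring
  simp only [h3, mul_pow, ← Finset.mul_sum] at h2
  have h4 : Real.exp (2 * F x) = Real.exp (F x) ^ 2 := by rw [← Real.exp_nat_mul]; norm_num
  rw [h4]
  simp only [mul_pow]
  nlinarith

theorem IsTestFun.integrable_sq_add {w q m : R3 → ℝ} (hw : IsTestFun w)
    (hm : Continuous m) (hq : LocallyIntegrable q volume)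
    (hq2 : LocallyIntegrable (fun x => q x ^ 2) volume) :
    Integrable (fun x => m x * (lap w x + q x * w x) ^ 2) volume := by
  have c := hw.1.continuous
  have cl := (contDiff_lap hw.1).continuous
  have s1 : HasCompactSupport (fun x => m x * lap w x ^ 2) :=
    hw.2.mono' fun x hx => by
      by_contra h; exact hx (by simp [lap_eq_zero_of_notMem h])
  have s2 : HasCompactSupport (fun x => 2 * m x * lap w x * w x) := hw.2.mul_left
  have s3 : HasCompactSupport (fun x => m x * w x ^ 2) :=
    hw.2.mono' fun x hx => by
      by_contra h; exact hx (by simp [image_eq_zero_of_notMem_tsupport h])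
  have i1 : Integrable (fun x => m x * lap w x ^ 2) volume :=
    (hm.mul (cl.pow 2)).integrable_of_hasCompactSupport s1
  have i2 := hq.integrable_smul_left_of_hasCompactSupport
    (((continuous_const.mul hm).mul cl).mul c) s2
  have i3 := hq2.integrable_smul_left_of_hasCompactSupport (hm.mul (c.pow 2)) s3
  refine ((i1.add i2).add i3).congr (.of_forall fun x => ?_)
  simp only [Pi.add_apply, Pi.mul_apply, Pi.pow_apply, smul_eq_mul]
  ring

theorem IsTestFun.integrable_grad {w m : R3 → ℝ} (hw : IsTestFun w) (hm : Continuous m) :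
    Integrable (fun x => m x * (w x ^ 2 + ∑ j, pd j w x ^ 2)) volume := by
  have c := hw.1.continuous
  have cj := fun j => (contDiff_pd hw.1 j).continuous
  refine (by fun_prop : Continuous _).integrable_of_hasCompactSupport (hw.2.mono' fun x hx => ?_)
  by_contra h
  exact hx (by simp [image_eq_zero_of_notMem_tsupport h, pd_eq_zero_of_notMem h])

/-- Carleman inequality for `Δ + q` with a radial weight `e^F`, with a constant depending only on
the coercivity constant `η`. -/
theorem carleman_of_coercive {a : R3} {F g q w : R3 → ℝ} {q' : Fin 3 → R3 → ℝ} {η : ℝ}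
    (hη : 0 < η) (hF : ContDiff ℝ ∞ F) (hg : ContDiff ℝ ∞ g)
    (hFg : ∀ j x, pd j F x = (x j - a j) * g x) (hq : HasWeakGrad q q')
    (hq2 : LocallyIntegrable (fun x => q x ^ 2) volume) (hw : IsTestFun w)
    (h : ∀ᵐ x ∂(volume : Measure R3), x ∈ tsupport w → 1 ≤ ‖x - a‖ ∧ 0 ≤ g x ∧
      -3 * g x ≤ euler a g x ∧ euler a g x ≤ 0 ∧
      2 * η + ‖x - a‖ ^ 2 * g x ^ 2 / 8 ≤
        ‖x - a‖ ^ 2 * (3 * g x ^ 2 + 2 * g x * euler a g x) + q x +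
          ∑ j, (x j - a j) * q' j x - 7 * g x) :
    ∫ x, Real.exp (2 * F x) * (w x ^ 2 + ∑ j, pd j w x ^ 2) ≤
      (16 + 1 / η) * (2 + 1 / η) *
        ∫ x, ‖x - a‖ ^ 2 * Real.exp (2 * F x) * (lap w x + q x * w x) ^ 2 := by
  set u : R3 → ℝ := fun x => Real.exp (F x) * w x with hu_def
  set G : R3 → ℝ := fun x => Real.exp (F x) * (lap w x + q x * w x) with hG_def
  have hu : IsTestFun u := hw.mul_left hF.exp
  obtain ⟨vi, v0⟩ := integral_virialDensity (u := u) (G := G) hg hq hu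
    fun x => (conjugation q hF hg hFg hw.1 x).2
  have cF := hF.continuous
  have iR := hw.integrable_sq_add (m := fun x => ‖x - a‖ ^ 2 * Real.exp (2 * F x))
    (by fun_prop) hq.1 hq2
  have iL := hw.integrable_grad (m := fun x => Real.exp (2 * F x)) (by fun_prop)
  have h4 : ∀ x, Real.exp (2 * F x) = Real.exp (F x) ^ 2 := fun x => by
    rw [← Real.exp_nat_mul]; norm_num
  have key : ∀ᵐ x ∂(volume : Measure R3), Real.exp (2 * F x) * (w x ^ 2 + ∑ j, pd j w x ^ 2) ≤
      (16 + 1 / η) * virialDensity a g q q' u G x + (16 + 1 / η) * (2 + 1 / η) *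
        (‖x - a‖ ^ 2 * Real.exp (2 * F x) * (lap w x + q x * w x) ^ 2) := by
    filter_upwards [h] with x hx
    by_cases hxw : x ∈ tsupport w
    · obtain ⟨hr, hg0, h1, h2, hK⟩ := hx hxw
      have hS : 0 ≤ ∑ j, pd j u x ^ 2 := Finset.sum_nonneg fun j _ => sq_nonneg _
      have b1 := virial_lower_bound (u := u x) (G := G x) hS (euler_sq_le a u x) hr hg0 h1 h2 hη hK
      have b2 := exp_mul_sum_sq_le hF hg hFg hw.1 x
      change _ ≤ u x ^ 2 + (2 * ∑ j, pd j u x ^ 2 + 2 * ‖x - a‖ ^ 2 * g x ^ 2 * u x ^ 2) at b2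
      have b3 : ‖x - a‖ ^ 2 * Real.exp (2 * F x) * (lap w x + q x * w x) ^ 2 =
          ‖x - a‖ ^ 2 * G x ^ 2 := by rw [h4, hG_def]; ring
      rw [b3]
      refine b2.trans ?_
      have b4 := mul_le_mul_of_nonneg_left b1 (show 0 ≤ 16 + 1 / η by positivity)
      refine le_trans ?_ (b4.trans (le_of_eq ?_))
      · have : (16 + 1 / η) * ((∑ j, pd j u x ^ 2) / 2 +
            (η + ‖x - a‖ ^ 2 * g x ^ 2 / 8) * u x ^ 2) =
            u x ^ 2 + (2 * ∑ j, pd j u x ^ 2 + 2 * ‖x - a‖ ^ 2 * g x ^ 2 * u x ^ 2) +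
            (6 * ∑ j, pd j u x ^ 2 + 16 * η * u x ^ 2 + 1 / η * ((∑ j, pd j u x ^ 2) / 2) +
              1 / η * (‖x - a‖ ^ 2 * g x ^ 2 / 8) * u x ^ 2) := by
          field_simp
          ring
        rw [this]
        refine le_add_of_nonneg_right ?_
        positivity
      · simp only [virialDensity]
        ring
    · have hxu : x ∉ tsupport u := fun h => hxw (tsupport_exp_mul_subset F w h)
      have z1 : euler a u x = 0 :=
        Finset.sum_eq_zero fun j _ => by rw [pd_eq_zero_of_notMem hxu, mul_zero]
      simp [virialDensity, image_eq_zero_of_notMem_tsupport hxw, pd_eq_zero_of_notMem hxw,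
        image_eq_zero_of_notMem_tsupport hxu, pd_eq_zero_of_notMem hxu, z1,
        lap_eq_zero_of_notMem hxw]
  have := integral_mono_ae iL ((vi.const_mul (16 + 1 / η)).add
    (iR.const_mul ((16 + 1 / η) * (2 + 1 / η)))) key
  refine this.trans (le_of_eq ?_)
  simp only [Pi.add_apply]
  rw [integral_add (vi.const_mul _) (iR.const_mul _), integral_const_mul, integral_const_mul, v0]
  ring

theorem hasWeakGrad_zero : HasWeakGrad 0 0 :=
  ⟨locallyIntegrable_zero, fun _ => locallyIntegrable_zero, fun φ _ j => by simp⟩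

/-- Carleman inequality for the Laplacian with the Gaussian weight `e^{τ|x - a|²/2}`, for functions
supported away from the centre `a`. -/
theorem carleman_gaussian {a : R3} {w : R3 → ℝ} {τ : ℝ} (hτ : 9 ≤ τ) (hw : IsTestFun w)
    (h : ∀ x ∈ tsupport w, 1 ≤ ‖x - a‖) :
    ∫ x, Real.exp (τ * ‖x - a‖ ^ 2) * (w x ^ 2 + ∑ j, pd j w x ^ 2) ≤
      4 / τ * ∫ x, Real.exp (τ * ‖x - a‖ ^ 2) * lap w x ^ 2 := by
  set F : R3 → ℝ := fun x => τ / 2 * ‖x - a‖ ^ 2 with hF_def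
  have hFe : F = fun x => τ / 2 * ∑ j : Fin 3, (x j - a j) * (x j - a j) := by
    funext x
    simp only [hF_def, norm_sq_eq_sum, PiLp.sub_apply, ← sq]
  have hF : ContDiff ℝ ∞ F := by
    rw [hFe]
    exact contDiff_const.mul
      (ContDiff.sum fun i _ => (contDiff_coord i _).mul (contDiff_coord i _))
  set g : R3 → ℝ := fun _ => τ with hg_def
  have hg : ContDiff ℝ ∞ g := contDiff_const
  have hFg : ∀ j x, pd j F x = (x j - a j) * g x := by
    intro j x
    rw [hFe, pd_mul contDiff_const
      (ContDiff.sum fun i _ => (contDiff_coord i _).mul (contDiff_coord i _)), pd_const,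
      pd_sum fun i => (contDiff_coord i _).mul (contDiff_coord i _)]
    have : ∀ i : Fin 3, pd j (fun y : R3 => (y i - a i) * (y i - a i)) x =
        if i = j then 2 * (x i - a i) else 0 := by
      intro i
      rw [pd_mul (contDiff_coord i _) (contDiff_coord i _), pd_coord]
      split_ifs <;> ring
    simp only [this, Finset.sum_ite_eq', Finset.mem_univ, if_true, hg_def]
    ring
  have hg1 : ∀ x, euler a g x = 0 := fun x =>
    Finset.sum_eq_zero fun j _ => by rw [hg_def, pd_const, mul_zero]
  have hFF : ∀ x, τ * ‖x - a‖ ^ 2 = 2 * F x := fun x => by rw [hF_def]; ring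
  simp only [hFF]
  set u : R3 → ℝ := fun x => Real.exp (F x) * w x with hu_def
  set G : R3 → ℝ := fun x => Real.exp (F x) * (lap w x + (0 : R3 → ℝ) x * w x) with hG_def
  have hu : IsTestFun u := hw.mul_left hF.exp
  obtain ⟨vi, v0⟩ := integral_virialDensity (u := u) (G := G) hg hasWeakGrad_zero hu
    fun x => (conjugation 0 hF hg hFg hw.1 x).2
  have cF := hF.continuous
  have iR := hw.integrable_sq_add (m := fun x => Real.exp (2 * F x)) (q := 0)
    (by fun_prop) locallyIntegrable_zero (by simpa using locallyIntegrable_zero)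
  simp only [Pi.zero_apply, zero_mul, add_zero] at iR
  have iL := hw.integrable_grad (m := fun x => Real.exp (2 * F x)) (by fun_prop)
  have h4 : ∀ x, Real.exp (2 * F x) = Real.exp (F x) ^ 2 := fun x => by
    rw [← Real.exp_nat_mul]; norm_num
  have hτ0 : 0 < τ := by linarith
  have key : ∀ x, Real.exp (2 * F x) * (w x ^ 2 + ∑ j, pd j w x ^ 2) ≤
      2 * virialDensity a g 0 0 u G x + 4 / τ * (Real.exp (2 * F x) * lap w x ^ 2) := by
    intro x
    by_cases hxw : x ∈ tsupport w
    · have hr := h x hxw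
      have hS : 0 ≤ ∑ j, pd j u x ^ 2 := Finset.sum_nonneg fun j _ => sq_nonneg _
      have b2 := exp_mul_sum_sq_le hF hg hFg hw.1 x
      change _ ≤ u x ^ 2 + (2 * ∑ j, pd j u x ^ 2 + 2 * ‖x - a‖ ^ 2 * τ ^ 2 * u x ^ 2) at b2
      have b3 : Real.exp (2 * F x) * lap w x ^ 2 = G x ^ 2 := by
        rw [h4, hG_def]; simp; ring
      rw [b3]
      refine b2.trans ?_
      have b5 : virialDensity a g 0 0 u G x = ∑ j, pd j u x ^ 2 + 4 * τ * euler a u x ^ 2 +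
          3 * ‖x - a‖ ^ 2 * τ ^ 2 * u x ^ 2 + 10 * τ * (u x * euler a u x) +
          6 * τ * u x ^ 2 + 2 * G x * (euler a u x + u x) := by
        have hgx : g x = τ := rfl
        simp only [virialDensity, hg1, hgx, Pi.zero_apply, mul_zero, Finset.sum_const_zero]
        ring
      rw [b5]
      set d := euler a u x
      set v := u x
      have c1 : 0 ≤ τ * d ^ 2 + 2 * G x * d + 1 / τ * G x ^ 2 := by
        have : τ * d ^ 2 + 2 * G x * d + 1 / τ * G x ^ 2 = 1 / τ * (τ * d + G x) ^ 2 := by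
          field_simp
          ring
        rw [this]; positivity
      have c2 : 0 ≤ τ * v ^ 2 + 2 * G x * v + 1 / τ * G x ^ 2 := by
        have : τ * v ^ 2 + 2 * G x * v + 1 / τ * G x ^ 2 = 1 / τ * (τ * v + G x) ^ 2 := by
          field_simp
          ring
        rw [this]; positivity
      have c3 : 0 ≤ τ * (3 * d ^ 2 + 10 * (v * d) + 25 / 3 * v ^ 2) := by
        have : 3 * d ^ 2 + 10 * (v * d) + 25 / 3 * v ^ 2 = 3 * (d + 5 / 3 * v) ^ 2 := by ring
        rw [this]; positivity
      have c4 : τ ^ 2 * v ^ 2 ≤ ‖x - a‖ ^ 2 * τ ^ 2 * v ^ 2 := by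
        have : (1 : ℝ) ≤ ‖x - a‖ ^ 2 := by nlinarith
        nlinarith [mul_le_mul_of_nonneg_right this (show 0 ≤ τ ^ 2 * v ^ 2 by positivity)]
      have c5 : 9 * (τ * v ^ 2) ≤ τ ^ 2 * v ^ 2 := by
        nlinarith [mul_le_mul_of_nonneg_right hτ (show 0 ≤ τ * v ^ 2 by positivity)]
      have c6 : 9 * v ^ 2 ≤ τ * v ^ 2 := by nlinarith [sq_nonneg v]
      have c7 : 4 / τ * G x ^ 2 = 4 * (1 / τ * G x ^ 2) := by ring
      rw [c7]
      nlinarith [sq_nonneg v]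
    · have hxu : x ∉ tsupport u := fun h => hxw (tsupport_exp_mul_subset F w h)
      have z1 : euler a u x = 0 :=
        Finset.sum_eq_zero fun j _ => by rw [pd_eq_zero_of_notMem hxu, mul_zero]
      simp [virialDensity, image_eq_zero_of_notMem_tsupport hxw, pd_eq_zero_of_notMem hxw,
        image_eq_zero_of_notMem_tsupport hxu, pd_eq_zero_of_notMem hxu, z1,
        lap_eq_zero_of_notMem hxw]
  have := integral_mono iL ((vi.const_mul 2).add (iR.const_mul (4 / τ))) key
  refine this.trans (le_of_eq ?_)
  simp only [Pi.add_apply]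
  rw [integral_add (vi.const_mul _) (iR.const_mul _), integral_const_mul, integral_const_mul, v0]
  ring

/-! ### The radial weights -/

theorem one_le_japaneseBracket (x : R3) : 1 ≤ japaneseBracket x :=
  Real.one_le_sqrt.2 (by nlinarith [sq_nonneg ‖x‖])

theorem japaneseBracket_pos (x : R3) : 0 < japaneseBracket x :=
  zero_lt_one.trans_le (one_le_japaneseBracket x)

theorem japaneseBracket_sq (x : R3) : japaneseBracket x ^ 2 = 1 + ‖x‖ ^ 2 :=
  Real.sq_sqrt (by positivity)

theorem norm_le_japaneseBracket (x : R3) : ‖x‖ ≤ japaneseBracket x :=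
  Real.le_sqrt_of_sq_le (by linarith)

theorem contDiff_japaneseBracket : ContDiff ℝ ∞ japaneseBracket :=
  (contDiff_const.add (contDiff_norm_sq ℝ)).sqrt fun x => by positivity

theorem pd_comp_japaneseBracket {h : ℝ → ℝ} {h' : ℝ} {x : R3}
    (hh : HasDerivAt h h' (japaneseBracket x)) (j : Fin 3) :
    pd j (fun y => h (japaneseBracket y)) x = h' * (x j / japaneseBracket x) := by
  have h1 : HasFDerivAt (fun y : R3 => 1 + ‖y‖ ^ 2) (2 • innerSL ℝ x) x :=
    ((hasStrictFDerivAt_norm_sq x).hasFDerivAt).const_add 1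
  have h2 : HasFDerivAt japaneseBracket
      ((1 / (2 * japaneseBracket x)) • (2 • innerSL ℝ x)) x :=
    h1.sqrt (by positivity)
  have h3 := hh.comp_hasFDerivAt x h2
  have h4 : pd j (fun y => h (japaneseBracket y)) x =
      (h' • ((1 / (2 * japaneseBracket x)) • (2 • innerSL ℝ x))) (stdVec j) := by
    rw [← h3.fderiv]; rfl
  have h0 := japaneseBracket_pos x
  rw [h4]
  simp only [smul_apply, smul_eq_mul, innerSL_apply_apply,
    EuclideanSpace.inner_single_right, nsmul_eq_mul]
  simp [-mul_eq_mul_left_iff]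
  field_simp

theorem euler_comp_japaneseBracket {h : ℝ → ℝ} {h' : ℝ} {x : R3}
    (hh : HasDerivAt h h' (japaneseBracket x)) :
    euler 0 (fun y => h (japaneseBracket y)) x = h' * (‖x‖ ^ 2 / japaneseBracket x) := by
  simp only [euler, pd_comp_japaneseBracket hh, norm_sq_eq_sum, PiLp.zero_apply, sub_zero,
    Fin.sum_univ_three]
  ring

/-- The weight exponent `α⟨x⟩ + γ⟨x⟩/(1 + δ⟨x⟩)`: of growth rate `α` at infinity when `δ > 0`, and
increasing to `(α + γ)⟨x⟩` as `δ → 0`. -/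
noncomputable def weightExp (α γ δ : ℝ) (x : R3) : ℝ :=
  α * japaneseBracket x + γ * (japaneseBracket x / (1 + δ * japaneseBracket x))

/-- The function `g` with `∇F = g x` for `F = weightExp α γ δ`. -/
noncomputable def weightSlope (α γ δ : ℝ) (x : R3) : ℝ :=
  α / japaneseBracket x + γ / (japaneseBracket x * (1 + δ * japaneseBracket x) ^ 2)

section
variable {α γ δ : ℝ}

theorem weight_den_pos (hδ : 0 ≤ δ) (x : R3) : 0 < 1 + δ * japaneseBracket x := by
  have := japaneseBracket_pos x
  positivity

theorem contDiff_weightExp (hδ : 0 ≤ δ) : ContDiff ℝ ∞ (weightExp α γ δ) := by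
  have c := contDiff_japaneseBracket
  exact (contDiff_const.mul c).add (contDiff_const.mul (c.div
    (contDiff_const.add (contDiff_const.mul c)) fun x => (weight_den_pos hδ x).ne'))

theorem contDiff_weightSlope (hδ : 0 ≤ δ) : ContDiff ℝ ∞ (weightSlope α γ δ) := by
  have c := contDiff_japaneseBracket
  exact (contDiff_const.div c fun x => (japaneseBracket_pos x).ne').add
    (contDiff_const.div (c.mul ((contDiff_const.add (contDiff_const.mul c)).pow 2))
      fun x => (mul_pos (japaneseBracket_pos x) (pow_pos (weight_den_pos hδ x) 2)).ne')

theorem pd_weightExp (hδ : 0 ≤ δ) (j : Fin 3) (x : R3) :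
    pd j (weightExp α γ δ) x = (x j - (0 : R3) j) * weightSlope α γ δ x := by
  have h0 := japaneseBracket_pos x
  have h1 := weight_den_pos hδ x
  have hd : HasDerivAt (fun t : ℝ => α * t + γ * (t / (1 + δ * t)))
      (α * 1 + γ * ((1 * (1 + δ * japaneseBracket x) - japaneseBracket x * (δ * 1)) /
        (1 + δ * japaneseBracket x) ^ 2)) (japaneseBracket x) :=
    ((hasDerivAt_id _).const_mul α).add (((hasDerivAt_id _).div
      (((hasDerivAt_id _).const_mul δ).const_add 1) h1.ne').const_mul γ)
  have := pd_comp_japaneseBracket hd j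
  change pd j (fun y => α * japaneseBracket y +
    γ * (japaneseBracket y / (1 + δ * japaneseBracket y))) x = _
  rw [this, weightSlope, PiLp.zero_apply, sub_zero]
  generalize japaneseBracket x = t at *
  field_simp
  ring

theorem euler_weightSlope (hδ : 0 ≤ δ) (x : R3) :
    euler 0 (weightSlope α γ δ) x = -(‖x‖ ^ 2 / japaneseBracket x ^ 3 *
      (α + γ * (3 * (1 + δ * japaneseBracket x) - 2) / (1 + δ * japaneseBracket x) ^ 3)) := by
  have h0 := japaneseBracket_pos x
  have h1 := weight_den_pos hδ x
  have hd : HasDerivAt (fun t : ℝ => α / t + γ / (t * (1 + δ * t) ^ 2))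
      ((0 * japaneseBracket x - α * 1) / japaneseBracket x ^ 2 +
        (0 * (japaneseBracket x * (1 + δ * japaneseBracket x) ^ 2) -
          γ * (1 * (1 + δ * japaneseBracket x) ^ 2 + japaneseBracket x *
            ((2 : ℕ) * (1 + δ * japaneseBracket x) ^ (2 - 1) * (δ * 1)))) /
        (japaneseBracket x * (1 + δ * japaneseBracket x) ^ 2) ^ 2) (japaneseBracket x) :=
    ((hasDerivAt_const _ α).div (hasDerivAt_id _) h0.ne').add
      ((hasDerivAt_const _ γ).div ((hasDerivAt_id _).mul
        ((((hasDerivAt_id _).const_mul δ).const_add 1).pow 2)) (mul_pos h0 (pow_pos h1 2)).ne')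
  have := euler_comp_japaneseBracket hd
  change euler 0 (fun y => α / japaneseBracket y +
    γ / (japaneseBracket y * (1 + δ * japaneseBracket y) ^ 2)) x = _
  rw [this]
  generalize japaneseBracket x = t at *
  simp only [Nat.cast_ofNat, Nat.add_one_sub_one, pow_one]
  field_simp
  ring

/-- The algebra behind `weight_coercive`, with `φ/t` the slope of the weight, `θ = |x|²/⟨x⟩²` and
`-θB/t` the Euler derivative of the slope. -/
theorem slope_coercive {φ B θ t r E Q : ℝ} (ht : 0 < t) (hφ : 0 ≤ φ) (hγ : 0 ≤ γ)
    (hφγ : φ * γ ≤ E / 16) (b1 : φ ≤ B) (b3 : B ≤ φ + γ / 2) (hθ : r ^ 2 = θ * t ^ 2)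
    (θ1 : θ ≤ 1) (θ2 : 1 / 2 ≤ θ) (hE : 0 < E) (hE' : 1568 ≤ E * t ^ 2) (hQ : 3 / 4 * E ≤ Q) :
    2 * (E / 4) + r ^ 2 * (φ / t) ^ 2 / 8 ≤
      r ^ 2 * (3 * (φ / t) ^ 2 + 2 * (φ / t) * -(θ * B / t)) + Q - 7 * (φ / t) := by
  have c1 : r ^ 2 * (φ / t) ^ 2 = θ * φ ^ 2 := by rw [hθ]; field_simp
  have c2 : r ^ 2 * (3 * (φ / t) ^ 2 + 2 * (φ / t) * -(θ * B / t)) =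
      3 * (θ * φ ^ 2) - 2 * (θ ^ 2 * (φ * B)) := by
    rw [hθ]; field_simp; ring
  have c3 : 7 * (φ / t) ≤ φ ^ 2 / 8 + E / 16 := by
    have d1 : 98 / t ^ 2 ≤ E / 16 := by
      rw [div_le_iff₀ (by positivity)]
      linarith
    have d2 : φ ^ 2 / 8 + 98 / t ^ 2 - 7 * (φ / t) = (φ - 28 / t) ^ 2 / 8 := by
      field_simp; ring
    linarith [sq_nonneg (φ - 28 / t)]
  have c4 : θ ^ 2 * (φ * B) ≤ θ * φ ^ 2 + φ * γ / 2 := by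
    have d1 : θ ^ 2 ≤ θ := by nlinarith
    have d2 : φ * B ≤ φ ^ 2 + φ * γ / 2 := by nlinarith
    have d3 : 0 ≤ φ * γ := by positivity
    calc θ ^ 2 * (φ * B) ≤ θ * (φ * B) :=
          mul_le_mul_of_nonneg_right d1 (mul_nonneg hφ (by linarith))
      _ ≤ θ * (φ ^ 2 + φ * γ / 2) := mul_le_mul_of_nonneg_left d2 (by linarith)
      _ ≤ θ * φ ^ 2 + φ * γ / 2 := by nlinarith
  have c6 : φ ^ 2 / 2 ≤ θ * φ ^ 2 := by
    have := mul_le_mul_of_nonneg_right θ2 (sq_nonneg φ)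
    linarith
  rw [c2, c1]
  linarith [sq_nonneg φ]

/-- Coercivity of the virial density at infinity for the radial weights: the term `-2γ(α + γ)`
produced by the bending of the weight is absorbed by the energy `E`. -/
theorem weight_coercive {E Q : ℝ} (hα : 0 ≤ α) (hγ : 0 ≤ γ) (hδ : 0 ≤ δ) (hE : 0 < E)
    (hγE : γ * (α + γ) ≤ E / 16) {x : R3} (hx : 1 ≤ ‖x‖) (hxE : 1568 / E ≤ ‖x‖ ^ 2)
    (hQ : 3 / 4 * E ≤ Q) :
    0 ≤ weightSlope α γ δ x ∧ -3 * weightSlope α γ δ x ≤ euler 0 (weightSlope α γ δ) x ∧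
      euler 0 (weightSlope α γ δ) x ≤ 0 ∧
      2 * (E / 4) + ‖x‖ ^ 2 * weightSlope α γ δ x ^ 2 / 8 ≤
        ‖x‖ ^ 2 * (3 * weightSlope α γ δ x ^ 2 +
          2 * weightSlope α γ δ x * euler 0 (weightSlope α γ δ) x) + Q -
          7 * weightSlope α γ δ x := by
  have h0 := japaneseBracket_pos x
  have hs : 1 ≤ 1 + δ * japaneseBracket x := by
    have : 0 ≤ δ * japaneseBracket x := by positivity
    linarith
  have hsq := japaneseBracket_sq x
  rw [euler_weightSlope hδ, weightSlope]
  set t := japaneseBracket x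
  set s := 1 + δ * t
  have hs0 : 0 < s := by linarith
  set φ := α + γ / s ^ 2 with hφ
  set B := α + γ * (3 * s - 2) / s ^ 3 with hB
  have hφ0 : 0 ≤ φ := by positivity
  have e1 : α / t + γ / (t * s ^ 2) = φ / t := by
    rw [hφ]; field_simp
  have hBφ : B - φ = γ * (2 * (s - 1) / s ^ 3) := by
    rw [hB, hφ]; field_simp; ring
  have k1 : 2 * (s - 1) / s ^ 3 ≤ 1 / 2 := by
    rw [div_le_iff₀ (by positivity)]
    have : s ^ 2 ≤ s ^ 3 := pow_le_pow_right₀ hs (by norm_num)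
    nlinarith [sq_nonneg (s - 2)]
  have k2 : 0 ≤ 2 * (s - 1) / s ^ 3 := div_nonneg (by linarith) (by positivity)
  have k3 : 2 * (s - 1) / s ^ 3 ≤ 2 * (1 / s ^ 2) := by
    rw [div_le_iff₀ (by positivity)]
    have : 2 * (1 / s ^ 2) * s ^ 3 = 2 * s := by field_simp
    rw [this]; linarith
  have b1 : φ ≤ B := by nlinarith [mul_nonneg hγ k2]
  have b2 : B ≤ 3 * φ := by
    have : γ * (1 / s ^ 2) = γ / s ^ 2 := by ring
    nlinarith [mul_le_mul_of_nonneg_left k3 hγ]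
  have b3 : B ≤ φ + γ / 2 := by nlinarith [mul_le_mul_of_nonneg_left k1 hγ]
  have b4 : φ ≤ α + γ := by
    have : γ / s ^ 2 ≤ γ := div_le_self hγ (one_le_pow₀ hs)
    linarith
  set θ := ‖x‖ ^ 2 / t ^ 2 with hθ
  have hr1 : 1 ≤ ‖x‖ ^ 2 := one_le_pow₀ hx
  have θ1 : θ ≤ 1 := by rw [hθ, div_le_one (by positivity)]; linarith
  have θ2 : 1 / 2 ≤ θ := by rw [hθ, le_div_iff₀ (by positivity)]; linarith
  have e2 : ‖x‖ ^ 2 / t ^ 3 * B = θ * B / t := by rw [hθ]; field_simp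
  have hθt : ‖x‖ ^ 2 = θ * t ^ 2 := by rw [hθ]; field_simp
  have hEt : 1568 ≤ E * t ^ 2 := by
    rw [div_le_iff₀ hE] at hxE
    nlinarith
  rw [e1, e2]
  clear_value φ B θ t
  have hθB : 0 ≤ θ * B := mul_nonneg (by linarith) (by linarith)
  have hθB3 : θ * B ≤ 3 * φ := (mul_le_of_le_one_left (by linarith) θ1).trans b2
  have n1 : 0 ≤ θ * B / t := by positivity
  have n2 : θ * B / t ≤ 3 * φ / t := by gcongr
  have n3 : 3 * φ / t = 3 * (φ / t) := by ring
  refine ⟨by positivity, by linarith, by linarith, ?_⟩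
  exact slope_coercive h0 hφ0 hγ (by nlinarith) b1 b3 hθt θ1 θ2 hE hEt hQ

end

/-! ### Mollification of `H²` functions -/

theorem eLpNorm_two_sq {α : Type*} {m : MeasurableSpace α} {μ : Measure α} (f : α → ℝ) :
    eLpNorm f 2 μ ^ 2 = ∫⁻ x, ENNReal.ofReal (f x ^ 2) ∂μ := by
  rw [eLpNorm_eq_lintegral_rpow_enorm_toReal (by norm_num) (by norm_num)]
  rw [← ENNReal.rpow_natCast, ← ENNReal.rpow_mul]
  norm_num
  refine lintegral_congr fun x => ?_
  rw [← Real.enorm_of_nonneg (sq_nonneg (f x)), enorm_pow]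

/-- Translations act continuously on `L²(ℝ³)`. -/
theorem exists_translation_close {f : R3 → ℝ} (hf : MemLp f 2 volume) {ε : ℝ} (hε : 0 < ε) :
    ∃ η > 0, ∀ t : R3, ‖t‖ < η →
      ∫⁻ x, ENNReal.ofReal ((f (x - t) - f x) ^ 2) ≤ ENNReal.ofReal ε := by
  have : Fact ((2 : ENNReal) ≠ ⊤) := ⟨by norm_num⟩
  have hc : Continuous fun t : R3 => DomAddAct.mk (-t) +ᵥ hf.toLp f :=
    (DomAddAct.mkHomeomorph.continuous.comp continuous_neg).vadd continuous_const
  have h0 : DomAddAct.mk (-(0 : R3)) +ᵥ hf.toLp f = hf.toLp f := by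
    rw [neg_zero]
    exact zero_vadd _ _
  have h1 := hc.tendsto 0
  simp only [h0] at h1
  obtain ⟨η, hη, h2⟩ := EMetric.tendsto_nhds_nhds.1 h1 (ENNReal.ofReal (√ε)) (by simpa using hε)
  obtain ⟨r, hr, hrη⟩ : ∃ r : ℝ, 0 < r ∧ ENNReal.ofReal r ≤ η := by
    by_cases hη' : η = ⊤
    · exact ⟨1, one_pos, by simp [hη']⟩
    · exact ⟨η.toReal, ENNReal.toReal_pos hη.ne' hη', ENNReal.ofReal_toReal_le⟩
  refine ⟨r, hr, fun t ht => ?_⟩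
  have h3 := h2 (x := t) (by
    rw [edist_zero_right, ← ofReal_norm]
    exact ((ENNReal.ofReal_lt_ofReal_iff hr).2 ht).trans_le hrη)
  rw [DomAddAct.mk_vadd_toLp, Lp.edist_toLp_toLp] at h3
  have h4 : (fun x : R3 => ENNReal.ofReal ((f (x - t) - f x) ^ 2)) =
      fun x => ENNReal.ofReal (((fun y : R3 => f (-t +ᵥ y)) - f) x ^ 2) := by
    funext x
    simp [vadd_eq_add, sub_eq_neg_add]
  rw [h4, ← eLpNorm_two_sq]
  calc _ ≤ ENNReal.ofReal (√ε) ^ 2 := by gcongr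
    _ = ENNReal.ofReal ε := by
      rw [← ENNReal.ofReal_pow (Real.sqrt_nonneg _), Real.sq_sqrt hε.le]

/-- Jensen's inequality for the square, with a smooth probability density. -/
theorem sq_integral_le_of_density {k h : R3 → ℝ} (hk : ∀ t, 0 ≤ k t) (k1 : ∫ t, k t = 1)
    (ki : Integrable k volume) (i1 : Integrable (fun t => k t * h t) volume)
    (i2 : Integrable (fun t => k t * h t ^ 2) volume) :
    (∫ t, k t * h t) ^ 2 ≤ ∫ t, k t * h t ^ 2 := by
  set c := ∫ t, k t * h t with hc
  have h0 : 0 ≤ ∫ t, (k t * h t ^ 2 - 2 * c * (k t * h t) + c ^ 2 * k t) := by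
    refine integral_nonneg fun t => ?_
    have : k t * h t ^ 2 - 2 * c * (k t * h t) + c ^ 2 * k t = k t * (h t - c) ^ 2 := by ring
    rw [this]
    exact mul_nonneg (hk t) (sq_nonneg _)
  have i3 : Integrable (fun t => k t * h t ^ 2 - 2 * c * (k t * h t)) volume :=
    i2.sub (i1.const_mul (2 * c))
  rw [integral_add i3 (ki.const_mul (c ^ 2)), integral_sub i2 (i1.const_mul (2 * c)), integral_const_mul, integral_const_mul, k1, ← hc] at h0
  nlinarith

/-- Convolution of a real function with the normalised bump `φ`. -/
noncomputable def mollify (φ : ContDiffBump (0 : R3)) (f : R3 → ℝ) : R3 → ℝ :=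
  fun x => ∫ t, φ.normed volume t * f (x - t)

section
variable (φ : ContDiffBump (0 : R3))

theorem isTestFun_normed : IsTestFun (φ.normed volume) :=
  ⟨φ.contDiff_normed (n := ⊤), φ.hasCompactSupport_normed⟩

theorem IsTestFun.reflect {u : R3 → ℝ} (hu : IsTestFun u) (x : R3) :
    IsTestFun (fun y => u (x - y)) :=
  ⟨hu.1.comp (contDiff_const.sub contDiff_id),
    hu.2.comp_homeomorph (Homeomorph.subLeft x)⟩

theorem pd_reflect {u : R3 → ℝ} (hu : IsTestFun u) (j : Fin 3) (x y : R3) :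
    pd j (fun y => u (x - y)) y = -pd j u (x - y) := by
  have h : HasFDerivAt (fun y => u (x - y)) ((fderiv ℝ u (x - y)).comp
      (-ContinuousLinearMap.id ℝ R3)) y :=
    (hu.1.differentiableAt_infty (x - y)).hasFDerivAt.comp y ((hasFDerivAt_id y).const_sub x)
  simp [pd, h.fderiv]

theorem integral_mul_reflect (u f : R3 → ℝ) (x : R3) :
    ∫ t, u t * f (x - t) = ∫ y, u (x - y) * f y := by
  rw [← integral_sub_left_eq_self _ volume x]
  simp

theorem mollify_eq_convolution (f : R3 → ℝ) :
    mollify φ f = convolution (φ.normed volume) f (ContinuousLinearMap.lsmul ℝ ℝ) volume := rfl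

variable {φ}

theorem contDiff_mollify {f : R3 → ℝ} (hf : LocallyIntegrable f volume) :
    ContDiff ℝ ∞ (mollify φ f) := by
  rw [mollify_eq_convolution]
  exact φ.hasCompactSupport_normed.contDiff_convolution_left _ (φ.contDiff_normed (n := ⊤)) hf

theorem pd_mollify {f : R3 → ℝ} (hf : LocallyIntegrable f volume) (j : Fin 3) (x : R3) :
    pd j (mollify φ f) x = ∫ t, pd j (φ.normed volume) t * f (x - t) := by
  have ht := isTestFun_normed φ
  have h := ht.2.hasFDerivAt_convolution_left (ContinuousLinearMap.lsmul ℝ ℝ)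
    (ht.1.of_le (by exact_mod_cast le_top)) hf x
  have hi := (ht.2.fderiv ℝ).convolutionExists_left
    ((ContinuousLinearMap.lsmul ℝ ℝ).precompL R3)
    (ht.1.continuous_fderiv (by simp)) hf x
  simp only [pd]
  rw [mollify_eq_convolution, h.fderiv, convolution, ContinuousLinearMap.integral_apply hi]
  rfl

theorem mollify_eq_reflect (f : R3 → ℝ) (x : R3) :
    mollify φ f x = ∫ y, φ.normed volume (x - y) * f y :=
  integral_mul_reflect _ _ _

/-- Mollification commutes with weak derivatives. -/
theorem HasWeakGrad.pd_mollify {q : R3 → ℝ} {q' : Fin 3 → R3 → ℝ} (hq : HasWeakGrad q q')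
    (j : Fin 3) : pd j (mollify φ q) = mollify φ (q' j) := by
  funext x
  have h := hq.2.2 _ ((isTestFun_normed φ).reflect x) j
  simp only [pd_reflect (isTestFun_normed φ)] at h
  rw [_root_.pd_mollify hq.1, integral_mul_reflect, mollify_eq_reflect]
  simp only [neg_mul, integral_neg, neg_inj] at h
  exact h

theorem MeasureTheory.MemLp.locallyIntegrable_two {f : R3 → ℝ} (hf : MemLp f 2 volume) :
    LocallyIntegrable f volume := hf.locallyIntegrable (by norm_num)

theorem memLp_mollify_sub {f : R3 → ℝ} (hf : MemLp f 2 volume) {ε : ℝ} (hε : 0 < ε) :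
    ∃ η > 0, ∀ φ : ContDiffBump (0 : R3), φ.rOut < η →
      Integrable (fun x => (mollify φ f x - f x) ^ 2) volume ∧
      ∫ x, (mollify φ f x - f x) ^ 2 ≤ ε := by
  obtain ⟨η, hη, h⟩ := exists_translation_close hf hε
  refine ⟨η, hη, fun φ hφ => ?_⟩
  set k := φ.normed volume with hk
  have ht := isTestFun_normed φ
  have hloc := hf.locallyIntegrable_two
  have hloc2 : LocallyIntegrable (fun x => f x ^ 2) volume := hf.integrable_sq.locallyIntegrable
  have i1 : ∀ x, Integrable (fun t => k t * f (x - t)) volume := fun x => by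
    have := ((ht.reflect x).integrable_mul hloc).comp_sub_left x
    simpa using this
  have i2 : ∀ x, Integrable (fun t => k t * f (x - t) ^ 2) volume := fun x => by
    have := ((ht.reflect x).integrable_mul hloc2).comp_sub_left x
    simpa using this
  have k0 : ∀ t, 0 ≤ k t := fun t => φ.nonneg_normed t
  have k1 : ∫ t, k t = 1 := φ.integral_normed
  have ki : Integrable k volume := φ.integrable_normed
  have i3 : ∀ x, Integrable (fun t => k t * (f (x - t) - f x)) volume := fun x =>
    ((i1 x).sub (ki.mul_const (f x))).congr (.of_forall fun t => by simp; ring)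
  have i4 : ∀ x, Integrable (fun t => k t * (f (x - t) - f x) ^ 2) volume := fun x =>
    (((i2 x).sub ((i1 x).const_mul (2 * f x))).add (ki.mul_const (f x ^ 2))).congr
      (.of_forall fun t => by simp; ring)
  have e1 : ∀ x, mollify φ f x - f x = ∫ t, k t * (f (x - t) - f x) := by
    intro x
    simp only [mul_sub]
    rw [integral_sub (i1 x) (ki.mul_const _), integral_mul_const, k1, one_mul]
    rfl
  have e2 : ∀ x, ENNReal.ofReal ((mollify φ f x - f x) ^ 2) ≤
      ∫⁻ t, ENNReal.ofReal (k t * (f (x - t) - f x) ^ 2) := by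
    intro x
    rw [← ofReal_integral_eq_lintegral_ofReal (i4 x)
      (.of_forall fun t => mul_nonneg (k0 t) (sq_nonneg _)), e1]
    exact ENNReal.ofReal_le_ofReal (sq_integral_le_of_density k0 k1 ki (i3 x) (i4 x))
  have hm : AEStronglyMeasurable (fun p : R3 × R3 => k p.2 * (f (p.1 - p.2) - f p.1) ^ 2)
      (volume.prod volume) := by
    have m1 : AEStronglyMeasurable (fun p : R3 × R3 => f (p.1 - p.2)) (volume.prod volume) :=
      hf.1.comp_quasiMeasurePreserving (quasiMeasurePreserving_sub volume volume)
    have m2 : AEStronglyMeasurable (fun p : R3 × R3 => f p.1) (volume.prod volume) :=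
      hf.1.comp_fst
    have m3 : AEStronglyMeasurable (fun p : R3 × R3 => k p.2) (volume.prod volume) :=
      (ht.1.continuous.comp continuous_snd).aestronglyMeasurable
    exact m3.mul ((m1.sub m2).pow 2)
  have e3 : ∫⁻ x, ENNReal.ofReal ((mollify φ f x - f x) ^ 2) ≤ ENNReal.ofReal ε := by
    calc _ ≤ ∫⁻ x, ∫⁻ t, ENNReal.ofReal (k t * (f (x - t) - f x) ^ 2) := lintegral_mono e2
      _ = ∫⁻ t, ∫⁻ x, ENNReal.ofReal (k t * (f (x - t) - f x) ^ 2) :=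
        lintegral_lintegral_swap hm.aemeasurable.ennreal_ofReal
      _ ≤ ∫⁻ t, ENNReal.ofReal (k t) * ENNReal.ofReal ε := by
        refine lintegral_mono fun t => ?_
        simp only [ENNReal.ofReal_mul (k0 t)]
        rw [lintegral_const_mul' _ _ ENNReal.ofReal_ne_top]
        by_cases hkt : k t = 0
        · simp [hkt]
        · gcongr
          have : t ∈ Function.support k := hkt
          rw [hk, φ.support_normed_eq, mem_ball_zero_iff] at this
          exact h t (this.trans hφ)
      _ = ENNReal.ofReal ε := by
        rw [lintegral_mul_const' _ _ ENNReal.ofReal_ne_top,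
          ← ofReal_integral_eq_lintegral_ofReal ki (.of_forall k0), k1]
        simp
  have m : AEStronglyMeasurable (fun x => (mollify φ f x - f x) ^ 2) volume :=
    ((contDiff_mollify hloc).continuous.aestronglyMeasurable.sub hf.1).pow 2
  have i : Integrable (fun x => (mollify φ f x - f x) ^ 2) volume :=
    ⟨m, (hasFiniteIntegral_iff_ofReal (.of_forall fun x => sq_nonneg _)).2
      (e3.trans_lt ENNReal.ofReal_lt_top)⟩
  refine ⟨i, ?_⟩
  rw [← ofReal_integral_eq_lintegral_ofReal i (.of_forall fun x => sq_nonneg _)] at e3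
  exact (ENNReal.ofReal_le_ofReal_iff hε.le).1 e3

end

/-- A real function `ψ ∈ H²(ℝ³)`, with weak partial derivatives `p j ∈ L²` and weak Laplacian
`ℓ ∈ L²`. -/
structure IsSobolevH2 (ψ : R3 → ℝ) (p : Fin 3 → R3 → ℝ) (ℓ : R3 → ℝ) : Prop where
  memLp : MemLp ψ 2 volume
  memLp_grad : ∀ j, MemLp (p j) 2 volume
  memLp_lap : MemLp ℓ 2 volume
  grad : ∀ φ, IsTestFun φ → ∀ j, ∫ x, pd j φ x * ψ x = - ∫ x, φ x * p j x
  lap : ∀ φ, IsTestFun φ → ∫ x, ∑ j, pd j φ x * p j x = - ∫ x, φ x * ℓ x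

theorem IsSobolevH2.hasWeakGrad {ψ ℓ : R3 → ℝ} {p : Fin 3 → R3 → ℝ} (h : IsSobolevH2 ψ p ℓ) :
    HasWeakGrad ψ p :=
  ⟨h.memLp.locallyIntegrable_two, fun j => (h.memLp_grad j).locallyIntegrable_two, h.grad⟩

theorem IsSobolevH2.lap_mollify {ψ ℓ : R3 → ℝ} {p : Fin 3 → R3 → ℝ} (h : IsSobolevH2 ψ p ℓ)
    (φ : ContDiffBump (0 : R3)) : _root_.lap (mollify φ ψ) = mollify φ ℓ := by
  funext x
  have h1 := h.lap _ ((isTestFun_normed φ).reflect x)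
  simp only [pd_reflect (isTestFun_normed φ)] at h1
  have hi : ∀ j ∈ Finset.univ, Integrable
      (fun y => -pd j (φ.normed volume) (x - y) * p j y) volume := fun j _ => by
    have := ((isTestFun_pd (isTestFun_normed φ) j).reflect x).integrable_mul
      (h.memLp_grad j).locallyIntegrable_two
    simpa using this.neg
  rw [integral_finsetSum _ hi] at h1
  simp only [_root_.lap, h.hasWeakGrad.pd_mollify,
    pd_mollify (h.memLp_grad _).locallyIntegrable_two, integral_mul_reflect (pd _ _)]
  rw [mollify_eq_reflect]
  simp only [neg_mul, integral_neg, Finset.sum_neg_distrib, neg_inj] at h1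
  exact h1

/-- Smooth functions are dense in `H²(ℝ³)`. -/
theorem IsSobolevH2.exists_smooth_approx {ψ ℓ : R3 → ℝ} {p : Fin 3 → R3 → ℝ}
    (h : IsSobolevH2 ψ p ℓ) {ε : ℝ} (hε : 0 < ε) :
    ∃ v : R3 → ℝ, ContDiff ℝ ∞ v ∧
      Integrable (fun x => (v x - ψ x) ^ 2 + ∑ j, (pd j v x - p j x) ^ 2 +
        (_root_.lap v x - ℓ x) ^ 2) volume ∧
      ∫ x, ((v x - ψ x) ^ 2 + ∑ j, (pd j v x - p j x) ^ 2 + (_root_.lap v x - ℓ x) ^ 2) ≤ ε := by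
  have hε5 : 0 < ε / 5 := by positivity
  obtain ⟨η, hη, h1⟩ := memLp_mollify_sub h.memLp hε5
  obtain ⟨η', hη', h2⟩ := memLp_mollify_sub h.memLp_lap hε5
  choose ηj hηj h3 using fun j => memLp_mollify_sub (h.memLp_grad j) hε5
  obtain ⟨r, hr, hr1, hr2, hr3⟩ : ∃ r > 0, r < η ∧ r < η' ∧ ∀ j, r < ηj j := by
    refine ⟨min (min η η') (min (ηj 0) (min (ηj 1) (ηj 2))) / 2, ?_, ?_, ?_, ?_⟩
    · have := hηj 0
      have := hηj 1
      have := hηj 2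
      positivity
    · linarith [min_le_left (min η η') (min (ηj 0) (min (ηj 1) (ηj 2))), min_le_left η η']
    · linarith [min_le_left (min η η') (min (ηj 0) (min (ηj 1) (ηj 2))), min_le_right η η']
    · have a0 := hηj 0
      have a1 := hηj 1
      have a2 := hηj 2
      have b := min_le_right (min η η') (min (ηj 0) (min (ηj 1) (ηj 2)))
      have b0 := min_le_left (ηj 0) (min (ηj 1) (ηj 2))
      have b1 := min_le_right (ηj 0) (min (ηj 1) (ηj 2))
      have b2 := min_le_left (ηj 1) (ηj 2)
      have b3 := min_le_right (ηj 1) (ηj 2)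
      intro j
      fin_cases j <;> simp only [Fin.zero_eta, Fin.mk_one, Fin.reduceFinMk] <;> linarith
  let φ : ContDiffBump (0 : R3) := ⟨r / 2, r, by positivity, by linarith⟩
  obtain ⟨i1, l1⟩ := h1 φ hr1
  obtain ⟨i2, l2⟩ := h2 φ hr2
  have i3 := fun j => (h3 j φ (hr3 j)).1
  have l3 := fun j => (h3 j φ (hr3 j)).2
  have i4 : Integrable (fun x => ∑ j, (mollify φ (p j) x - p j x) ^ 2) volume :=
    integrable_finsetSum _ fun j _ => i3 j
  refine ⟨mollify φ ψ, contDiff_mollify h.memLp.locallyIntegrable_two, ?_, ?_⟩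
  · simp only [h.hasWeakGrad.pd_mollify, h.lap_mollify]
    exact (i1.add i4).add i2
  · simp only [h.hasWeakGrad.pd_mollify, h.lap_mollify]
    have i5 : Integrable (fun x => (mollify φ ψ x - ψ x) ^ 2 +
        ∑ j, (mollify φ (p j) x - p j x) ^ 2) volume := i1.add i4
    rw [integral_add i5 i2, integral_add i1 i4, integral_finsetSum _ fun j _ => i3 j,
      Fin.sum_univ_three]
    linarith [l3 0, l3 1, l3 2]

/-! ### Carleman inequalities for truncated `H²` functions -/

section
variable {χ v : R3 → ℝ}

theorem lap_mul (hχ : ContDiff ℝ ∞ χ) (hv : ContDiff ℝ ∞ v) (x : R3) :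
    lap (fun y => χ y * v y) x = χ x * lap v x + 2 * ∑ j, pd j χ x * pd j v x + lap χ x * v x := by
  have h1 : ∀ j, pd j (fun y => χ y * v y) = fun x => pd j χ x * v x + χ x * pd j v x :=
    fun j => funext (pd_mul hχ hv j)
  have h2 : ∀ j, pd j (pd j (fun y => χ y * v y)) x =
      pd j (pd j χ) x * v x + 2 * (pd j χ x * pd j v x) + χ x * pd j (pd j v) x := by
    intro j
    rw [h1, pd_add ((contDiff_pd hχ j).mul hv) (hχ.mul (contDiff_pd hv j)),
      pd_mul (contDiff_pd hχ j) hv, pd_mul hχ (contDiff_pd hv j)]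
    ring
  simp only [lap, h2, Fin.sum_univ_three]
  ring

/-- The gradient part of the error made by replacing a Sobolev function by a smooth one. -/
theorem grad_error_le {K χ d0 : ℝ} {c d : Fin 3 → ℝ} (hχ : χ ^ 2 ≤ K) (hc : ∀ j, c j ^ 2 ≤ K) :
    (χ * d0) ^ 2 + ∑ j, (c j * d0 + χ * d j) ^ 2 ≤ 7 * K * (d0 ^ 2 + ∑ j, d j ^ 2) := by
  have h : ∀ j, (c j * d0 + χ * d j) ^ 2 ≤ 2 * K * d0 ^ 2 + 2 * K * d j ^ 2 := by
    intro j
    nlinarith [sq_nonneg (c j * d0 - χ * d j), mul_le_mul_of_nonneg_right (hc j) (sq_nonneg d0),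
      mul_le_mul_of_nonneg_right hχ (sq_nonneg (d j))]
  have hK : 0 ≤ K := (sq_nonneg χ).trans hχ
  have h0 := mul_le_mul_of_nonneg_right hχ (sq_nonneg d0)
  have k := fun j => mul_nonneg hK (sq_nonneg (d j))
  simp only [Fin.sum_univ_three]
  linarith [h 0, h 1, h 2, k 0, k 1, k 2]

theorem sq_add_three_le (a b c : ℝ) : (a + b + c) ^ 2 ≤ 3 * (a ^ 2 + b ^ 2 + c ^ 2) := by
  nlinarith [sq_nonneg (a - b), sq_nonneg (a - c), sq_nonneg (b - c)]

/-- Cauchy-Schwarz for the commutator of the Laplacian with a cutoff. -/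
theorem cutoff_sq_le (χ e d0 dl : ℝ) (c d : Fin 3 → ℝ) :
    (χ * dl + 2 * ∑ j, c j * d j + e * d0) ^ 2 ≤
      3 * (χ ^ 2 * dl ^ 2 + 4 * ((∑ j, c j ^ 2) * ∑ j, d j ^ 2) + e ^ 2 * d0 ^ 2) := by
  have h := Finset.sum_mul_sq_le_sq_mul_sq Finset.univ c d
  have h2 := sq_add_three_le (χ * dl) (2 * ∑ j, c j * d j) (e * d0)
  simp only [mul_pow] at h2
  linarith

theorem lap_error_le {K χ e d0 dl : ℝ} {c d : Fin 3 → ℝ} (hχ : χ ^ 2 ≤ K)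
    (hc : ∀ j, c j ^ 2 ≤ K) (he : e ^ 2 ≤ K) :
    (χ * dl + 2 * ∑ j, c j * d j + e * d0) ^ 2 ≤
      36 * K * (d0 ^ 2 + ∑ j, d j ^ 2 + dl ^ 2) := by
  have h1 := cutoff_sq_le χ e d0 dl c d
  have hK : 0 ≤ K := (sq_nonneg χ).trans hχ
  have h2 : ∑ j, c j ^ 2 ≤ 3 * K := by
    rw [Fin.sum_univ_three]; linarith [hc 0, hc 1, hc 2]
  have hD : 0 ≤ ∑ j, d j ^ 2 := Finset.sum_nonneg fun j _ => sq_nonneg _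
  have h3 := mul_le_mul_of_nonneg_right h2 hD
  have h4 := mul_le_mul_of_nonneg_right hχ (sq_nonneg dl)
  have h5 := mul_le_mul_of_nonneg_right he (sq_nonneg d0)
  have h6 := mul_nonneg hK (sq_nonneg dl)
  have h7 := mul_nonneg hK (sq_nonneg d0)
  linarith

theorem two_sq_add_le (a b : ℝ) : a ^ 2 ≤ 2 * b ^ 2 + 2 * (b - a) ^ 2 := by
  nlinarith [sq_nonneg (2 * b - a)]

end

/-- The uniform bounds on a cutoff and on two continuous weights along its support. -/
theorem exists_cutoff_bound {χ b m q : R3 → ℝ} {M : ℝ} (hχ : IsTestFun χ) (hb : Continuous b)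
    (hm : Continuous m) (hqM : ∀ x, |q x| ≤ M) :
    ∃ K, (∀ x, χ x ^ 2 ≤ K) ∧ (∀ x j, pd j χ x ^ 2 ≤ K) ∧
      (∀ x, (lap χ x + q x * χ x) ^ 2 ≤ K) ∧ ∀ x ∈ tsupport χ, b x ≤ K ∧ m x ≤ K := by
  obtain ⟨c1, h1⟩ := hχ.2.exists_bound_of_continuous hχ.1.continuous
  choose c2 h2 using fun j =>
    (isTestFun_pd hχ j).2.exists_bound_of_continuous (isTestFun_pd hχ j).1.continuous
  have hl : HasCompactSupport (lap χ) := hχ.2.mono' fun x hx => by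
    by_contra h; exact hx (lap_eq_zero_of_notMem h)
  obtain ⟨c3, h3⟩ := hl.exists_bound_of_continuous (contDiff_lap hχ.1).continuous
  have hc : IsCompact (tsupport χ) := hχ.2
  obtain ⟨c4, h4⟩ := hc.exists_bound_of_continuousOn hb.continuousOn
  obtain ⟨c5, h5⟩ := hc.exists_bound_of_continuousOn hm.continuousOn
  simp only [Real.norm_eq_abs] at h1 h2 h3 h4 h5
  have s : ∀ {t c : ℝ}, |t| ≤ c → t ^ 2 ≤ c ^ 2 := fun h => sq_le_sq' (abs_le.1 h).1 (abs_le.1 h).2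
  have n0 := sq_nonneg c1
  have n1 := sq_nonneg (c2 0)
  have n2 := sq_nonneg (c2 1)
  have n3 := sq_nonneg (c2 2)
  have n4 := sq_nonneg (c3 + M * c1)
  have n5 := abs_nonneg c4
  have n6 := abs_nonneg c5
  refine ⟨c1 ^ 2 + (c2 0 ^ 2 + c2 1 ^ 2 + c2 2 ^ 2) + (c3 + M * c1) ^ 2 + |c4| + |c5|,
    fun x => ?_, fun x j => ?_, fun x => ?_, fun x hx => ⟨?_, ?_⟩⟩
  · linarith [s (h1 x)]
  · have := s (h2 j x)
    fin_cases j <;> simp only [Fin.zero_eta, Fin.mk_one, Fin.reduceFinMk] at this ⊢ <;> linarith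
  · have : |lap χ x + q x * χ x| ≤ c3 + M * c1 := by
      refine (abs_add_le _ _).trans (add_le_add (h3 x) ?_)
      rw [abs_mul]
      exact mul_le_mul (hqM x) (h1 x) (abs_nonneg _) ((abs_nonneg _).trans (hqM x))
    linarith [s this]
  · linarith [(le_abs_self _).trans (h4 x hx), le_abs_self c4]
  · linarith [(le_abs_self _).trans (h5 x hx), le_abs_self c5]

/-- A Carleman inequality for test functions supported in `tsupport χ` passes, by mollification, to
`χ ψ` for `ψ ∈ H²`. -/
theorem IsSobolevH2.carleman {ψ ℓ : R3 → ℝ} {p : Fin 3 → R3 → ℝ} (h : IsSobolevH2 ψ p ℓ)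
    {χ b m q : R3 → ℝ} {M : ℝ} (hχ : IsTestFun χ) (hb : Continuous b) (hm : Continuous m)
    (b0 : ∀ x, 0 ≤ b x) (m0 : ∀ x, 0 ≤ m x) (hq : AEStronglyMeasurable q volume)
    (hqM : ∀ x, |q x| ≤ M)
    (hC : ∀ w, IsTestFun w → tsupport w ⊆ tsupport χ →
      ∫ x, b x * (w x ^ 2 + ∑ j, pd j w x ^ 2) ≤ ∫ x, m x * (_root_.lap w x + q x * w x) ^ 2) :
    Integrable (fun x => b x * ((χ x * ψ x) ^ 2 +
      ∑ j, (pd j χ x * ψ x + χ x * p j x) ^ 2)) volume ∧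
    Integrable (fun x => m x * (χ x * (ℓ x + q x * ψ x) + 2 * ∑ j, pd j χ x * p j x +
      _root_.lap χ x * ψ x) ^ 2) volume ∧
    ∫ x, b x * ((χ x * ψ x) ^ 2 + ∑ j, (pd j χ x * ψ x + χ x * p j x) ^ 2) ≤
      4 * ∫ x, m x * (χ x * (ℓ x + q x * ψ x) + 2 * ∑ j, pd j χ x * p j x +
        _root_.lap χ x * ψ x) ^ 2 := by
  obtain ⟨K, k1, k2, k3, k4⟩ := exists_cutoff_bound hχ hb hm hqM
  have K0 : 0 ≤ K := (sq_nonneg _).trans (k1 0)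
  have hqloc : LocallyIntegrable q volume :=
    (locallyIntegrable_const M).mono hq (.of_forall fun x => by
      simpa using (hqM x).trans (le_abs_self M))
  have hq2 : LocallyIntegrable (fun x => q x ^ 2) volume :=
    (locallyIntegrable_const (M ^ 2)).mono (hq.pow 2) (.of_forall fun x => by
      have := sq_le_sq' (abs_le.1 (hqM x)).1 (abs_le.1 (hqM x)).2
      simpa using this)
  set L : R3 → ℝ := fun x => b x * ((χ x * ψ x) ^ 2 +
    ∑ j, (pd j χ x * ψ x + χ x * p j x) ^ 2) with hL
  set T : R3 → ℝ := fun x => m x * (χ x * (ℓ x + q x * ψ x) + 2 * ∑ j, pd j χ x * p j x +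
    _root_.lap χ x * ψ x) ^ 2 with hT
  set D : (R3 → ℝ) → R3 → ℝ := fun v x => (v x - ψ x) ^ 2 + ∑ j, (pd j v x - p j x) ^ 2 +
    (_root_.lap v x - ℓ x) ^ 2 with hD
  have D0 : ∀ v x, 0 ≤ D v x := fun v x => by positivity
  have hψ := h.memLp.1
  have hp := fun j => (h.memLp_grad j).1
  have hℓ := h.memLp_lap.1
  have cχ := hχ.1.continuous
  have cj := fun j => (contDiff_pd hχ.1 j).continuous
  have cl := (contDiff_lap hχ.1).continuous
  have mL : AEStronglyMeasurable L volume :=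
    hb.aestronglyMeasurable.mul (((cχ.aestronglyMeasurable.mul hψ).pow 2).add
      (Finset.aestronglyMeasurable_fun_sum _ fun j _ =>
        (((cj j).aestronglyMeasurable.mul hψ).add (cχ.aestronglyMeasurable.mul (hp j))).pow 2))
  have mT : AEStronglyMeasurable T volume :=
    hm.aestronglyMeasurable.mul ((((cχ.aestronglyMeasurable.mul (hℓ.add (hq.mul hψ))).add
      ((Finset.aestronglyMeasurable_fun_sum _ fun j _ =>
        (cj j).aestronglyMeasurable.mul (hp j)).const_mul 2)).add
      (cl.aestronglyMeasurable.mul hψ)).pow 2)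
  have L0 : ∀ x, 0 ≤ L x := fun x => mul_nonneg (b0 x) (by positivity)
  have T0 : ∀ x, 0 ≤ T x := fun x => mul_nonneg (m0 x) (by positivity)
  -- comparison of both sides with their analogues for a smooth function `v`
  have cmpL : ∀ v, ContDiff ℝ ∞ v → ∀ x, L x ≤ 2 * (b x * ((χ x * v x) ^ 2 +
      ∑ j, pd j (fun y => χ y * v y) x ^ 2)) + 14 * K * K * D v x := by
    intro v hv x
    by_cases hx : x ∈ tsupport χ
    · have e := grad_error_le (d0 := v x - ψ x) (d := fun j => pd j v x - p j x) (k1 x) (k2 x)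
      have h1 := two_sq_add_le (χ x * ψ x) (χ x * v x)
      have h2 := fun j => two_sq_add_le (pd j χ x * ψ x + χ x * p j x)
        (pd j (fun y => χ y * v y) x)
      have e1 : χ x * v x - χ x * ψ x = χ x * (v x - ψ x) := by ring
      have e2 : ∀ j, pd j (fun y => χ y * v y) x - (pd j χ x * ψ x + χ x * p j x) =
          pd j χ x * (v x - ψ x) + χ x * (pd j v x - p j x) := fun j => by
        rw [pd_mul hχ.1 hv]; ring
      simp only [e1, e2] at h1 h2
      have h3 := Finset.sum_le_sum fun j (_ : j ∈ Finset.univ) => h2 j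
      rw [Finset.sum_add_distrib, ← Finset.mul_sum, ← Finset.mul_sum] at h3
      have h4 : (v x - ψ x) ^ 2 + ∑ j, (pd j v x - p j x) ^ 2 ≤ D v x :=
        le_add_of_nonneg_right (sq_nonneg _)
      have h5 : 7 * K * ((v x - ψ x) ^ 2 + ∑ j, (pd j v x - p j x) ^ 2) ≤ 7 * K * D v x := by
        gcongr
      have h6 : (χ x * ψ x) ^ 2 + ∑ j, (pd j χ x * ψ x + χ x * p j x) ^ 2 ≤
          2 * ((χ x * v x) ^ 2 + ∑ j, pd j (fun y => χ y * v y) x ^ 2) +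
            14 * K * D v x := by linarith
      have h7 := mul_le_mul_of_nonneg_left h6 (b0 x)
      have h8 := mul_le_mul_of_nonneg_right (k4 x hx).1
        (show 0 ≤ 14 * K * D v x by have := D0 v x; positivity)
      simp only [hL]
      linarith
    · have z : L x = 0 := by
        simp [hL, image_eq_zero_of_notMem_tsupport hx, pd_eq_zero_of_notMem hx]
      rw [z]
      have := D0 v x
      have := b0 x
      positivity
  have cmpT : ∀ v, ContDiff ℝ ∞ v → ∀ x,
      m x * (_root_.lap (fun y => χ y * v y) x + q x * (χ x * v x)) ^ 2 ≤
        2 * T x + 72 * K * K * D v x ∧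
      T x ≤ 2 * (m x * (_root_.lap (fun y => χ y * v y) x + q x * (χ x * v x)) ^ 2) +
        72 * K * K * D v x := by
    intro v hv x
    by_cases hx : x ∈ tsupport χ
    · have e := lap_error_le (d0 := v x - ψ x) (d := fun j => pd j v x - p j x)
        (dl := _root_.lap v x - ℓ x) (k1 x) (k2 x) (k3 x)
      set X := χ x * (ℓ x + q x * ψ x) + 2 * ∑ j, pd j χ x * p j x + _root_.lap χ x * ψ x with hX
      set Y := _root_.lap (fun y => χ y * v y) x + q x * (χ x * v x) with hY
      have e1 : χ x * (_root_.lap v x - ℓ x) + 2 * ∑ j, pd j χ x * (pd j v x - p j x) +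
          (_root_.lap χ x + q x * χ x) * (v x - ψ x) = Y - X := by
        rw [hX, hY, lap_mul hχ.1 hv]
        simp only [Fin.sum_univ_three]
        ring
      rw [e1] at e
      change (Y - X) ^ 2 ≤ 36 * K * D v x at e
      have f1 := two_sq_add_le X Y
      have f2 := two_sq_add_le Y X
      have f3 : (X - Y) ^ 2 = (Y - X) ^ 2 := by ring
      have h8 := mul_le_mul_of_nonneg_right (k4 x hx).2
        (show 0 ≤ 72 * K * D v x by have := D0 v x; positivity)
      have g1 := mul_le_mul_of_nonneg_left (f1.trans (by gcongr : _ ≤ 2 * Y ^ 2 +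
        2 * (36 * K * D v x))) (m0 x)
      have g2 := mul_le_mul_of_nonneg_left (f2.trans (by rw [f3]; gcongr : _ ≤ 2 * X ^ 2 +
        2 * (36 * K * D v x))) (m0 x)
      simp only [hT]
      constructor <;> linarith
    · have z : T x = 0 := by
        simp [hT, image_eq_zero_of_notMem_tsupport hx, pd_eq_zero_of_notMem hx,
          lap_eq_zero_of_notMem hx]
      have z2 : m x * (_root_.lap (fun y => χ y * v y) x + q x * (χ x * v x)) ^ 2 = 0 := by
        rw [lap_mul hχ.1 hv]
        simp [image_eq_zero_of_notMem_tsupport hx, pd_eq_zero_of_notMem hx,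
          lap_eq_zero_of_notMem hx]
      rw [z, z2]
      have := D0 v x
      constructor <;> positivity
  have tw : ∀ v, ContDiff ℝ ∞ v → IsTestFun (fun y => χ y * v y) := fun v hv => hχ.mul_right hv
  have iw : ∀ v, ContDiff ℝ ∞ v → Integrable (fun x => b x * ((χ x * v x) ^ 2 +
      ∑ j, pd j (fun y => χ y * v y) x ^ 2)) volume := fun v hv => (tw v hv).integrable_grad hb
  have iw' : ∀ v, ContDiff ℝ ∞ v → Integrable (fun x =>
      m x * (_root_.lap (fun y => χ y * v y) x + q x * (χ x * v x)) ^ 2) volume := fun v hv =>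
    (tw v hv).integrable_sq_add hm hqloc hq2
  obtain ⟨v₀, hv₀, hi₀, -⟩ := h.exists_smooth_approx one_pos
  have iL : Integrable L volume :=
    (((iw v₀ hv₀).const_mul 2).add (hi₀.const_mul (14 * K * K))).mono' mL
      (.of_forall fun x => by
        rw [Real.norm_of_nonneg (L0 x)]
        exact cmpL v₀ hv₀ x)
  have iT : Integrable T volume :=
    (((iw' v₀ hv₀).const_mul 2).add (hi₀.const_mul (72 * K * K))).mono' mT
      (.of_forall fun x => by
        rw [Real.norm_of_nonneg (T0 x)]
        exact (cmpT v₀ hv₀ x).2)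
  refine ⟨iL, iT, ?_⟩
  refine le_of_forall_pos_le_add fun ε hε => ?_
  have hK' : 0 < 158 * K * K + 1 := by positivity
  obtain ⟨v, hv, hi, hle⟩ := h.exists_smooth_approx (div_pos hε hK')
  have s1 : ∫ x, L x ≤ 2 * (∫ x, b x * ((χ x * v x) ^ 2 +
      ∑ j, pd j (fun y => χ y * v y) x ^ 2)) + 14 * K * K * ∫ x, D v x := by
    rw [← integral_const_mul, ← integral_const_mul,
      ← integral_add ((iw v hv).const_mul 2) (hi.const_mul (14 * K * K))]
    exact integral_mono iL (((iw v hv).const_mul 2).add (hi.const_mul (14 * K * K))) (cmpL v hv)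
  have s2 : ∫ x, m x * (_root_.lap (fun y => χ y * v y) x + q x * (χ x * v x)) ^ 2 ≤
      2 * (∫ x, T x) + 72 * K * K * ∫ x, D v x := by
    rw [← integral_const_mul, ← integral_const_mul,
      ← integral_add (iT.const_mul 2) (hi.const_mul (72 * K * K))]
    exact integral_mono (iw' v hv) ((iT.const_mul 2).add (hi.const_mul (72 * K * K)))
      fun x => (cmpT v hv x).1
  have s3 := hC _ (tw v hv) (tsupport_mul_subset_left)
  have s4 : (158 * K * K) * ∫ x, D v x ≤ ε := by
    have d0 : 0 ≤ ∫ x, D v x := integral_nonneg (D0 v)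
    have : (158 * K * K + 1) * ∫ x, D v x ≤ ε := by
      rw [le_div_iff₀ hK'] at hle
      linarith
    linarith
  linarith

/-- Weighted estimate for a finite family of `H²` functions: when `|ℓ + q ψ|²` is dominated by the
Carleman gain, only the terms with derivatives of the cutoff remain. -/
theorem carleman_system {ι : Type*} [Fintype ι] {ψ ℓ : ι → R3 → ℝ} {p : ι → Fin 3 → R3 → ℝ}
    (h : ∀ i, IsSobolevH2 (ψ i) (p i) (ℓ i))
    {χ b m q : R3 → ℝ} {M : ℝ} (hχ : IsTestFun χ) (hb : Continuous b) (hm : Continuous m)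
    (b0 : ∀ x, 0 ≤ b x) (m0 : ∀ x, 0 ≤ m x) (hq : AEStronglyMeasurable q volume)
    (hqM : ∀ x, |q x| ≤ M)
    (hC : ∀ w, IsTestFun w → tsupport w ⊆ tsupport χ →
      ∫ x, b x * (w x ^ 2 + ∑ j, pd j w x ^ 2) ≤ ∫ x, m x * (lap w x + q x * w x) ^ 2)
    (hae : ∀ᵐ x ∂(volume : Measure R3), x ∈ tsupport χ →
      48 * m x * ∑ i, (ℓ i x + q x * ψ i x) ^ 2 ≤
        b x * (∑ i, ψ i x ^ 2 + ∑ i, ∑ j, p i j x ^ 2)) :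
    Integrable (fun x => b x * χ x ^ 2 * (∑ i, ψ i x ^ 2 + ∑ i, ∑ j, p i j x ^ 2)) volume ∧
    Integrable (fun x => (∑ j, pd j χ x ^ 2) * (192 * m x * (∑ i, ∑ j, p i j x ^ 2) +
        4 * b x * ∑ i, ψ i x ^ 2) + 48 * m x * lap χ x ^ 2 * ∑ i, ψ i x ^ 2) volume ∧
    ∫ x, b x * χ x ^ 2 * (∑ i, ψ i x ^ 2 + ∑ i, ∑ j, p i j x ^ 2) ≤
      ∫ x, ((∑ j, pd j χ x ^ 2) * (192 * m x * (∑ i, ∑ j, p i j x ^ 2) +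
        4 * b x * ∑ i, ψ i x ^ 2) + 48 * m x * lap χ x ^ 2 * ∑ i, ψ i x ^ 2) := by
  choose iL iT hle using fun i => (h i).carleman hχ hb hm b0 m0 hq hqM hC
  obtain ⟨K, k1, k2, k3, k4⟩ := exists_cutoff_bound (q := 0) (M := 0) hχ hb hm (by simp)
  have K0 : 0 ≤ K := (sq_nonneg _).trans (k1 0)
  simp only [Pi.zero_apply, zero_mul, add_zero] at k3
  set P : R3 → ℝ := fun x => ∑ i, ψ i x ^ 2 with hP
  set Γ : R3 → ℝ := fun x => ∑ i, ∑ j, p i j x ^ 2 with hΓ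
  have iP : Integrable P volume := integrable_finsetSum _ fun i _ => (h i).memLp.integrable_sq
  have iΓ : Integrable Γ volume := integrable_finsetSum _ fun i _ =>
    integrable_finsetSum _ fun j _ => ((h i).memLp_grad j).integrable_sq
  have P0 : ∀ x, 0 ≤ P x := fun x => by positivity
  have Γ0 : ∀ x, 0 ≤ Γ x := fun x => by positivity
  have cχ := hχ.1.continuous
  have cj := fun j => (contDiff_pd hχ.1 j).continuous
  have cl := (contDiff_lap hχ.1).continuous
  -- continuous functions vanishing off the support of `χ` are bounded multipliers
  have mult : ∀ {f k : R3 → ℝ}, Integrable f volume → Continuous k → (∀ x ∉ tsupport χ, k x = 0) →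
      Integrable (fun x => k x * f x) volume := by
    intro f k hf hk hk0
    have hks : HasCompactSupport k := hχ.2.mono' fun x hx => by
      by_contra h; exact hx (hk0 x h)
    obtain ⟨c, hc⟩ := hks.exists_bound_of_continuous hk
    exact hf.bdd_mul hk.aestronglyMeasurable (.of_forall hc)
  have i1 : Integrable (fun x => b x * χ x ^ 2 * (P x + Γ x)) volume :=
    mult (iP.add iΓ) (by fun_prop) fun x hx => by simp [image_eq_zero_of_notMem_tsupport hx]
  have i2 : Integrable (fun x => (∑ j, pd j χ x ^ 2) * (192 * m x * Γ x + 4 * b x * P x) +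
      48 * m x * lap χ x ^ 2 * P x) volume := by
    have j1 := mult (k := fun x => (∑ j, pd j χ x ^ 2) * (192 * m x)) iΓ (by fun_prop)
      fun x hx => by simp [pd_eq_zero_of_notMem hx]
    have j2 := mult (k := fun x => (∑ j, pd j χ x ^ 2) * (4 * b x)) iP (by fun_prop)
      fun x hx => by simp [pd_eq_zero_of_notMem hx]
    have j3 := mult (k := fun x => 48 * m x * lap χ x ^ 2) iP (by fun_prop)
      fun x hx => by simp [lap_eq_zero_of_notMem hx]
    exact ((j1.add j2).add j3).congr (.of_forall fun x => by simp only [Pi.add_apply]; ring)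
  refine ⟨i1, i2, ?_⟩
  set LL : R3 → ℝ := fun x => ∑ i, b x * ((χ x * ψ i x) ^ 2 +
    ∑ j, (pd j χ x * ψ i x + χ x * p i j x) ^ 2) with hLL
  set TT : R3 → ℝ := fun x => ∑ i, m x * (χ x * (ℓ i x + q x * ψ i x) +
    2 * ∑ j, pd j χ x * p i j x + lap χ x * ψ i x) ^ 2 with hTT
  have iLL : Integrable LL volume := integrable_finsetSum _ fun i _ => iL i
  have iTT : Integrable TT volume := integrable_finsetSum _ fun i _ => iT i
  have hLT : ∫ x, LL x ≤ 4 * ∫ x, TT x := by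
    rw [integral_finsetSum _ fun i _ => iL i, integral_finsetSum _ fun i _ => iT i,
      Finset.mul_sum]
    exact Finset.sum_le_sum fun i _ => hle i
  have pw : ∀ᵐ x ∂(volume : Measure R3),
      b x * χ x ^ 2 * (P x + Γ x) + 16 * TT x ≤ 4 * LL x +
        ((∑ j, pd j χ x ^ 2) * (192 * m x * Γ x + 4 * b x * P x) +
          48 * m x * lap χ x ^ 2 * P x) := by
    filter_upwards [hae] with x hx
    by_cases hxs : x ∈ tsupport χ
    · have hx := hx hxs
      set c := ∑ j, pd j χ x ^ 2 with hc
      have t1 : TT x ≤ m x * (3 * (χ x ^ 2 * ∑ i, (ℓ i x + q x * ψ i x) ^ 2 + 4 * (c * Γ x) +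
          lap χ x ^ 2 * P x)) := by
        simp only [hTT, hΓ, hP, ← Finset.mul_sum]
        refine mul_le_mul_of_nonneg_left ?_ (m0 x)
        simp only [Finset.mul_sum, ← Finset.sum_add_distrib]
        refine Finset.sum_le_sum fun i _ => ?_
        have := cutoff_sq_le (χ x) (lap χ x) (ψ i x) (ℓ i x + q x * ψ i x)
          (fun j => pd j χ x) (fun j => p i j x)
        simp only [Finset.mul_sum] at this
        exact this
      have t2 : b x * (χ x ^ 2 * (P x + Γ x)) ≤ b x * (2 * c * P x) + 2 * LL x := by
        have r1 : χ x ^ 2 * (P x + Γ x) ≤ 2 * c * P x + 2 * ∑ i, ((χ x * ψ i x) ^ 2 +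
            ∑ j, (pd j χ x * ψ i x + χ x * p i j x) ^ 2) := by
          simp only [hΓ, hP, ← Finset.sum_add_distrib, Finset.mul_sum]
          refine Finset.sum_le_sum fun i _ => ?_
          have r2 : ∑ j, χ x ^ 2 * p i j x ^ 2 ≤ ∑ j, (2 * (pd j χ x ^ 2 * ψ i x ^ 2) +
              2 * (pd j χ x * ψ i x + χ x * p i j x) ^ 2) :=
            Finset.sum_le_sum fun j _ => by
              nlinarith [sq_nonneg (2 * (pd j χ x * ψ i x) + χ x * p i j x)]
          rw [Finset.sum_add_distrib, ← Finset.mul_sum, ← Finset.mul_sum, ← Finset.mul_sum,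
            ← Finset.sum_mul] at r2
          have r3 : 0 ≤ (χ x * ψ i x) ^ 2 := sq_nonneg _
          have r4 : χ x ^ 2 * ψ i x ^ 2 = (χ x * ψ i x) ^ 2 := by ring
          rw [hc]
          linarith
        have r5 := mul_le_mul_of_nonneg_left r1 (b0 x)
        have r6 : LL x = b x * ∑ i, ((χ x * ψ i x) ^ 2 +
            ∑ j, (pd j χ x * ψ i x + χ x * p i j x) ^ 2) := by
          simp only [hLL, Finset.mul_sum]
        rw [r6]
        linarith
      have t3 := mul_le_mul_of_nonneg_left hx (sq_nonneg (χ x))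
      change χ x ^ 2 * (48 * m x * _) ≤ χ x ^ 2 * (b x * (P x + Γ x)) at t3
      linarith
    · have z1 : LL x = 0 := by
        simp [hLL, image_eq_zero_of_notMem_tsupport hxs, pd_eq_zero_of_notMem hxs]
      have z2 : TT x = 0 := by
        simp [hTT, image_eq_zero_of_notMem_tsupport hxs, pd_eq_zero_of_notMem hxs,
          lap_eq_zero_of_notMem hxs]
      simp [z1, z2, image_eq_zero_of_notMem_tsupport hxs, pd_eq_zero_of_notMem hxs,
          lap_eq_zero_of_notMem hxs]
  have fin := integral_mono_ae (i1.add (iTT.const_mul 16)) ((iLL.const_mul 4).add i2) pw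
  simp only [Pi.add_apply] at fin
  rw [integral_add i1 (iTT.const_mul 16), integral_add (iLL.const_mul 4) i2, integral_const_mul,
    integral_const_mul] at fin
  linarith

/-! ### Cutoff functions -/

theorem pd_comp_smul {u : R3 → ℝ} (hu : ContDiff ℝ ∞ u) (c : ℝ) (j : Fin 3) (x : R3) :
    pd j (fun y => u (c • y)) x = c * pd j u (c • x) := by
  have h1 : HasFDerivAt (fun y : R3 => c • y) (c • ContinuousLinearMap.id ℝ R3) x :=
    (hasFDerivAt_id x).const_smul c
  have h : HasFDerivAt (fun y => u (c • y)) ((fderiv ℝ u (c • x)).comp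
      (c • ContinuousLinearMap.id ℝ R3)) x :=
    (hu.differentiableAt_infty (c • x)).hasFDerivAt.comp x h1
  simp [pd, h.fderiv]

theorem lap_comp_smul {u : R3 → ℝ} (hu : ContDiff ℝ ∞ u) (c : ℝ) (x : R3) :
    lap (fun y => u (c • y)) x = c ^ 2 * lap u (c • x) := by
  have h1 : ∀ j, pd j (fun y => u (c • y)) = fun y => c * pd j u (c • y) :=
    fun j => funext fun y => pd_comp_smul hu c j y
  have h2 : ∀ j, pd j (pd j (fun y => u (c • y))) x = c ^ 2 * pd j (pd j u) (c • x) := by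
    intro j
    have hs : ContDiff ℝ ∞ fun y : R3 => pd j u (c • y) :=
      (contDiff_pd hu j).comp (contDiff_const_smul c)
    rw [h1, pd_mul contDiff_const hs, pd_const, pd_comp_smul (contDiff_pd hu j)]
    ring
  simp only [lap, h2, Finset.mul_sum]

theorem pd_eq_zero_of_eventually_one {u : R3 → ℝ} {x : R3} {R : ℝ} (hu : ∀ y, ‖y‖ ≤ R → u y = 1)
    (hx : ‖x‖ < R) (j : Fin 3) : pd j u x = 0 := by
  have : u =ᶠ[𝓝 x] fun _ => (1 : ℝ) := by
    filter_upwards [(isOpen_lt continuous_norm continuous_const).mem_nhds hx] with y hy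
    exact hu y (le_of_lt hy)
  simp [pd, this.fderiv_eq]

theorem lap_eq_zero_of_eventually_one {u : R3 → ℝ} {x : R3} {R : ℝ}
    (hu : ∀ y, ‖y‖ ≤ R → u y = 1) (hx : ‖x‖ < R) : lap u x = 0 := by
  refine Finset.sum_eq_zero fun j _ => ?_
  have : pd j u =ᶠ[𝓝 x] fun _ => (0 : ℝ) := by
    filter_upwards [(isOpen_lt continuous_norm continuous_const).mem_nhds hx] with y hy
    exact pd_eq_zero_of_eventually_one hu hy j
  change fderiv ℝ (pd j u) x (stdVec j) = 0
  simp [this.fderiv_eq]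

/-- Smooth cutoffs `θ R`, equal to `1` on the ball of radius `R` and supported in the ball of radius
`2R`, with the scaling bounds `|x| |∇θ| ≤ 2C` and `|x|² |Δθ| ≤ 4C` uniform in `R`. -/
theorem exists_cutoff : ∃ C : ℝ, 0 ≤ C ∧ ∃ θ : ℝ → R3 → ℝ, ∀ R, 0 < R → IsTestFun (θ R) ∧
    (∀ x, ‖x‖ ≤ R → θ R x = 1) ∧ (∀ x, 2 * R ≤ ‖x‖ → θ R x = 0) ∧ tsupport (θ R) ⊆ {x | ‖x‖ ≤ 2 * R} ∧
    (∀ j x, ‖x‖ * |pd j (θ R) x| ≤ 2 * C) ∧ ∀ x, ‖x‖ ^ 2 * |lap (θ R) x| ≤ 4 * C := by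
  let β : ContDiffBump (0 : R3) := ⟨1, 2, one_pos, one_lt_two⟩
  have hβ : IsTestFun β := ⟨β.contDiff, β.hasCompactSupport⟩
  choose c2 h2 using fun j =>
    (isTestFun_pd hβ j).2.exists_bound_of_continuous (isTestFun_pd hβ j).1.continuous
  have hl : HasCompactSupport (lap β) := hβ.2.mono' fun x hx => by
    by_contra h; exact hx (lap_eq_zero_of_notMem h)
  obtain ⟨c3, h3⟩ := hl.exists_bound_of_continuous (contDiff_lap hβ.1).continuous
  simp only [Real.norm_eq_abs] at h2 h3
  have g2 : ∀ j, 0 ≤ c2 j := fun j => (abs_nonneg _).trans (h2 j 0)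
  have g3 : 0 ≤ c3 := (abs_nonneg _).trans (h3 0)
  set C := c2 0 + c2 1 + c2 2 + c3 with hC
  have b2 : ∀ j x, |pd j β x| ≤ C := fun j x => by
    have := h2 j x
    have := g2 0
    have := g2 1
    have := g2 2
    fin_cases j <;> simp only [Fin.zero_eta, Fin.mk_one, Fin.reduceFinMk] at * <;> linarith
  have b3 : ∀ x, |lap β x| ≤ C := fun x => by
    have := h3 x
    have := g2 0
    have := g2 1
    have := g2 2
    linarith
  refine ⟨C, by have := g2 0; have := g2 1; have := g2 2; positivity,
    fun R x => β (R⁻¹ • x), fun R hR => ?_⟩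
  have hsupp : tsupport (fun x => β (R⁻¹ • x)) ⊆ {x : R3 | ‖x‖ ≤ 2 * R} := by
    refine closure_minimal (fun x hx => ?_) (isClosed_le continuous_norm continuous_const)
    have : R⁻¹ • x ∈ Function.support β := hx
    rw [β.support_eq, mem_ball_zero_iff, norm_smul, norm_inv, Real.norm_of_nonneg hR.le,
      inv_mul_lt_iff₀ hR] at this
    change ‖x‖ ≤ 2 * R
    change ‖x‖ < R * 2 at this
    linarith
  have hnorm : ∀ x : R3, ‖x‖ = R * ‖R⁻¹ • x‖ := fun x => by
    rw [norm_smul, norm_inv, Real.norm_of_nonneg hR.le]; field_simp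
  have hsm : ContDiff ℝ ∞ (fun x : R3 => β (R⁻¹ • x)) :=
    hβ.1.comp (contDiff_const_smul R⁻¹)
  refine ⟨⟨hsm, ?_⟩, fun x hx => ?_, fun x hx => ?_, hsupp, fun j x => ?_, fun x => ?_⟩
  · exact HasCompactSupport.of_support_subset_isCompact (isCompact_closedBall (0 : R3) (2 * R))
      fun x hx => by
        rw [mem_closedBall_zero_iff]; exact hsupp (subset_tsupport _ hx)
  · refine β.one_of_mem_closedBall ?_
    rw [mem_closedBall_zero_iff, norm_smul, norm_inv, Real.norm_of_nonneg hR.le,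
      inv_mul_le_iff₀ hR]
    change ‖x‖ ≤ R * 1
    linarith
  · refine β.zero_of_le_dist ?_
    rw [dist_zero_right, norm_smul, norm_inv, Real.norm_of_nonneg hR.le, le_inv_mul_iff₀ hR]
    change R * 2 ≤ ‖x‖
    linarith
  · by_cases hx : ‖x‖ ≤ 2 * R
    · rw [pd_comp_smul hβ.1, abs_mul, abs_inv, abs_of_pos hR]
      calc ‖x‖ * (R⁻¹ * |pd j β (R⁻¹ • x)|) ≤ (2 * R) * (R⁻¹ * C) := by
            gcongr; exact b2 j _
        _ = 2 * C := by field_simp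
    · rw [pd_eq_zero_of_notMem fun h => hx (hsupp h)]
      have := (abs_nonneg _).trans (b2 0 0)
      simpa using this
  · by_cases hx : ‖x‖ ≤ 2 * R
    · rw [lap_comp_smul hβ.1, abs_mul, abs_of_nonneg (by positivity)]
      calc ‖x‖ ^ 2 * (R⁻¹ ^ 2 * |lap β (R⁻¹ • x)|) ≤ (2 * R) ^ 2 * (R⁻¹ ^ 2 * C) := by
            gcongr; exact b3 _
        _ = 4 * C := by field_simp; ring
    · rw [lap_eq_zero_of_notMem fun h => hx (hsupp h)]
      have := (abs_nonneg _).trans (b2 0 0)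
      simpa using this

/-! ### Exponential decay and vanishing at infinity -/

/-- The Carleman inequality with the radial weights `e^F`, for functions whose equation has
first-order perturbation of size `o(1/|x|)`: the weighted mass at infinity is controlled by the
weighted mass in a fixed ball, uniformly in the weight. -/
theorem weighted_mass_le {ι : Type*} [Fintype ι] {ψ ℓ : ι → R3 → ℝ} {p : ι → Fin 3 → R3 → ℝ}
    (h : ∀ i, IsSobolevH2 (ψ i) (p i) (ℓ i)) {q a : R3 → ℝ} {q' : Fin 3 → R3 → ℝ} {E M : ℝ}
    (hq : HasWeakGrad q q') (hqM : ∀ x, |q x| ≤ M) (hE : 0 < E)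
    (hQ : ∃ R, ∀ᵐ x ∂(volume : Measure R3), R ≤ ‖x‖ → 3 / 4 * E ≤ q x + ∑ j, x j * q' j x)
    (ha : ∀ c > 0, ∃ R, ∀ᵐ x ∂(volume : Measure R3), R ≤ ‖x‖ → ‖x‖ ^ 2 * a x ≤ c)
    (heq : ∀ᵐ x ∂(volume : Measure R3),
      ∑ i, (ℓ i x + q x * ψ i x) ^ 2 ≤ a x * ∑ i, ∑ j, p i j x ^ 2) :
    ∃ R K : ℝ, 1 ≤ R ∧ 0 ≤ K ∧ ∀ α γ δ : ℝ, 0 ≤ α → 0 ≤ γ → 0 ≤ δ → γ * (α + γ) ≤ E / 16 →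
      Integrable (fun x => Real.exp (2 * weightExp α γ δ x) *
        (∑ i, ψ i x ^ 2 + ∑ i, ∑ j, p i j x ^ 2)) volume →
      ∫ x in {x | 2 * R ≤ ‖x‖}, Real.exp (2 * weightExp α γ δ x) *
          (∑ i, ψ i x ^ 2 + ∑ i, ∑ j, p i j x ^ 2) ≤
        K * ∫ x in {x | ‖x‖ ≤ 2 * R}, Real.exp (2 * weightExp α γ δ x) *
          (∑ i, ψ i x ^ 2 + ∑ i, ∑ j, p i j x ^ 2) := by
  obtain ⟨C, hC0, θ, hθ⟩ := exists_cutoff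
  set C1 : ℝ := (16 + 1 / (E / 4)) * (2 + 1 / (E / 4)) with hC1
  have C1pos : 0 < C1 := by positivity
  obtain ⟨R1, hR1⟩ := hQ
  obtain ⟨R2, hR2⟩ := ha (1 / (48 * C1)) (by positivity)
  set R : ℝ := max 1 (max (1568 / E) (max R1 R2)) with hR
  have r0 : 1 ≤ R := le_max_left _ _
  have r1 : 1568 / E ≤ R := (le_max_left _ _).trans (le_max_right _ _)
  have r2 : R1 ≤ R := ((le_max_left _ _).trans (le_max_right _ _)).trans (le_max_right _ _)
  have r3 : R2 ≤ R := ((le_max_right _ _).trans (le_max_right _ _)).trans (le_max_right _ _)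
  have Rpos : 0 < R := by linarith
  set K : ℝ := C ^ 2 * (192 + 12288 * C1) with hK
  have K0 : 0 ≤ K := by positivity
  refine ⟨R, K, r0, K0, fun α γ δ hα hγ hδ hγE hint => ?_⟩
  set F := weightExp α γ δ with hF
  set P : R3 → ℝ := fun x => ∑ i, ψ i x ^ 2 with hP
  set Γ : R3 → ℝ := fun x => ∑ i, ∑ j, p i j x ^ 2 with hΓ
  have P0 : ∀ x, 0 ≤ P x := fun x => by positivity
  have Γ0 : ∀ x, 0 ≤ Γ x := fun x => by positivity
  set f : R3 → ℝ := fun x => Real.exp (2 * F x) * (P x + Γ x) with hf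
  have f0 : ∀ x, 0 ≤ f x := fun x =>
    mul_nonneg (Real.exp_pos _).le (add_nonneg (P0 x) (Γ0 x))
  change Integrable f volume at hint
  change ∫ x in {x | 2 * R ≤ ‖x‖}, f x ≤ K * ∫ x in {x | ‖x‖ ≤ 2 * R}, f x
  have cF : Continuous F := (contDiff_weightExp hδ).continuous
  have msF : ∀ r : ℝ, MeasurableSet {x : R3 | r ≤ ‖x‖} := fun r =>
    (isClosed_le continuous_const continuous_norm).measurableSet
  have msN : ∀ r : ℝ, MeasurableSet {x : R3 | ‖x‖ ≤ r} := fun r =>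
    (isClosed_le continuous_norm continuous_const).measurableSet
  have main : ∀ N : ℝ, 2 * R < N → ∫ x in {x | 2 * R ≤ ‖x‖}, f x ≤
      K * (∫ x in {x | ‖x‖ ≤ 2 * R}, f x) + (K + 1) * ∫ x in {x | N ≤ ‖x‖}, f x := by
    intro N hN
    obtain ⟨tR, oR, vR, sR, gR, lR⟩ := hθ R Rpos
    obtain ⟨tN, oN, -, -, gN, lN⟩ := hθ N (by linarith)
    set χ : R3 → ℝ := fun x => θ N x - θ R x with hχ
    have tχ : IsTestFun χ := by
      have e : χ = fun x => θ N x + (-1) * θ R x := by funext x; simp only [hχ]; ring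
      rw [e]
      exact tN.add (tR.mul_left contDiff_const)
    have pχ : ∀ j x, pd j χ x = pd j (θ N) x - pd j (θ R) x := fun j x => pd_sub tN.1 tR.1 j x
    have lχ : ∀ x, lap χ x = lap (θ N) x - lap (θ R) x := by
      intro x
      simp only [lap, ← Finset.sum_sub_distrib]
      refine Finset.sum_congr rfl fun j _ => ?_
      have : pd j χ = fun x => pd j (θ N) x - pd j (θ R) x := funext (pχ j)
      rw [this, pd_sub (contDiff_pd tN.1 j) (contDiff_pd tR.1 j)]
    have sχ : tsupport χ ⊆ {x | R ≤ ‖x‖} := by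
      refine closure_minimal (fun x hx => ?_) (isClosed_le continuous_const continuous_norm)
      by_contra hlt
      have hlt : ‖x‖ ≤ R := (not_le.1 hlt).le
      apply hx
      simp only [hχ, oR x hlt, oN x (by linarith), sub_self]
    -- the derivatives of the cutoff live in `R ≤ |x| ≤ 2R` and in `N ≤ |x|`
    have z1 : ∀ x, ‖x‖ < R ∨ (2 * R < ‖x‖ ∧ ‖x‖ < N) → (∀ j, pd j χ x = 0) ∧ lap χ x = 0 := by
      rintro x (hx | ⟨hx1, hx2⟩)
      · refine ⟨fun j => ?_, ?_⟩
        · rw [pχ, pd_eq_zero_of_eventually_one oR hx,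
            pd_eq_zero_of_eventually_one oN (by linarith), sub_zero]
        · rw [lχ, lap_eq_zero_of_eventually_one oR hx,
            lap_eq_zero_of_eventually_one oN (by linarith), sub_zero]
      · have hxs : x ∉ tsupport (θ R) := fun h => by
          have : ‖x‖ ≤ 2 * R := sR h
          linarith
        refine ⟨fun j => ?_, ?_⟩
        · rw [pχ, pd_eq_zero_of_notMem hxs, pd_eq_zero_of_eventually_one oN hx2, sub_zero]
        · rw [lχ, lap_eq_zero_of_notMem hxs, lap_eq_zero_of_eventually_one oN hx2, sub_zero]
    have bp : ∀ j x, ‖x‖ ^ 2 * pd j χ x ^ 2 ≤ 16 * C ^ 2 := by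
      intro j x
      have h1 : |‖x‖ * pd j χ x| ≤ 4 * C := by
        rw [abs_mul, abs_norm, pχ]
        have := mul_le_mul_of_nonneg_left (abs_sub (pd j (θ N) x) (pd j (θ R) x)) (norm_nonneg x)
        linarith [gR j x, gN j x]
      have := sq_le_sq' (abs_le.1 h1).1 (abs_le.1 h1).2
      linarith
    have bl : ∀ x, ‖x‖ ^ 4 * lap χ x ^ 2 ≤ 64 * C ^ 2 := by
      intro x
      have h1 : |‖x‖ ^ 2 * lap χ x| ≤ 8 * C := by
        rw [abs_mul, abs_of_nonneg (sq_nonneg ‖x‖), lχ]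
        have := mul_le_mul_of_nonneg_left (abs_sub (lap (θ N) x) (lap (θ R) x)) (sq_nonneg ‖x‖)
        linarith [lR x, lN x]
      have := sq_le_sq' (abs_le.1 h1).1 (abs_le.1 h1).2
      linarith
    set b : R3 → ℝ := fun x => Real.exp (2 * F x) with hb
    set m : R3 → ℝ := fun x => C1 * (‖x‖ ^ 2 * Real.exp (2 * F x)) with hm
    have cb : Continuous b := by fun_prop
    have cm : Continuous m := by fun_prop
    have b0 : ∀ x, 0 ≤ b x := fun x => (Real.exp_pos _).le
    have m0 : ∀ x, 0 ≤ m x := fun x => by positivity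
    have hqm : AEStronglyMeasurable q volume := hq.1.aestronglyMeasurable
    have hq2 : LocallyIntegrable (fun x => q x ^ 2) volume :=
      (locallyIntegrable_const (M ^ 2)).mono (hqm.pow 2) (.of_forall fun x => by
        have := sq_le_sq' (abs_le.1 (hqM x)).1 (abs_le.1 (hqM x)).2
        simpa using this)
    have carl : ∀ w, IsTestFun w → tsupport w ⊆ tsupport χ →
        ∫ x, b x * (w x ^ 2 + ∑ j, pd j w x ^ 2) ≤ ∫ x, m x * (lap w x + q x * w x) ^ 2 := by
      intro w hw hws
      have := carleman_of_coercive (a := 0) (η := E / 4) (by positivity) (contDiff_weightExp hδ)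
        (contDiff_weightSlope hδ) (pd_weightExp hδ) hq hq2 hw (by
          filter_upwards [hR1] with x hx1 hx
          have hxR : R ≤ ‖x‖ := sχ (hws hx)
          have hx1' : 1 ≤ ‖x‖ := r0.trans hxR
          have hxE : 1568 / E ≤ ‖x‖ ^ 2 := by nlinarith
          obtain ⟨c1, c2, c3, c4⟩ := weight_coercive hα hγ hδ hE hγE hx1' hxE (hx1 (r2.trans hxR))
          simp only [sub_zero, PiLp.zero_apply]
          exact ⟨hx1', c1, c2, c3, by linarith⟩)
      refine this.trans (le_of_eq ?_)
      rw [← integral_const_mul]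
      refine integral_congr_ae (.of_forall fun x => ?_)
      simp only [hm, sub_zero]
      ring
    have gain : ∀ᵐ x ∂(volume : Measure R3), x ∈ tsupport χ →
        48 * m x * ∑ i, (ℓ i x + q x * ψ i x) ^ 2 ≤
          b x * (∑ i, ψ i x ^ 2 + ∑ i, ∑ j, p i j x ^ 2) := by
      filter_upwards [hR2, heq] with x hx1 hx2 hx
      have hxR : R ≤ ‖x‖ := sχ hx
      have e1 := hx1 (r3.trans hxR)
      have e2 : 48 * C1 * (‖x‖ ^ 2 * a x) ≤ 1 := by
        rw [le_div_iff₀ (by positivity)] at e1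
        linarith
      calc 48 * m x * ∑ i, (ℓ i x + q x * ψ i x) ^ 2
          ≤ 48 * m x * (a x * Γ x) :=
            mul_le_mul_of_nonneg_left hx2 (mul_nonneg (by norm_num) (m0 x))
        _ = b x * ((48 * C1 * (‖x‖ ^ 2 * a x)) * Γ x) := by simp only [hm, hb]; ring
        _ ≤ b x * (P x + Γ x) := by
            refine mul_le_mul_of_nonneg_left ?_ (b0 x)
            have := mul_le_mul_of_nonneg_right e2 (Γ0 x)
            linarith [P0 x]
    obtain ⟨i1, i2, hle⟩ := carleman_system h tχ cb cm b0 m0 hqm hqM carl gain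
    have up : ∫ x, ((∑ j, pd j χ x ^ 2) * (192 * m x * Γ x + 4 * b x * P x) +
        48 * m x * lap χ x ^ 2 * P x) ≤
        K * (∫ x in {x | ‖x‖ ≤ 2 * R}, f x) + K * ∫ x in {x | N ≤ ‖x‖}, f x := by
      rw [← integral_indicator (msN _), ← integral_indicator (msF _), ← integral_const_mul,
        ← integral_const_mul, ← integral_add ((hint.indicator (msN _)).const_mul K)
          ((hint.indicator (msF _)).const_mul K)]
      refine integral_mono i2 (((hint.indicator (msN _)).const_mul K).add
          ((hint.indicator (msF _)).const_mul K)) fun x => ?_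
      have n1 : 0 ≤ K * Set.indicator {x | ‖x‖ ≤ 2 * R} f x :=
        mul_nonneg K0 (Set.indicator_nonneg (fun x _ => f0 x) x)
      have n2 : 0 ≤ K * Set.indicator {x | N ≤ ‖x‖} f x :=
        mul_nonneg K0 (Set.indicator_nonneg (fun x _ => f0 x) x)
      by_cases hz : ‖x‖ < R ∨ (2 * R < ‖x‖ ∧ ‖x‖ < N)
      · obtain ⟨y1, y2⟩ := z1 x hz
        simp only [y1, y2]
        simp only [ne_eq, OfNat.ofNat_ne_zero, not_false_eq_true, zero_pow, Finset.sum_const_zero,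
          zero_mul, mul_zero, add_zero]
        exact add_nonneg n1 n2
      · push Not at hz
        obtain ⟨hz1, hz2⟩ := hz
        have hx1 : (1 : ℝ) ≤ ‖x‖ ^ 2 := one_le_pow₀ (r0.trans hz1)
        have key : (∑ j, pd j χ x ^ 2) * (192 * m x * Γ x + 4 * b x * P x) +
            48 * m x * lap χ x ^ 2 * P x ≤ K * f x := by
          set c := ∑ j, pd j χ x ^ 2 with hc
          have c0 : 0 ≤ c := by positivity
          have k1 : ‖x‖ ^ 2 * c ≤ 48 * C ^ 2 := by
            rw [hc, Fin.sum_univ_three]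
            linarith [bp 0 x, bp 1 x, bp 2 x]
          have k2 : c ≤ 48 * C ^ 2 := (le_mul_of_one_le_left c0 hx1).trans k1
          have k3 : ‖x‖ ^ 2 * lap χ x ^ 2 ≤ 64 * C ^ 2 := by
            refine le_trans ?_ (bl x)
            have : ‖x‖ ^ 4 = ‖x‖ ^ 2 * ‖x‖ ^ 2 := by ring
            rw [this, mul_assoc]
            exact le_mul_of_one_le_left (by positivity) hx1
          have l1 : c * (192 * m x * Γ x) ≤ (9216 * C ^ 2 * C1) * (b x * Γ x) := by
            have : c * (192 * m x * Γ x) = 192 * C1 * (b x * Γ x) * (‖x‖ ^ 2 * c) := by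
              simp only [hm, hb]; ring
            rw [this]
            have := mul_le_mul_of_nonneg_left k1
              (show 0 ≤ 192 * C1 * (b x * Γ x) from mul_nonneg (by positivity)
                (mul_nonneg (b0 x) (Γ0 x)))
            linarith
          have l2 : c * (4 * b x * P x) ≤ 192 * C ^ 2 * (b x * P x) := by
            have := mul_le_mul_of_nonneg_left k2
              (show 0 ≤ 4 * (b x * P x) from mul_nonneg (by positivity)
                (mul_nonneg (b0 x) (P0 x)))
            linarith
          have l3 : 48 * m x * lap χ x ^ 2 * P x ≤ (3072 * C ^ 2 * C1) * (b x * P x) := by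
            have : 48 * m x * lap χ x ^ 2 * P x =
                48 * C1 * (b x * P x) * (‖x‖ ^ 2 * lap χ x ^ 2) := by
              simp only [hm, hb]; ring
            rw [this]
            have := mul_le_mul_of_nonneg_left k3
              (show 0 ≤ 48 * C1 * (b x * P x) from mul_nonneg (by positivity)
                (mul_nonneg (b0 x) (P0 x)))
            linarith
          have e : K * f x = 192 * C ^ 2 * (b x * P x) + 192 * C ^ 2 * (b x * Γ x) +
              12288 * C ^ 2 * C1 * (b x * P x) + 12288 * C ^ 2 * C1 * (b x * Γ x) := by
            simp only [hK, hf, hb]; ring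
          have n3 : 0 ≤ C ^ 2 * (b x * Γ x) := mul_nonneg (sq_nonneg C) (mul_nonneg (b0 x) (Γ0 x))
          have n4 : 0 ≤ C ^ 2 * C1 * (b x * Γ x) :=
            mul_nonneg (by positivity) (mul_nonneg (b0 x) (Γ0 x))
          have n5 : 0 ≤ C ^ 2 * C1 * (b x * P x) :=
            mul_nonneg (by positivity) (mul_nonneg (b0 x) (P0 x))
          rw [e]
          linarith
        by_cases h2R : ‖x‖ ≤ 2 * R
        · have : Set.indicator {x : R3 | ‖x‖ ≤ 2 * R} f x = f x :=
            Set.indicator_of_mem (s := {x : R3 | ‖x‖ ≤ 2 * R}) h2R f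
          rw [← this] at key
          exact key.trans (le_add_of_nonneg_right n2)
        · have hNx : N ≤ ‖x‖ := hz2 (not_le.1 h2R)
          have : Set.indicator {x : R3 | N ≤ ‖x‖} f x = f x :=
            Set.indicator_of_mem (s := {x : R3 | N ≤ ‖x‖}) hNx f
          rw [← this] at key
          exact key.trans (le_add_of_nonneg_left n1)
    have low : ∫ x in {x | 2 * R ≤ ‖x‖}, f x ≤ (∫ x, b x * χ x ^ 2 * (P x + Γ x)) +
        ∫ x in {x | N ≤ ‖x‖}, f x := by
      rw [← integral_indicator (msF _), ← integral_indicator (msF _),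
        ← integral_add i1 (hint.indicator (msF _))]
      refine integral_mono (hint.indicator (msF _)) (i1.add (hint.indicator (msF _))) fun x => ?_
      have n1 : 0 ≤ b x * χ x ^ 2 * (P x + Γ x) :=
        mul_nonneg (mul_nonneg (b0 x) (sq_nonneg _)) (add_nonneg (P0 x) (Γ0 x))
      have n2 : 0 ≤ Set.indicator {x | N ≤ ‖x‖} f x := Set.indicator_nonneg (fun x _ => f0 x) x
      by_cases h2R : 2 * R ≤ ‖x‖
      · have e1 : Set.indicator {x : R3 | 2 * R ≤ ‖x‖} f x = f x :=
            Set.indicator_of_mem (s := {x : R3 | 2 * R ≤ ‖x‖}) h2R f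
        change Set.indicator {x : R3 | 2 * R ≤ ‖x‖} f x ≤ _ + _
        rw [e1]
        rcases le_or_gt N ‖x‖ with hNx | hNx
        · have e2 : Set.indicator {x : R3 | N ≤ ‖x‖} f x = f x :=
            Set.indicator_of_mem (s := {x : R3 | N ≤ ‖x‖}) hNx f
          rw [e2]
          exact le_add_of_nonneg_left n1
        · have hχ1 : χ x = 1 := by simp only [hχ, vR x h2R, oN x hNx.le, sub_zero]
          have : f x = b x * χ x ^ 2 * (P x + Γ x) := by simp only [hχ1, hf, hb]; ring
          rw [this]
          exact le_add_of_nonneg_right n2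
      · have e1 : Set.indicator {x : R3 | 2 * R ≤ ‖x‖} f x = 0 :=
            Set.indicator_of_notMem (s := {x : R3 | 2 * R ≤ ‖x‖}) h2R f
        change Set.indicator {x : R3 | 2 * R ≤ ‖x‖} f x ≤ _ + _
        rw [e1]
        exact add_nonneg n1 n2
    change ∫ x, b x * χ x ^ 2 * (P x + Γ x) ≤ _ at hle
    linarith
  -- the mass outside the ball of radius `N` tends to zero
  have tail : Tendsto (fun n : ℕ => ∫ x in {x : R3 | (n : ℝ) ≤ ‖x‖}, f x) atTop (𝓝 0) := by
    have h1 := tendsto_setIntegral_of_antitone (μ := (volume : Measure R3)) (f := f)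
      (s := fun n : ℕ => {x : R3 | (n : ℝ) ≤ ‖x‖}) (fun n => msF n)
      (fun n k hnk x hx => le_trans (by exact_mod_cast hnk) (show (k : ℝ) ≤ ‖x‖ from hx))
      ⟨0, hint.integrableOn⟩
    have h2 : ⋂ n : ℕ, {x : R3 | (n : ℝ) ≤ ‖x‖} = ∅ := by
      ext x
      simp only [Set.mem_iInter, Set.mem_ofPred_eq, Set.mem_empty_iff_false, iff_false, not_forall,
        not_le]
      exact exists_nat_gt _
    rw [h2] at h1
    simpa using h1
  have lim := (tail.const_mul (K + 1)).const_add (K * ∫ x in {x | ‖x‖ ≤ 2 * R}, f x)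
  rw [mul_zero, add_zero] at lim
  refine ge_of_tendsto lim ?_
  obtain ⟨n0, hn0⟩ := exists_nat_gt (2 * R)
  filter_upwards [eventually_ge_atTop n0] with n hn
  exact main n (hn0.trans_le (by exact_mod_cast hn))

theorem weightExp_le_linear {α γ δ : ℝ} (hγ : 0 ≤ γ) (hδ : 0 ≤ δ) (x : R3) :
    weightExp α γ δ x ≤ (α + γ) * japaneseBracket x := by
  have h0 := japaneseBracket_pos x
  have h1 : japaneseBracket x / (1 + δ * japaneseBracket x) ≤ japaneseBracket x :=
    div_le_self h0.le (by have : 0 ≤ δ * japaneseBracket x := by positivity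
                          linarith)
  have := mul_le_mul_of_nonneg_left h1 hγ
  rw [weightExp]
  linarith

theorem weightExp_le_add_const {α γ δ : ℝ} (hγ : 0 ≤ γ) (hδ : 0 < δ) (x : R3) :
    weightExp α γ δ x ≤ α * japaneseBracket x + γ / δ := by
  have h0 := japaneseBracket_pos x
  have h1 : japaneseBracket x / (1 + δ * japaneseBracket x) ≤ 1 / δ := by
    rw [div_le_div_iff₀ (by positivity) hδ]
    linarith
  have := mul_le_mul_of_nonneg_left h1 hγ
  rw [weightExp]
  have e : γ / δ = γ * (1 / δ) := by ring
  linarith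

/-- The estimate of `weighted_mass_le` for a nonnegative density `D`: the weighted mass at infinity
is controlled by the one in a ball, uniformly in the admissible weights. -/
def MassControlled (D : R3 → ℝ) (E R K : ℝ) : Prop :=
  ∀ α γ δ : ℝ, 0 ≤ α → 0 ≤ γ → 0 ≤ δ → γ * (α + γ) ≤ E / 16 →
    Integrable (fun x => Real.exp (2 * weightExp α γ δ x) * D x) volume →
    ∫ x in {x | 2 * R ≤ ‖x‖}, Real.exp (2 * weightExp α γ δ x) * D x ≤
      K * ∫ x in {x | ‖x‖ ≤ 2 * R}, Real.exp (2 * weightExp α γ δ x) * D x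

section
variable {D : R3 → ℝ} {E R K : ℝ}

theorem measurableSet_le_norm (r : ℝ) : MeasurableSet {x : R3 | r ≤ ‖x‖} :=
  (isClosed_le continuous_const continuous_norm).measurableSet

theorem measurableSet_norm_le (r : ℝ) : MeasurableSet {x : R3 | ‖x‖ ≤ r} :=
  (isClosed_le continuous_norm continuous_const).measurableSet

/-- The weighted mass in a ball, for a weight of growth rate at most `β`. -/
theorem setIntegral_weight_le (D0 : ∀ x, 0 ≤ D x) (hD : Integrable D volume) {F : R3 → ℝ} {β r : ℝ}
    (hβ : 0 ≤ β) (hF : ∀ x, F x ≤ β * japaneseBracket x)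
    (hi : Integrable (fun x => Real.exp (2 * F x) * D x) volume) :
    ∫ x in {x | ‖x‖ ≤ r}, Real.exp (2 * F x) * D x ≤
      Real.exp (2 * (β * √(1 + r ^ 2))) * ∫ x, D x := by
  calc ∫ x in {x | ‖x‖ ≤ r}, Real.exp (2 * F x) * D x
      ≤ ∫ x in {x | ‖x‖ ≤ r}, Real.exp (2 * (β * √(1 + r ^ 2))) * D x := by
        refine setIntegral_mono_on hi.integrableOn (hD.const_mul _).integrableOn
          (measurableSet_norm_le r) fun x hx => ?_
        have hx : ‖x‖ ≤ r := hx
        have h1 : japaneseBracket x ≤ √(1 + r ^ 2) := Real.sqrt_le_sqrt (by gcongr)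
        have := hF x
        have := mul_le_mul_of_nonneg_left h1 hβ
        exact mul_le_mul_of_nonneg_right (Real.exp_le_exp.2 (by linarith)) (D0 x)
    _ ≤ ∫ x, Real.exp (2 * (β * √(1 + r ^ 2))) * D x :=
        setIntegral_le_integral (hD.const_mul _)
          (.of_forall fun x => mul_nonneg (Real.exp_pos _).le (D0 x))
    _ = _ := integral_const_mul _ _

/-- Improvement of the rate of exponential decay from `α` to `α + γ`. -/
theorem MassControlled.improve (h : MassControlled D E R K) (D0 : ∀ x, 0 ≤ D x)
    (hD : Integrable D volume) (K0 : 0 ≤ K) {α γ : ℝ} (hα : 0 ≤ α) (hγ : 0 ≤ γ)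
    (hγE : γ * (α + γ) ≤ E / 16)
    (hi : Integrable (fun x => Real.exp (2 * (α * japaneseBracket x)) * D x) volume) :
    Integrable (fun x => Real.exp (2 * ((α + γ) * japaneseBracket x)) * D x) volume := by
  set δ : ℕ → ℝ := fun n => 1 / ((n : ℝ) + 1) with hδ
  have δpos : ∀ n, 0 < δ n := fun n => by positivity
  set G : ℕ → R3 → ℝ := fun n x => Real.exp (2 * weightExp α γ (δ n) x) * D x with hG
  have cF : ∀ n, Continuous (weightExp α γ (δ n)) := fun n =>
    (contDiff_weightExp (δpos n).le).continuous
  have mG : ∀ n, AEStronglyMeasurable (G n) volume := fun n =>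
    (by fun_prop : Continuous fun x => Real.exp (2 * weightExp α γ (δ n) x)).aestronglyMeasurable.mul
      hD.1
  have G0 : ∀ n x, 0 ≤ G n x := fun n x => mul_nonneg (Real.exp_pos _).le (D0 x)
  have iG : ∀ n, Integrable (G n) volume := fun n => by
    refine (hi.const_mul (Real.exp (2 * (γ / δ n)))).mono' (mG n) (.of_forall fun x => ?_)
    rw [Real.norm_of_nonneg (G0 n x), ← mul_assoc, ← Real.exp_add]
    refine mul_le_mul_of_nonneg_right (Real.exp_le_exp.2 ?_) (D0 x)
    linarith [weightExp_le_add_const (α := α) hγ (δpos n) x]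
  set B := (K + 1) * (Real.exp (2 * ((α + γ) * √(1 + (2 * R) ^ 2))) * ∫ x, D x) with hB
  have bG : ∀ n, ∫ x, G n x ≤ B := by
    intro n
    have h1 := h α γ (δ n) hα hγ (δpos n).le hγE (iG n)
    have h2 := setIntegral_weight_le (r := 2 * R) D0 hD (add_nonneg hα hγ)
      (weightExp_le_linear hγ (δpos n).le) (iG n)
    have h3 := integral_add_compl (measurableSet_le_norm (2 * R)) (iG n)
    have h4 : ∫ x in {x : R3 | 2 * R ≤ ‖x‖}ᶜ, G n x ≤ ∫ x in {x | ‖x‖ ≤ 2 * R}, G n x :=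
      setIntegral_mono_set (iG n).integrableOn (.of_forall (G0 n))
        (.of_forall fun x (hx : ¬ 2 * R ≤ ‖x‖) => show ‖x‖ ≤ 2 * R from (not_le.1 hx).le)
    have h5 := mul_le_mul_of_nonneg_left h2 (show 0 ≤ K + 1 by linarith)
    change ∫ x in {x | 2 * R ≤ ‖x‖}, G n x ≤ K * ∫ x in {x | ‖x‖ ≤ 2 * R}, G n x at h1
    change (K + 1) * ∫ x in {x | ‖x‖ ≤ 2 * R}, G n x ≤ _ at h5
    rw [hB]
    linarith
  have lim : ∀ x, Tendsto (fun n => G n x) atTop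
      (𝓝 (Real.exp (2 * ((α + γ) * japaneseBracket x)) * D x)) := by
    intro x
    have h1 : Tendsto δ atTop (𝓝 0) := tendsto_one_div_add_atTop_nhds_zero_nat
    have h2 : ContinuousAt (fun d : ℝ => Real.exp (2 * (α * japaneseBracket x +
        γ * (japaneseBracket x / (1 + d * japaneseBracket x)))) * D x) 0 := by
      refine ContinuousAt.mul (ContinuousAt.rexp ?_) continuousAt_const
      refine continuousAt_const.mul (continuousAt_const.add (continuousAt_const.mul
        (continuousAt_const.div (by fun_prop) (by simp))))
    have h3 := h2.tendsto.comp h1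
    have e : Real.exp (2 * ((α + γ) * japaneseBracket x)) * D x =
        Real.exp (2 * (α * japaneseBracket x +
        γ * (japaneseBracket x / (1 + 0 * japaneseBracket x)))) * D x := by
      simp; left; ring
    rw [e]
    exact h3
  have cj := contDiff_japaneseBracket.continuous
  refine ⟨(by fun_prop : Continuous fun x =>
    Real.exp (2 * ((α + γ) * japaneseBracket x))).aestronglyMeasurable.mul hD.1, ?_⟩
  rw [hasFiniteIntegral_iff_ofReal (.of_forall fun x => mul_nonneg (Real.exp_pos _).le (D0 x))]
  calc ∫⁻ x, ENNReal.ofReal (Real.exp (2 * ((α + γ) * japaneseBracket x)) * D x)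
      = ∫⁻ x, liminf (fun n => ENNReal.ofReal (G n x)) atTop :=
        lintegral_congr fun x => ((ENNReal.tendsto_ofReal (lim x)).liminf_eq).symm
    _ ≤ liminf (fun n => ∫⁻ x, ENNReal.ofReal (G n x)) atTop :=
        lintegral_liminf_le' fun n => (mG n).aemeasurable.ennreal_ofReal
    _ ≤ liminf (fun _ : ℕ => ENNReal.ofReal B) atTop := by
        refine liminf_le_liminf (.of_forall fun n => ?_)
        rw [← ofReal_integral_eq_lintegral_ofReal (iG n) (.of_forall (G0 n))]
        exact ENNReal.ofReal_le_ofReal (bG n)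
    _ < ⊤ := by rw [liminf_const]; exact ENNReal.ofReal_lt_top

/-- Decay faster than every exponential. The increment of the rate can be chosen uniformly as long
as the rate stays below a given `Λ`. -/
theorem MassControlled.exp_decay (h : MassControlled D E R K) (D0 : ∀ x, 0 ≤ D x)
    (hD : Integrable D volume) (K0 : 0 ≤ K) (hE : 0 < E) {Λ : ℝ} (hΛ : 0 ≤ Λ) :
    Integrable (fun x => Real.exp (2 * (Λ * japaneseBracket x)) * D x) volume := by
  set γ : ℝ := min 1 (E / (16 * (Λ + 1))) with hγ
  have γpos : 0 < γ := lt_min one_pos (by positivity)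
  have cj := contDiff_japaneseBracket.continuous
  have mono : ∀ {a b : ℝ}, a ≤ b →
      Integrable (fun x => Real.exp (2 * (b * japaneseBracket x)) * D x) volume →
      Integrable (fun x => Real.exp (2 * (a * japaneseBracket x)) * D x) volume := by
    intro a b hab hb
    refine hb.mono' ((by fun_prop : Continuous fun x =>
      Real.exp (2 * (a * japaneseBracket x))).aestronglyMeasurable.mul hD.1)
      (.of_forall fun x => ?_)
    rw [Real.norm_of_nonneg (mul_nonneg (Real.exp_pos _).le (D0 x))]
    refine mul_le_mul_of_nonneg_right (Real.exp_le_exp.2 ?_) (D0 x)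
    have := mul_le_mul_of_nonneg_right hab (japaneseBracket_pos x).le
    linarith
  have step : ∀ n : ℕ, Integrable (fun x =>
      Real.exp (2 * (min (n * γ) Λ * japaneseBracket x)) * D x) volume := by
    intro n
    induction n with
    | zero => simpa [hΛ] using hD
    | succ n ih =>
      have h1 : γ * (min (n * γ) Λ + γ) ≤ E / 16 := by
        have a1 : min (n * γ) Λ + γ ≤ Λ + 1 := add_le_add (min_le_right _ _) (min_le_left _ _)
        have a2 : γ * (Λ + 1) ≤ E / 16 := by
          have := mul_le_mul_of_nonneg_right (min_le_right 1 (E / (16 * (Λ + 1))))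
            (show 0 ≤ Λ + 1 by linarith)
          refine this.trans (le_of_eq ?_)
          field_simp
        exact (mul_le_mul_of_nonneg_left a1 γpos.le).trans a2
      refine mono ?_ (h.improve D0 hD K0 (le_min (by positivity) hΛ) γpos.le h1 ih)
      push_cast
      rcases le_total (n * γ) Λ with hle | hle
      · rw [min_eq_left hle]
        exact (min_le_left _ _).trans (le_of_eq (by ring))
      · rw [min_eq_right hle]
        exact (min_le_right _ _).trans (by linarith)
  obtain ⟨n, hn⟩ := exists_nat_ge (Λ / γ)
  have := step n
  rwa [min_eq_right ((div_le_iff₀ γpos).1 hn)] at this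

/-- Letting the rate of the weight tend to infinity, the density vanishes outside a ball. -/
theorem MassControlled.eq_zero_outside (h : MassControlled D E R K) (D0 : ∀ x, 0 ≤ D x)
    (hD : Integrable D volume) (K0 : 0 ≤ K) (hE : 0 < E) (hR : 0 < R) :
    ∀ᵐ x ∂(volume : Measure R3), 3 * R ≤ ‖x‖ → D x = 0 := by
  set c0 := √(1 + (2 * R) ^ 2) with hc0
  set c1 := √(1 + (3 * R) ^ 2) with hc1
  have hc : c0 < c1 := Real.sqrt_lt_sqrt (by positivity) (by nlinarith)
  have hw : ∀ α x, weightExp α 0 0 x = α * japaneseBracket x := fun α x => by simp [weightExp]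
  have bound : ∀ α : ℝ, 0 ≤ α → ∫ x in {x | 3 * R ≤ ‖x‖}, D x ≤
      (K * ∫ x, D x) * Real.exp (-(2 * (c1 - c0) * α)) := by
    intro α hα
    have hi := h.exp_decay D0 hD K0 hE hα
    have h1 := h α 0 0 hα le_rfl le_rfl (by rw [zero_mul]; positivity) (by simpa only [hw] using hi)
    simp only [hw] at h1
    have h2 := setIntegral_weight_le (r := 2 * R) D0 hD hα (fun x => le_rfl) hi
    have h3 : Real.exp (2 * (α * c1)) * ∫ x in {x | 3 * R ≤ ‖x‖}, D x ≤
        ∫ x in {x | 3 * R ≤ ‖x‖}, Real.exp (2 * (α * japaneseBracket x)) * D x := by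
      rw [← integral_const_mul]
      refine setIntegral_mono_on (hD.const_mul _).integrableOn hi.integrableOn
        (measurableSet_le_norm _) fun x hx => ?_
      have hx : 3 * R ≤ ‖x‖ := hx
      have a1 : c1 ≤ japaneseBracket x := Real.sqrt_le_sqrt (by gcongr)
      have := mul_le_mul_of_nonneg_left a1 hα
      exact mul_le_mul_of_nonneg_right (Real.exp_le_exp.2 (by linarith)) (D0 x)
    have h4 : ∫ x in {x | 3 * R ≤ ‖x‖}, Real.exp (2 * (α * japaneseBracket x)) * D x ≤
        ∫ x in {x | 2 * R ≤ ‖x‖}, Real.exp (2 * (α * japaneseBracket x)) * D x :=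
      setIntegral_mono_set hi.integrableOn
        (.of_forall fun x => mul_nonneg (Real.exp_pos _).le (D0 x))
        (.of_forall fun x (hx : 3 * R ≤ ‖x‖) => show 2 * R ≤ ‖x‖ by linarith)
    have h5 := mul_le_mul_of_nonneg_left h2 K0
    have h6 : Real.exp (2 * (α * c1)) * ∫ x in {x | 3 * R ≤ ‖x‖}, D x ≤
        K * (Real.exp (2 * (α * c0)) * ∫ x, D x) := by linarith
    have e1 : Real.exp (-(2 * (c1 - c0) * α)) =
        Real.exp (2 * (α * c0)) / Real.exp (2 * (α * c1)) := by
      rw [← Real.exp_sub]; congr 1; ring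
    rw [e1, mul_div_assoc', le_div_iff₀ (Real.exp_pos _)]
    linarith
  have lim : Tendsto (fun α : ℝ => (K * ∫ x, D x) * Real.exp (-(2 * (c1 - c0) * α))) atTop
      (𝓝 0) := by
    have h1 : Tendsto (fun α : ℝ => 2 * (c1 - c0) * α) atTop atTop :=
      tendsto_id.const_mul_atTop (by linarith)
    simpa using (Real.tendsto_exp_neg_atTop_nhds_zero.comp h1).const_mul (K * ∫ x, D x)
  have hle : ∫ x in {x | 3 * R ≤ ‖x‖}, D x ≤ 0 := by
    refine ge_of_tendsto lim ?_
    filter_upwards [eventually_ge_atTop 0] with α hα using bound α hα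
  have h0 : ∫ x in {x | 3 * R ≤ ‖x‖}, D x = 0 :=
    le_antisymm hle (integral_nonneg D0)
  rw [setIntegral_eq_zero_iff_of_nonneg_ae (.of_forall D0) hD.integrableOn] at h0
  exact (ae_restrict_iff' (measurableSet_le_norm _)).1 h0

end

/-! ### Absence of eigenfunctions -/

/-- Unique continuation from outside a ball, by the Gaussian Carleman inequality centred outside
the support. -/
theorem ae_eq_zero_of_compact_support {ι : Type*} [Fintype ι] {ψ ℓ : ι → R3 → ℝ}
    {p : ι → Fin 3 → R3 → ℝ} (h : ∀ i, IsSobolevH2 (ψ i) (p i) (ℓ i)) {B R : ℝ} (hB : 0 ≤ B)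
    (hR : 0 < R)
    (hℓ : ∀ᵐ x ∂(volume : Measure R3), ∑ i, ℓ i x ^ 2 ≤
      B * (∑ i, ψ i x ^ 2 + ∑ i, ∑ j, p i j x ^ 2))
    (hz : ∀ᵐ x ∂(volume : Measure R3), R ≤ ‖x‖ → ∑ i, ψ i x ^ 2 + ∑ i, ∑ j, p i j x ^ 2 = 0) :
    ∀ᵐ x ∂(volume : Measure R3), ∑ i, ψ i x ^ 2 + ∑ i, ∑ j, p i j x ^ 2 = 0 := by
  obtain ⟨C, hC0, θ, hθ⟩ := exists_cutoff
  obtain ⟨tR, oR, -, sR, -, -⟩ := hθ R hR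
  set a : R3 := EuclideanSpace.single 0 (2 * R + 1) with ha
  have hna : ‖a‖ = 2 * R + 1 := by
    rw [ha, PiLp.norm_single, Real.norm_of_nonneg (by linarith)]
  set τ : ℝ := 9 + 192 * B with hτ
  have hτ9 : 9 ≤ τ := by linarith
  have hτ0 : 0 < τ := by linarith
  set b : R3 → ℝ := fun x => Real.exp (τ * ‖x - a‖ ^ 2) with hb
  have cb : Continuous b := by fun_prop
  have b0 : ∀ x, 0 < b x := fun x => Real.exp_pos _
  obtain ⟨i1, i2, hle⟩ := carleman_system (M := 0) (m := fun x => 4 / τ * b x) (b := b) (q := 0)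
    h tR cb (by fun_prop) (fun x => (b0 x).le)
    (fun x => mul_nonneg (by positivity) (b0 x).le) aestronglyMeasurable_zero (by simp)
    (fun w hw hws => by
      have := carleman_gaussian (a := a) hτ9 hw fun x hx => by
        have h1 : ‖x‖ ≤ 2 * R := sR (hws hx)
        have h2 := norm_sub_norm_le a x
        rw [norm_sub_rev] at h2
        linarith
      refine this.trans (le_of_eq ?_)
      rw [← integral_const_mul]
      refine integral_congr_ae (.of_forall fun x => ?_)
      simp only [hb, Pi.zero_apply, zero_mul, add_zero]
      ring)
    (by
      filter_upwards [hℓ] with x hx _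
      simp only [Pi.zero_apply, zero_mul, add_zero]
      have hD : 0 ≤ ∑ i, ψ i x ^ 2 + ∑ i, ∑ j, p i j x ^ 2 := by positivity
      have h1 : 48 * (4 / τ * b x) * ∑ i, ℓ i x ^ 2 ≤ 48 * (4 / τ * b x) *
          (B * (∑ i, ψ i x ^ 2 + ∑ i, ∑ j, p i j x ^ 2)) :=
        mul_le_mul_of_nonneg_left hx (mul_nonneg (by norm_num)
          (mul_nonneg (by positivity) (b0 x).le))
      refine h1.trans ?_
      have h2 : 192 * B / τ ≤ 1 := by rw [div_le_one hτ0]; linarith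
      calc 48 * (4 / τ * b x) * (B * (∑ i, ψ i x ^ 2 + ∑ i, ∑ j, p i j x ^ 2))
          = (192 * B / τ) * (b x * (∑ i, ψ i x ^ 2 + ∑ i, ∑ j, p i j x ^ 2)) := by ring
        _ ≤ _ := mul_le_of_le_one_left (mul_nonneg (b0 x).le hD) h2)
  set D : R3 → ℝ := fun x => ∑ i, ψ i x ^ 2 + ∑ i, ∑ j, p i j x ^ 2 with hD
  have D0 : ∀ x, 0 ≤ D x := fun x => by positivity
  -- the cutoff is constant where the functions do not vanish
  have hright : ∫ x, ((∑ j, pd j (θ R) x ^ 2) * (192 * (4 / τ * b x) * (∑ i, ∑ j, p i j x ^ 2) +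
      4 * b x * ∑ i, ψ i x ^ 2) + 48 * (4 / τ * b x) * lap (θ R) x ^ 2 * ∑ i, ψ i x ^ 2) = 0 := by
    refine integral_eq_zero_of_ae ?_
    filter_upwards [hz] with x hx
    rcases lt_or_ge ‖x‖ R with hlt | hge
    · simp [pd_eq_zero_of_eventually_one oR hlt, lap_eq_zero_of_eventually_one oR hlt]
    · have hx := hx hge
      have hP : 0 ≤ ∑ i, ψ i x ^ 2 := by positivity
      have hΓ : 0 ≤ ∑ i, ∑ j, p i j x ^ 2 := by positivity
      have e1 : ∑ i, ψ i x ^ 2 = 0 := by linarith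
      have e2 : ∑ i, ∑ j, p i j x ^ 2 = 0 := by linarith
      simp only [e1, e2]
      simp
  rw [hright] at hle
  have hnn : 0 ≤ fun x => b x * θ R x ^ 2 * D x := fun x =>
    mul_nonneg (mul_nonneg (b0 x).le (sq_nonneg _)) (D0 x)
  have h0 : ∫ x, b x * θ R x ^ 2 * D x = 0 := le_antisymm hle (integral_nonneg hnn)
  rw [integral_eq_zero_iff_of_nonneg hnn i1] at h0
  filter_upwards [h0, hz] with x hx hx'
  rcases lt_or_ge ‖x‖ R with hlt | hge
  · have : b x * θ R x ^ 2 * D x = 0 := hx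
    rw [oR x hlt.le] at this
    simpa [(b0 x).ne'] using this
  · exact hx' hge

/-- Absence of nontrivial `H²` solutions of `Δψ + qψ = f` with `|f|² ≤ a |∇ψ|²`, where `q` has
positive virial `q + x · ∇q` at infinity and `|x|² a → 0`. -/
theorem ae_eq_zero_of_virial {ι : Type*} [Fintype ι] {ψ ℓ : ι → R3 → ℝ} {p : ι → Fin 3 → R3 → ℝ}
    (h : ∀ i, IsSobolevH2 (ψ i) (p i) (ℓ i)) {q a : R3 → ℝ} {q' : Fin 3 → R3 → ℝ} {E M B : ℝ}
    (hq : HasWeakGrad q q') (hqM : ∀ x, |q x| ≤ M) (hE : 0 < E)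
    (hQ : ∃ R, ∀ᵐ x ∂(volume : Measure R3), R ≤ ‖x‖ → 3 / 4 * E ≤ q x + ∑ j, x j * q' j x)
    (ha : ∀ c > 0, ∃ R, ∀ᵐ x ∂(volume : Measure R3), R ≤ ‖x‖ → ‖x‖ ^ 2 * a x ≤ c)
    (hB : 0 ≤ B) (haB : ∀ᵐ x ∂(volume : Measure R3), a x ≤ B)
    (heq : ∀ᵐ x ∂(volume : Measure R3),
      ∑ i, (ℓ i x + q x * ψ i x) ^ 2 ≤ a x * ∑ i, ∑ j, p i j x ^ 2) :
    ∀ᵐ x ∂(volume : Measure R3), ∑ i, ψ i x ^ 2 + ∑ i, ∑ j, p i j x ^ 2 = 0 := by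
  obtain ⟨R, K, hR, K0, hcontrol⟩ := weighted_mass_le h hq hqM hE hQ ha heq
  have hMC : MassControlled (fun x => ∑ i, ψ i x ^ 2 + ∑ i, ∑ j, p i j x ^ 2) E R K := hcontrol
  have iP : Integrable (fun x => ∑ i, ψ i x ^ 2) volume :=
    integrable_finsetSum _ fun i _ => (h i).memLp.integrable_sq
  have iΓ : Integrable (fun x => ∑ i, ∑ j, p i j x ^ 2) volume := integrable_finsetSum _ fun i _ =>
    integrable_finsetSum _ fun j _ => ((h i).memLp_grad j).integrable_sq
  have hz := hMC.eq_zero_outside (fun x => by positivity) (iP.add iΓ) K0 hE (by linarith)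
  refine ae_eq_zero_of_compact_support h (B := 2 * B + 2 * M ^ 2) (by positivity)
    (show 0 < 3 * R by linarith) ?_ hz
  filter_upwards [haB, heq] with x hx1 hx2
  have hP : 0 ≤ ∑ i, ψ i x ^ 2 := by positivity
  have hΓ : 0 ≤ ∑ i, ∑ j, p i j x ^ 2 := by positivity
  have h1 : ∑ i, ℓ i x ^ 2 ≤
      2 * ∑ i, (ℓ i x + q x * ψ i x) ^ 2 + 2 * q x ^ 2 * ∑ i, ψ i x ^ 2 := by
    rw [Finset.mul_sum, Finset.mul_sum, ← Finset.sum_add_distrib]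
    refine Finset.sum_le_sum fun i _ => ?_
    nlinarith [sq_nonneg (ℓ i x + 2 * (q x * ψ i x))]
  have h2 : q x ^ 2 ≤ M ^ 2 := sq_le_sq' (abs_le.1 (hqM x)).1 (abs_le.1 (hqM x)).2
  have h3 := mul_le_mul_of_nonneg_right h2 hP
  have h4 := mul_le_mul_of_nonneg_right hx1 hΓ
  have h5 := mul_nonneg hB hP
  have h6 := mul_nonneg (sq_nonneg M) hΓ
  linarith

/-! ### Reduction of the eigenvalue equation -/

/-- Applying a continuous real functional to the values of a weakly differentiable function. -/
theorem HasWeakFDeriv.integral_clm {F : Type*} [NormedAddCommGroup F] [NormedSpace ℝ F]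
    [CompleteSpace F] {f : R3 → F} {f' : R3 → R3 →L[ℝ] F} (h : HasWeakFDeriv f f') (T : F →L[ℝ] ℝ)
    {φ : R3 → ℝ} (hφ : IsTestFun φ) (j : Fin 3) :
    ∫ x, pd j φ x * T (f x) = - ∫ x, φ x * T (f' x (stdVec j)) := by
  have i1 : Integrable (fun x => pd j φ x • f x) volume :=
    h.1.integrable_smul_left_of_hasCompactSupport (isTestFun_pd hφ j).1.continuous
      (isTestFun_pd hφ j).2
  have i2 : Integrable (fun x => φ x • f' x (stdVec j)) volume :=
    ((ContinuousLinearMap.apply ℝ F (stdVec j)).integrable_comp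
      (h.2.1.integrable_smul_left_of_hasCompactSupport hφ.1.continuous hφ.2)).congr
      (.of_forall fun x => by simp)
  have h1 := h.2.2 φ hφ (stdVec j)
  change ∫ x, pd j φ x • f x = _ at h1
  have h2 := congrArg T h1
  rw [map_neg, ← T.integral_comp_comm i1, ← T.integral_comp_comm i2] at h2
  simpa only [map_smul, smul_eq_mul] using h2

theorem isSobolevH2_component {ψ : R3 → ℂ} {Dψ : R3 → R3 →L[ℝ] ℂ}
    {D2ψ : R3 → R3 →L[ℝ] R3 →L[ℝ] ℂ} (hψ : MemLp ψ 2 volume) (h1 : HasWeakFDeriv ψ Dψ)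
    (hD : MemLp Dψ 2 volume) (h2 : HasWeakFDeriv Dψ D2ψ) (hD2 : MemLp D2ψ 2 volume)
    (T : ℂ →L[ℝ] ℝ) :
    IsSobolevH2 (fun x => T (ψ x)) (fun j x => T (Dψ x (stdVec j)))
      (fun x => T (∑ j, D2ψ x (stdVec j) (stdVec j))) := by
  have hp : ∀ j, MemLp (fun x => T (Dψ x (stdVec j))) 2 volume := fun j =>
    (T.comp (ContinuousLinearMap.apply ℝ ℂ (stdVec j))).comp_memLp' hD
  have hs : ∀ j, MemLp (fun x => T (D2ψ x (stdVec j) (stdVec j))) 2 volume := fun j => by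
    have hD2j : MemLp (fun x => D2ψ x (stdVec j)) 2 volume := by
      exact ContinuousLinearMap.comp_memLp' (E := R3 →L[ℝ] R3 →L[ℝ] ℂ) (F := R3 →L[ℝ] ℂ)
        (𝕜 := ℝ) (𝕜' := ℝ) (σ := RingHom.id ℝ)
        (ContinuousLinearMap.apply ℝ (R3 →L[ℝ] ℂ) (stdVec j)) hD2
    exact (T.comp (ContinuousLinearMap.apply ℝ ℂ (stdVec j))).comp_memLp' hD2j
  refine ⟨T.comp_memLp' hψ, hp, ?_, fun φ hφ j => h1.integral_clm T hφ j, fun φ hφ => ?_⟩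
  · simp only [map_sum]
    exact memLp_finsetSum _ fun j _ => hs j
  · have e : ∀ j, ∫ x, pd j φ x * T (Dψ x (stdVec j)) =
        - ∫ x, φ x * T (D2ψ x (stdVec j) (stdVec j)) := fun j =>
      h2.integral_clm (T.comp (ContinuousLinearMap.apply ℝ ℂ (stdVec j))) hφ j
    rw [integral_finsetSum _ fun j _ =>
      (isTestFun_pd hφ j).integrable_mul (hp j).locallyIntegrable_two]
    simp only [e, map_sum, Finset.mul_sum]
    rw [integral_finsetSum _ fun j _ => hφ.integrable_mul (hs j).locallyIntegrable_two,
      Finset.sum_neg_distrib]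

/-- Young's inequality with parameter `t`. It bounds the pairing of a bounded field `A` with the
gradient `d ∇φ + φ e` of a product, where `c = ∇φ` and `f = φ`. -/
theorem abs_pairing_le {B t f d : ℝ} {A c e : Fin 3 → ℝ} (hB : 0 ≤ B) (hA : ∀ j, |A j| ≤ B)
    (ht : 0 < t) :
    |∑ j, A j * (c j * d + f * e j)| ≤
      B * t * (∑ j, c j ^ 2 + 3 * f ^ 2) + B / t * (3 * d ^ 2 + ∑ j, e j ^ 2) := by
  have key : ∀ a b : ℝ, |a * b| ≤ t * a ^ 2 + 1 / t * b ^ 2 := by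
    intro a b
    rw [abs_le]
    have h1 : t * a ^ 2 + 1 / t * b ^ 2 + a * b =
        1 / t * ((t * a + b / 2) ^ 2 + 3 / 4 * b ^ 2) := by field_simp; ring
    have h2 : t * a ^ 2 + 1 / t * b ^ 2 - a * b =
        1 / t * ((t * a - b / 2) ^ 2 + 3 / 4 * b ^ 2) := by field_simp; ring
    have h3 : 0 ≤ 1 / t * ((t * a + b / 2) ^ 2 + 3 / 4 * b ^ 2) := by positivity
    have h4 : 0 ≤ 1 / t * ((t * a - b / 2) ^ 2 + 3 / 4 * b ^ 2) := by positivity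
    constructor <;> linarith
  have h : ∀ j, |A j * (c j * d + f * e j)| ≤
      B * (t * c j ^ 2 + 1 / t * d ^ 2 + (t * f ^ 2 + 1 / t * e j ^ 2)) := by
    intro j
    rw [abs_mul]
    exact mul_le_mul (hA j) ((abs_add_le _ _).trans (add_le_add (key _ _) (key _ _)))
      (abs_nonneg _) hB
  refine (Finset.abs_sum_le_sum_abs _ _).trans ((Finset.sum_le_sum fun j _ => h j).trans
    (le_of_eq ?_))
  simp only [Fin.sum_univ_three]
  ring

/-- A bounded divergence-free field `A` pairs to zero with `∇(φψ)`, for `φ` a test function and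
`ψ` in `H²`. -/
theorem IsSobolevH2.integral_divergence_free {ψ ℓ : R3 → ℝ} {p : Fin 3 → R3 → ℝ}
    (h : IsSobolevH2 ψ p ℓ) {A : R3 → R3} {B : ℝ} (hB : 0 ≤ B)
    (hAm : ∀ j, AEStronglyMeasurable (fun x => A x j) volume)
    (hA : ∀ᵐ x ∂(volume : Measure R3), ∀ j, |A x j| ≤ B)
    (hdiv : ∀ φ : R3 → ℝ, IsTestFun φ → ∫ x, ∑ j, pd j φ x * A x j = 0)
    {φ : R3 → ℝ} (hφ : IsTestFun φ) :
    ∫ x, ∑ j, A x j * (pd j φ x * ψ x + φ x * p j x) = 0 := by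
  have hAloc : ∀ j, LocallyIntegrable (fun x => A x j) volume := fun j =>
    (locallyIntegrable_const B).mono (hAm j) (by
      filter_upwards [hA] with x hx
      rw [Real.norm_eq_abs, Real.norm_of_nonneg hB]
      exact hx j)
  have bdd : ∀ j {f : R3 → ℝ}, Integrable f volume → Integrable (fun x => A x j * f x) volume :=
    fun j f hf => hf.bdd_mul (hAm j) (by
      filter_upwards [hA] with x hx
      rw [Real.norm_eq_abs]
      exact hx j)
  have i0 : Integrable (fun x => ∑ j, A x j * (pd j φ x * ψ x + φ x * p j x)) volume :=
    integrable_finsetSum _ fun j _ => bdd j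
      (((isTestFun_pd hφ j).integrable_mul h.memLp.locallyIntegrable_two).add
        (hφ.integrable_mul (h.memLp_grad j).locallyIntegrable_two))
  set c : R3 → ℝ := fun x => ∑ j, pd j φ x ^ 2 + 3 * φ x ^ 2 with hc
  have ic : Integrable c volume := by
    have h1 : ∀ j, Integrable (fun x => pd j φ x ^ 2) volume := fun j => by
      simpa [sq] using ((isTestFun_pd hφ j).mul_left (isTestFun_pd hφ j).1).integrable
    have h2 : Integrable (fun x => φ x ^ 2) volume := by
      simpa [sq] using (hφ.mul_left hφ.1).integrable
    exact (integrable_finsetSum _ fun j _ => h1 j).add (h2.const_mul 3)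
  have c0 : 0 ≤ ∫ x, c x := integral_nonneg fun x => by positivity
  rw [← abs_nonpos_iff]
  refine le_of_forall_pos_le_add fun ε hε => ?_
  rw [zero_add]
  -- the parameter `t` balances the fixed factor against the approximation error
  set t : ℝ := ε / (B * (∫ x, c x) + 3 * B + 1) with ht
  have hden : 0 < B * (∫ x, c x) + 3 * B + 1 := by positivity
  have tpos : 0 < t := div_pos hε hden
  obtain ⟨v, hv, hi, hle⟩ := h.exists_smooth_approx (show 0 < t ^ 2 by positivity)
  set D : R3 → ℝ := fun x => (v x - ψ x) ^ 2 + ∑ j, (pd j v x - p j x) ^ 2 +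
    (_root_.lap v x - ℓ x) ^ 2 with hD
  have tw : IsTestFun (fun y => φ y * v y) := hφ.mul_right hv
  have i1 : Integrable (fun x => ∑ j, pd j (fun y => φ y * v y) x * A x j) volume :=
    integrable_finsetSum _ fun j _ => (isTestFun_pd tw j).integrable_mul (hAloc j)
  have e : ∫ x, ∑ j, A x j * (pd j φ x * ψ x + φ x * p j x) =
      ∫ x, ((∑ j, A x j * (pd j φ x * ψ x + φ x * p j x)) -
        ∑ j, pd j (fun y => φ y * v y) x * A x j) := by
    rw [integral_sub i0 i1, hdiv _ tw, sub_zero]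
  rw [e]
  have pw : ∀ᵐ x ∂(volume : Measure R3), |(∑ j, A x j * (pd j φ x * ψ x + φ x * p j x)) -
      ∑ j, pd j (fun y => φ y * v y) x * A x j| ≤ B * t * c x + 3 * B / t * D x := by
    filter_upwards [hA] with x hx
    have e1 : (∑ j, A x j * (pd j φ x * ψ x + φ x * p j x)) -
        ∑ j, pd j (fun y => φ y * v y) x * A x j =
        -∑ j, A x j * (pd j φ x * (v x - ψ x) + φ x * (pd j v x - p j x)) := by
      simp only [pd_mul hφ.1 hv, Fin.sum_univ_three]
      ring
    rw [e1, abs_neg]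
    refine (abs_pairing_le (c := fun j => pd j φ x) (e := fun j => pd j v x - p j x)
      hB hx tpos).trans ?_
    have s0 : 0 ≤ ∑ j, (pd j v x - p j x) ^ 2 := by positivity
    have h1 : 3 * (v x - ψ x) ^ 2 + ∑ j, (pd j v x - p j x) ^ 2 ≤ 3 * D x := by
      simp only [hD]
      nlinarith [sq_nonneg (_root_.lap v x - ℓ x)]
    have h2 := mul_le_mul_of_nonneg_left h1 (show 0 ≤ B / t by positivity)
    have h3 : B / t * (3 * D x) = 3 * B / t * D x := by ring
    linarith
  refine (abs_integral_le_integral_abs).trans ((integral_mono_ae (i0.sub i1).abs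
    ((ic.const_mul (B * t)).add (hi.const_mul (3 * B / t))) pw).trans ?_)
  simp only [Pi.add_apply]
  rw [integral_add (ic.const_mul (B * t)) (hi.const_mul (3 * B / t)), integral_const_mul,
    integral_const_mul]
  have h4 : 3 * B / t * ∫ x, D x ≤ 3 * B / t * t ^ 2 := by gcongr
  have h5 : 3 * B / t * t ^ 2 = 3 * B * t := by field_simp
  have h6 : t * (B * (∫ x, c x) + 3 * B + 1) = ε := by rw [ht]; field_simp
  change B * t * (∫ x, c x) + 3 * B / t * (∫ x, D x) ≤ ε
  linarith

/-- For a bounded divergence-free field `A`, the weak divergence of `Aψ` is `A · ∇ψ`. -/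
theorem weakDivergence_eq {ψ : R3 → ℂ} {Dψ : R3 → R3 →L[ℝ] ℂ}
    {D2ψ : R3 → R3 →L[ℝ] R3 →L[ℝ] ℂ} {d : R3 → ℂ} {A : R3 → R3} {B : ℝ}
    (hψ : MemLp ψ 2 volume) (h1 : HasWeakFDeriv ψ Dψ)
    (hD : MemLp Dψ 2 volume) (h2 : HasWeakFDeriv Dψ D2ψ) (hD2 : MemLp D2ψ 2 volume)
    (hB : 0 ≤ B) (hA : ∀ᵐ x ∂(volume : Measure R3), ∀ j, |A x j| ≤ B)
    (hdiv : HasWeakDivergence (fun x j => A x j) (fun _ => (0 : ℝ)))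
    (hd : HasWeakDivergence (fun x j => A x j • ψ x) d) :
    ∀ᵐ x ∂(volume : Measure R3), d x = ∑ j, (A x j : ℂ) * Dψ x (stdVec j) := by
  have hAm : ∀ j, AEStronglyMeasurable (fun x => A x j) volume := fun j =>
    (hdiv.1 j).aestronglyMeasurable
  have hdiv' : ∀ φ : R3 → ℝ, IsTestFun φ → ∫ x, ∑ j, pd j φ x * A x j = 0 := fun φ hφ => by
    simpa [pd] using hdiv.2.2 φ hφ
  have comp : ∀ T : ℂ →L[ℝ] ℝ, ∀ᵐ x ∂(volume : Measure R3),
      T (d x) - ∑ j, A x j * T (Dψ x (stdVec j)) = 0 := by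
    intro T
    have hH := isSobolevH2_component hψ h1 hD h2 hD2 T
    have bdd : ∀ j {f : R3 → ℝ}, Integrable f volume →
        Integrable (fun x => A x j * f x) volume :=
      fun j f hf => hf.bdd_mul (hAm j) (by
        filter_upwards [hA] with x hx
        rw [Real.norm_eq_abs]
        exact hx j)
    have ld : LocallyIntegrable (fun x => T (d x)) volume := fun x => by
      obtain ⟨s, hs, hi⟩ := hd.2.1 x
      exact ⟨s, hs, T.integrable_comp hi⟩
    have lA : ∀ j, LocallyIntegrable (fun x => A x j * T (Dψ x (stdVec j))) volume := fun j => by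
      refine ((hH.memLp_grad j).locallyIntegrable_two.smul B).mono
        ((hAm j).mul (hH.memLp_grad j).1) ?_
      filter_upwards [hA] with x hx
      simp only [Pi.smul_apply, smul_eq_mul, norm_mul, Real.norm_eq_abs, abs_of_nonneg hB]
      exact mul_le_mul_of_nonneg_right (hx j) (abs_nonneg _)
    have lS : LocallyIntegrable (fun x => ∑ j, A x j * T (Dψ x (stdVec j))) volume := by
      simp only [Fin.sum_univ_three]
      exact ((lA 0).add (lA 1)).add (lA 2)
    refine ae_eq_zero_of_integral_contDiff_smul_eq_zero (ld.sub lS) fun φ hφ1 hφ2 => ?_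
    have hφ : IsTestFun φ := ⟨hφ1, hφ2⟩
    have e1 : ∫ x, ∑ j, pd j φ x * (A x j * T (ψ x)) = -∫ x, φ x * T (d x) := by
      have i1 : Integrable (fun x => ∑ j, pd j φ x • (A x j • ψ x)) volume :=
        integrable_finsetSum _ fun j _ => (hd.1 j).integrable_smul_left_of_hasCompactSupport
          (isTestFun_pd hφ j).1.continuous (isTestFun_pd hφ j).2
      have i2 : Integrable (fun x => φ x • d x) volume :=
        hd.2.1.integrable_smul_left_of_hasCompactSupport hφ.1.continuous hφ.2
      have := congrArg T (hd.2.2 φ hφ)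
      change T (∫ x, ∑ j, pd j φ x • (A x j • ψ x)) = _ at this
      rw [map_neg, ← T.integral_comp_comm i1, ← T.integral_comp_comm i2] at this
      simpa only [map_sum, map_smul, smul_eq_mul] using this
    have e2 := hH.integral_divergence_free hB hAm hA hdiv' hφ
    have i3 : ∀ j, Integrable (fun x => A x j * (pd j φ x * T (ψ x))) volume := fun j =>
      bdd j ((isTestFun_pd hφ j).integrable_mul hH.memLp.locallyIntegrable_two)
    have i4 : ∀ j, Integrable (fun x => A x j * (φ x * T (Dψ x (stdVec j)))) volume := fun j =>
      bdd j (hφ.integrable_mul (hH.memLp_grad j).locallyIntegrable_two)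
    have e3 : (fun x => ∑ j, A x j * (pd j φ x * T (ψ x) + φ x * T (Dψ x (stdVec j)))) =
        fun x => (∑ j, A x j * (pd j φ x * T (ψ x))) +
          ∑ j, A x j * (φ x * T (Dψ x (stdVec j))) := by
      funext x
      simp only [mul_add, Finset.sum_add_distrib]
    rw [e3, integral_add (integrable_finsetSum _ fun j _ => i3 j)
      (integrable_finsetSum _ fun j _ => i4 j)] at e2
    have e4 : ∀ x, ∑ j, A x j * (pd j φ x * T (ψ x)) = ∑ j, pd j φ x * (A x j * T (ψ x)) :=
      fun x => Finset.sum_congr rfl fun j _ => by ring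
    have e5 : ∀ x, ∑ j, A x j * (φ x * T (Dψ x (stdVec j))) =
        φ x * ∑ j, A x j * T (Dψ x (stdVec j)) := fun x => by
      rw [Finset.mul_sum]
      exact Finset.sum_congr rfl fun j _ => by ring
    simp only [e4, e5] at e2
    rw [e1] at e2
    simp only [smul_eq_mul, mul_sub]
    rw [integral_sub (hφ.integrable_mul ld) (hφ.integrable_mul lS)]
    linarith
  filter_upwards [comp Complex.reCLM, comp Complex.imCLM] with x hre him
  apply Complex.ext
  · simp only [Complex.reCLM_apply] at hre
    simp only [Complex.re_sum, Complex.re_ofReal_mul]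
    linarith
  · simp only [Complex.imCLM_apply] at him
    simp only [Complex.im_sum, Complex.im_ofReal_mul]
    linarith

theorem eventually_norm_mul_bracket_le (C : ℝ) {ε c : ℝ} (hε : 0 < ε) (hc : 0 < c) :
    ∃ R : ℝ, 1 ≤ R ∧ ∀ x : R3, R ≤ ‖x‖ → ‖x‖ * (|C| * japaneseBracket x ^ (-1 - ε)) ≤ c := by
  have h1 : Tendsto (fun r : ℝ => |C| * r ^ (-ε)) atTop (𝓝 0) := by
    simpa using (tendsto_rpow_neg_atTop hε).const_mul |C|
  obtain ⟨R, hR⟩ := ((h1.eventually (gt_mem_nhds hc)).and (eventually_ge_atTop 1)).exists_forall_of_atTop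
  refine ⟨max 1 R, le_max_left _ _, fun x hx => ?_⟩
  obtain ⟨h2, h3⟩ := hR ‖x‖ ((le_max_right _ _).trans hx)
  have hj := japaneseBracket_pos x
  have hn := norm_le_japaneseBracket x
  calc ‖x‖ * (|C| * japaneseBracket x ^ (-1 - ε))
      ≤ japaneseBracket x * (|C| * japaneseBracket x ^ (-1 - ε)) := by gcongr
    _ = |C| * japaneseBracket x ^ (-ε) := by
        have : japaneseBracket x ^ (-ε) = japaneseBracket x ^ (1 : ℝ) *
            japaneseBracket x ^ (-1 - ε) := by
          rw [← Real.rpow_add hj]; congr 1; ring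
        rw [this, Real.rpow_one]; ring
    _ ≤ |C| * ‖x‖ ^ (-ε) := by
        refine mul_le_mul_of_nonneg_left ?_ (abs_nonneg C)
        exact Real.rpow_le_rpow_of_nonpos (by linarith) hn (by linarith)
    _ ≤ c := h2.le

/-- The first-order perturbation `i A · z` is bounded by `|A| |z|`. -/
theorem normSq_I_mul_sum_le (A : R3) (z : Fin 3 → ℂ) :
    (Complex.I * ∑ j, (A j : ℂ) * z j).re ^ 2 + (Complex.I * ∑ j, (A j : ℂ) * z j).im ^ 2 ≤
      ‖A‖ ^ 2 * (∑ j, (z j).re ^ 2 + ∑ j, (z j).im ^ 2) := by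
  have h1 := Finset.sum_mul_sq_le_sq_mul_sq Finset.univ (fun j => A j) fun j => (z j).re
  have h2 := Finset.sum_mul_sq_le_sq_mul_sq Finset.univ (fun j => A j) fun j => (z j).im
  rw [← norm_sq_eq_sum] at h1 h2
  have e1 : (Complex.I * ∑ j, (A j : ℂ) * z j).re = -∑ j, A j * (z j).im := by
    rw [Complex.I_mul_re, Complex.im_sum]
    simp only [Complex.im_ofReal_mul]
  have e2 : (Complex.I * ∑ j, (A j : ℂ) * z j).im = ∑ j, A j * (z j).re := by
    rw [Complex.I_mul_im, Complex.re_sum]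
    simp only [Complex.re_ofReal_mul]
  rw [e1, e2, neg_sq]
  linarith

theorem HasWeakFDeriv.hasWeakGrad_const_sub {V : R3 → ℝ} {gradV : R3 → R3 →L[ℝ] ℝ}
    (h : HasWeakFDeriv V gradV) (E : ℝ) :
    HasWeakGrad (fun x => E - V x) (fun j x => -gradV x (stdVec j)) := by
  have lg : ∀ j, LocallyIntegrable (fun x => gradV x (stdVec j)) volume := fun j x => by
    obtain ⟨s, hs, hi⟩ := h.2.1 x
    exact ⟨s, hs, (ContinuousLinearMap.apply ℝ ℝ (stdVec j)).integrable_comp hi⟩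
  refine ⟨(locallyIntegrable_const E).sub h.1, fun j => (lg j).neg, fun φ hφ j => ?_⟩
  have h1 := h.integral_clm (ContinuousLinearMap.id ℝ ℝ) hφ j
  simp only [ContinuousLinearMap.id_apply] at h1
  simp only [mul_sub, mul_neg, integral_neg, neg_neg]
  rw [integral_sub ((isTestFun_pd hφ j).integrable.mul_const E)
    ((isTestFun_pd hφ j).integrable_mul h.1), integral_mul_const, integral_pd_eq_zero hφ, h1]
  ring

theorem theorem6p1
    (V : R3 → ℝ) (gradV : R3 → R3 →L[ℝ] ℝ)
    (A : R3 → R3) (DA : R3 → R3 →L[ℝ] R3)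
    (hV' : HasWeakFDeriv V gradV)
    (hA' : HasWeakFDeriv A DA)
    (hVbdd : ∃ M : ℝ, ∀ x, |V x| ≤ M)
    (hVlim : Tendsto V (cocompact R3) (𝓝 0))
    (hdecay : ∃ C ε : ℝ, 0 < ε ∧ ∀ᵐ x ∂(volume : Measure R3),
      ‖gradV x‖ ≤ C * japaneseBracket x ^ (-1 - ε) ∧
      ‖A x‖ ≤ C * japaneseBracket x ^ (-1 - ε) ∧
      ‖DA x‖ ≤ C * japaneseBracket x ^ (-1 - ε))
    (hdiv : HasWeakDivergence (fun x j => A x j) (fun _ => (0 : ℝ)))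
    (E : ℝ) (hE : 0 < E) :
    ¬ IsMagneticEigenvalue A V E := by
  rintro ⟨ψ, hψ0, hψ, -, Dψ, D2ψ, d, h1, hD, h2, hD2, hd, hH⟩
  apply hψ0
  obtain ⟨M, hM⟩ := hVbdd
  obtain ⟨C, ε, hε, hdec⟩ := hdecay
  have hb : ∀ x, C * japaneseBracket x ^ (-1 - ε) ≤ |C| * japaneseBracket x ^ (-1 - ε) := fun x =>
    mul_le_mul_of_nonneg_right (le_abs_self C) (Real.rpow_nonneg (japaneseBracket_pos x).le _)
  have hb1 : ∀ x, |C| * japaneseBracket x ^ (-1 - ε) ≤ |C| := fun x =>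
    mul_le_of_le_one_right (abs_nonneg C)
      (Real.rpow_le_one_of_one_le_of_nonpos (one_le_japaneseBracket x) (by linarith))
  have hAn : ∀ᵐ x ∂(volume : Measure R3), ‖A x‖ ≤ |C| := by
    filter_upwards [hdec] with x hx using (hx.2.1.trans (hb x)).trans (hb1 x)
  have hAj : ∀ᵐ x ∂(volume : Measure R3), ∀ j, |A x j| ≤ |C| := by
    filter_upwards [hAn] with x hx j using (PiLp.norm_apply_le (A x) j).trans hx
  have hdA := weakDivergence_eq hψ h1 hD h2 hD2 (abs_nonneg C) hAj hdiv hd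
  -- real and imaginary parts
  set T : Fin 2 → ℂ →L[ℝ] ℝ := ![Complex.reCLM, Complex.imCLM] with hT
  have hS := fun i => isSobolevH2_component hψ h1 hD h2 hD2 (T i)
  have hq := hV'.hasWeakGrad_const_sub E
  have hqM : ∀ x, |E - V x| ≤ E + M := fun x => by
    refine (abs_sub _ _).trans ?_
    rw [abs_of_pos hE]
    linarith [hM x]
  have hQ : ∃ R, ∀ᵐ x ∂(volume : Measure R3), R ≤ ‖x‖ →
      3 / 4 * E ≤ (E - V x) + ∑ j, x j * -gradV x (stdVec j) := by
    obtain ⟨R1, -, hR1⟩ := eventually_norm_mul_bracket_le C hε (show 0 < E / 8 by positivity)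
    have hV8 : ∀ᶠ x in cocompact R3, |V x| < E / 8 := by
      have := (hVlim.abs).eventually (gt_mem_nhds (show |(0 : ℝ)| < E / 8 by
        rw [abs_zero]; positivity))
      exact this
    rw [← Metric.cobounded_eq_cocompact, (hasBasis_cobounded_norm).eventually_iff] at hV8
    obtain ⟨R2, -, hR2⟩ := hV8
    refine ⟨max R1 R2, ?_⟩
    filter_upwards [hdec] with x hx hxR
    have a1 := hR1 x ((le_max_left _ _).trans hxR)
    have a2 : |V x| < E / 8 := hR2 (show R2 ≤ ‖x‖ from (le_max_right _ _).trans hxR)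
    have a3 : ∑ j, x j * -gradV x (stdVec j) = -gradV x x := by
      have e : x = ∑ j, x j • stdVec j := by
        ext i
        fin_cases i <;> simp [Fin.sum_univ_three]
      have e' : gradV x x = ∑ j, x j * gradV x (stdVec j) := by
        calc gradV x x = gradV x (∑ j, x j • stdVec j) := congrArg (gradV x) e
          _ = _ := by simp only [map_sum, map_smul, smul_eq_mul]
      simp only [mul_neg, Finset.sum_neg_distrib, e']
    have a4 : |gradV x x| ≤ E / 8 := by
      refine ((gradV x).le_opNorm x).trans (le_trans ?_ a1)
      rw [mul_comm]
      exact mul_le_mul_of_nonneg_left (hx.1.trans (hb x)) (norm_nonneg x)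
    rw [a3]
    linarith [le_abs_self (V x), le_abs_self (gradV x x)]
  have ha : ∀ c > 0, ∃ R, ∀ᵐ x ∂(volume : Measure R3), R ≤ ‖x‖ → ‖x‖ ^ 2 * ‖A x‖ ^ 2 ≤ c := by
    intro c hc
    obtain ⟨R1, -, hR1⟩ := eventually_norm_mul_bracket_le C hε (Real.sqrt_pos.2 hc)
    refine ⟨R1, ?_⟩
    filter_upwards [hdec] with x hx hxR
    have a1 : ‖x‖ * ‖A x‖ ≤ √c :=
      (mul_le_mul_of_nonneg_left (hx.2.1.trans (hb x)) (norm_nonneg x)).trans (hR1 x hxR)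
    rw [← mul_pow, ← Real.sq_sqrt hc.le]
    gcongr
  have hfin := ae_eq_zero_of_virial hS (a := fun x => ‖A x‖ ^ 2) (B := |C| ^ 2) hq hqM hE hQ ha
    (by positivity) (by filter_upwards [hAn] with x hx; gcongr) (by
      filter_upwards [hH, hdA] with x hx hdx
      rw [hdx] at hx
      have e : (∑ j, D2ψ x (stdVec j) (stdVec j)) + ((E - V x : ℝ) : ℂ) * ψ x =
          Complex.I * ∑ j, (A x j : ℂ) * Dψ x (stdVec j) := by
        push_cast
        linear_combination hx
      have e2 : ∀ i, T i (∑ j, D2ψ x (stdVec j) (stdVec j)) + (E - V x) * T i (ψ x) =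
          T i (Complex.I * ∑ j, (A x j : ℂ) * Dψ x (stdVec j)) := fun i => by
        rw [← e, map_add, ← Complex.real_smul, map_smul, smul_eq_mul]
      simp only [e2, Fin.sum_univ_two]
      exact normSq_I_mul_sum_le (A x) fun j => Dψ x (stdVec j))
  filter_upwards [hfin] with x hx
  have hP : 0 ≤ ∑ i, ∑ j, T i (Dψ x (stdVec j)) ^ 2 := by positivity
  have hx : T 0 (ψ x) ^ 2 + T 1 (ψ x) ^ 2 + ∑ i, ∑ j, T i (Dψ x (stdVec j)) ^ 2 = 0 := by
    rw [Fin.sum_univ_two] at hx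
    exact hx
  have r0 : (ψ x).re = 0 := by
    have : T 0 (ψ x) ^ 2 = 0 := by nlinarith [sq_nonneg (T 0 (ψ x)), sq_nonneg (T 1 (ψ x))]
    exact pow_eq_zero_iff (two_ne_zero) |>.1 this
  have r1 : (ψ x).im = 0 := by
    have : T 1 (ψ x) ^ 2 = 0 := by nlinarith [sq_nonneg (T 0 (ψ x)), sq_nonneg (T 1 (ψ x))]
    exact pow_eq_zero_iff (two_ne_zero) |>.1 this
  exact Complex.ext r0 r1
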